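/- **Setting.** For $n=1,2,\dots$ (an asymptotic index) consider a linear mixed model $y=X\beta+Zv+e$ with $X$ of full column rank $p$ less than the number of observations, where $v$ and $e$ are independent with means $0$ and covariance matrices $G=G(\sigma)$, $R=R(\sigma)$, $\sigma=(\sigma_1,\dots,\sigma_s)'\in\Theta$, $s$ fixed; $\Sigma=R+ZGZ'$. (All quantities except $\sigma$ and $s$ may depend on $n$.) Normality is not assumed. The mixed effect $\mu=l'\beta+m'v$ has the BLUP $t(\sigma)=l'\tilde\beta+s(\sigma)'(y-X\tilde\beta)$ with $\tilde\beta=(X'\Sigma^{-1}X)^{-1}X'\Sigma^{-1}y$ and $s(\sigma)=\Sigma^{-1}ZGm$. Let $l(\sigma)=l(\sigma,y)$ be a criterion function (for example the restricted or profile log-likelihood), and put $h=\partial t(\sigma)/\partial\sigma$, $a=\partial l(\sigma)/\partial\sigma$, $F=\partial^2l(\sigma)/\partial\sigma^2$, $H_i=\partial^3l(\sigma)/\partial\sigma_i\partial\sigma^2$, $A=\mathrm E(F)$, let $C$ be the matrix with rows $a'A^{-1}H_i$, and $$\eta(\sigma)=\mathrm E[t(\sigma)-\mu]^2+\mathrm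 E(h'A^{-1}a)^2,\qquad b=\frac{\partial\eta}{\partial\sigma},\qquad B=\frac{\partial^2\eta}{\partial\sigma^2}.$$ Expectations that define functions of $\sigma$ are taken at the same $\sigma$ at which the integrand is evaluated; those of $a_i$, $F_{ij}$, $a_ia_j$, $F_{ij}a_k$, $(H_i)_{jk}a_la_m$ are assumed to exist for every $\sigma\in\Theta^\circ$, the interior of $\Theta$. Let $$\Delta_1(\sigma)=b'A^{-1}\mathrm E(FA^{-1}a),\quad \Delta_2(\sigma)=\tfrac12\mathrm E(a'A^{-1}BA^{-1}a),\quad \Delta_3(\sigma)=-\tfrac12b'A^{-1}\mathrm E(CA^{-1}a).$$ Let $D=\mathrm{diag}(d_1,\dots,d_s)$ with $d_i=d_i(n)>0$, $d_*=\min_id_i\to\infty$, and $S_\delta(\sigma)=\{\tilde\sigma:|\tilde\sigma_i-\sigma_i|\le\delta d_*/d_i,\ 1\le i\le s\}$. Put $Q=D^{-1}AD^{-1}$, $(\lambda_i)=D^{-1}a$, $(\lambda_{ij})=D^{-1/2}(F-A)D^{-1/2}$, $(\lambda_{ijk})_{j,k}=D^{-1}H_iD^{-1}$, $U_1=(\mathrm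 E\lambda_i\lambda_l)$, $U_2=(\mathrm E\lambda_{jk}\lambda_l)$, $U_3=(\mathrm E\lambda_{jkm}\lambda_l\lambda_n)$; $\|\cdot\|$ is the spectral norm of a matrix and the maximum norm of an array. **Assumptions.** Let $\sigma$ be the true value, $g,\delta,c_0,\lambda>0$ be constants with $g>8+4\lambda$, and $\sigma^*\in\Theta$ a given point with $\eta(\sigma^*)=O(d_*^\lambda)$. "Bounded" means bounded in $n$. Suppose: 1. $l(\cdot,y)$ is four times and $\eta$ three times continuously differentiable on $\Theta^\circ$, and $\sigma\in\Theta^\circ$ (if $\Theta$ varies with $n$: $\sigma$ is interior to the intersection of these sets); 2. $-\infty<\limsup_n\lambda_{\max}(D^{-1}AD^{-1})<0$ at $\sigma$; 3. the $g$th moments (under $\sigma$) of the following are bounded for all $1\le i,j,k,r\le s$: $$\frac{|a_i|}{d_i},\quad\frac{|F_{ij}-\mathrm EF_{ij}|}{\sqrt{d_id_j}},\quad\frac{d_*}{d_id_jd_k}\sup_{\tilde\sigma\in S_\delta(\sigma)}\Bigl|\frac{\partial^3l(\tilde\sigma)}{\partial\sigma_i\partial\sigma_j\partial\sigma_k}\Bigr|,$$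 $$\frac{|(H_i)_{jk}-\mathrm E(H_i)_{jk}|}{\sqrt{d_jd_k}},\quad\frac{|(H_i)_{jk}|}{d_jd_k},\quad\frac{d_*^2}{d_id_jd_kd_r}\sup_{\tilde\sigma\in S_\delta(\sigma)}\Bigl|\frac{\partial^4l(\tilde\sigma)}{\partial\sigma_i\partial\sigma_j\partial\sigma_k\partial\sigma_r}\Bigr|;$$ 4. $\eta(\sigma)$, $|b|$, $\|B\|$ and $\sup_{\tilde\sigma\in S_\delta(\sigma)}|\partial^3\eta(\tilde\sigma)/\partial\sigma_i\partial\sigma_j\partial\sigma_k|$ are bounded; 5. $\sup_{\tilde\sigma\in S_{\delta'}(\sigma)}\|Q(\tilde\sigma)-Q(\sigma)\|\to0$ and $\sup_{\tilde\sigma\in S_{\delta'}(\sigma)}\|U_j(\tilde\sigma)-U_j(\sigma)\|\to0$, $j=1,2,3$, as $\delta'\to0$, uniformly in $n$; 6. $\mathrm E(a)=0$ at every point of $\Theta^\circ$ (as is the case for REML). **Conclusion.** Call a sequence of estimators $\hat\sigma=\hat\sigma(y)$ *admissible* if for every $0<\rho<1$ there are events $\mathcal B$ and a constant $c$ with $\mathrm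 P(\mathcal B^c)\le c\,d_*^{-\tau g}$, $\tau=\frac14\wedge(1-\rho)$, such that for large $n$, on $\mathcal B$, $\hat\sigma\in\Theta$, $\partial l(\hat\sigma)/\partial\sigma=0$ and $|D(\hat\sigma-\sigma)|<d_*^{1-\rho}$. Admissible $\hat\sigma$ (with values in $\Theta^\circ$) exist. For every admissible $\hat\sigma$ let $$\hat\eta=\eta(\hat\sigma)-\sum_{j=1}^3\Delta_j(\hat\sigma)$$ if the absolute value of the right-hand side is at most $c_0d_*^\lambda$, and $\hat\eta=\eta(\sigma^*)$ otherwise. Then $\hat\eta$ (assumed measurable) is integrable and $$\mathrm E(\hat\eta)=\eta(\sigma)+o(d_*^{-2}).$$ -/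

import Mathlib

open MeasureTheory Filter Topology Asymptotics
open scoped ENNReal NNReal Matrix

noncomputable section

namespace EBLUP

/-- The space of dispersion parameters `σ = (σ₁, …, σₛ)`, with the Euclidean norm. -/
abbrev Par (s : ℕ) : Type := EuclideanSpace ℝ (Fin s)

/-- The partial derivative `∂f/∂σᵢ`. -/
def pd {s : ℕ} (i : Fin s) (f : Par s → ℝ) (σ : Par s) : ℝ :=
  fderiv ℝ f σ (EuclideanSpace.single i 1)

/-- The spectral norm `‖B‖ = [λ_max(B'B)]^{1/2}`, i.e. the operator norm for Euclidean norms. -/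
def specNorm {s : ℕ} (B : Matrix (Fin s) (Fin s) ℝ) : ℝ :=
  ‖Matrix.toEuclideanCLM (n := Fin s) (𝕜 := ℝ) B‖

/-- The largest (real) eigenvalue. -/
def lamMax {s : ℕ} (B : Matrix (Fin s) (Fin s) ℝ) : ℝ := sSup (spectrum ℝ B)

/-- A general linear mixed model `y = Xβ + Zv + e` with `N` observations, together with the mixed
effect `μ = l'β + m'v` to be predicted.  The random vectors `v` and `e` are independent, with
mean zero and covariance matrices `G(σ)` and `R(σ)` for `σ ∈ Θ`; normality is not assumed.
The laws at `σ ∉ Θ` are irrelevant. -/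
structure MixedModel (s : ℕ) where
  N : ℕ
  p : ℕ
  r : ℕ
  X : Matrix (Fin N) (Fin p) ℝ
  Z : Matrix (Fin N) (Fin r) ℝ
  β : Fin p → ℝ
  Θ : Set (Par s)
  G : Par s → Matrix (Fin r) (Fin r) ℝ
  R : Par s → Matrix (Fin N) (Fin N) ℝ
  vLaw : Par s → Measure (Fin r → ℝ)
  eLaw : Par s → Measure (Fin N → ℝ)
  l : Fin p → ℝ
  m : Fin r → ℝ
  p_lt : p < N
  rank_X : X.rank = p
  vLaw_prob : ∀ σ, IsProbabilityMeasure (vLaw σ)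
  eLaw_prob : ∀ σ, IsProbabilityMeasure (eLaw σ)
  v_memLp : ∀ σ ∈ Θ, ∀ i, MemLp (fun v : Fin r → ℝ => v i) 2 (vLaw σ)
  e_memLp : ∀ σ ∈ Θ, ∀ i, MemLp (fun e : Fin N → ℝ => e i) 2 (eLaw σ)
  v_mean : ∀ σ ∈ Θ, ∀ i, ∫ v, v i ∂(vLaw σ) = 0
  e_mean : ∀ σ ∈ Θ, ∀ i, ∫ e, e i ∂(eLaw σ) = 0
  v_cov : ∀ σ ∈ Θ, ∀ i j, ∫ v, v i * v j ∂(vLaw σ) = G σ i j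
  e_cov : ∀ σ ∈ Θ, ∀ i j, ∫ e, e i * e j ∂(eLaw σ) = R σ i j

namespace MixedModel

variable {s : ℕ} (M : MixedModel s)

/-- The joint law of `(v, e)` at `σ`. -/
def veLaw (σ : Par s) : Measure ((Fin M.r → ℝ) × (Fin M.N → ℝ)) :=
  (M.vLaw σ).prod (M.eLaw σ)

/-- The observation vector `y = Xβ + Zv + e`. -/
def obs (w : (Fin M.r → ℝ) × (Fin M.N → ℝ)) : Fin M.N → ℝ :=
  M.X *ᵥ M.β + M.Z *ᵥ w.1 + w.2

/-- The law of `y` at `σ`. -/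
def law (σ : Par s) : Measure (Fin M.N → ℝ) := (M.veLaw σ).map M.obs

/-- `Σ = cov(y) = R + ZGZ'`. -/
def Sig (σ : Par s) : Matrix (Fin M.N) (Fin M.N) ℝ := M.R σ + M.Z * M.G σ * M.Zᵀ

/-- `β̃(σ) = (X'Σ⁻¹X)⁻¹X'Σ⁻¹y`. -/
def betaTilde (σ : Par s) (y : Fin M.N → ℝ) : Fin M.p → ℝ :=
  ((M.Xᵀ * (M.Sig σ)⁻¹ * M.X)⁻¹ * M.Xᵀ * (M.Sig σ)⁻¹) *ᵥ y

/-- `s(σ) = Σ⁻¹ZGm`. -/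
def sVec (σ : Par s) : Fin M.N → ℝ := ((M.Sig σ)⁻¹ * M.Z * M.G σ) *ᵥ M.m

/-- The BLUP `t(σ) = l'β̃ + s(σ)'(y - Xβ̃)`. -/
def blup (σ : Par s) (y : Fin M.N → ℝ) : ℝ :=
  M.l ⬝ᵥ M.betaTilde σ y + M.sVec σ ⬝ᵥ (y - M.X *ᵥ M.betaTilde σ y)

/-- `MSE[t(σ)] = E[t(σ) - μ]²`, the expectation being taken at `σ`. -/
def mseBlup (σ : Par s) : ℝ :=
  ∫ w, (M.blup σ (M.obs w) - (M.l ⬝ᵥ M.β + M.m ⬝ᵥ w.1)) ^ 2 ∂(M.veLaw σ)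

/-- `h = ∂t(σ)/∂σ`. -/
def hVec (σ : Par s) (y : Fin M.N → ℝ) : Fin s → ℝ := fun i => pd i (fun τ => M.blup τ y) σ

variable (ℓ : Par s → (Fin M.N → ℝ) → ℝ)

/-- `a = ∂l(σ)/∂σ`, where `ℓ σ y` is the criterion function `l(σ, y)`. -/
def aVec (σ : Par s) (y : Fin M.N → ℝ) : Fin s → ℝ := fun i => pd i (fun τ => ℓ τ y) σ

/-- `F = ∂²l(σ)/∂σ²`. -/
def FMat (σ : Par s) (y : Fin M.N → ℝ) : Matrix (Fin s) (Fin s) ℝ :=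
  Matrix.of fun i j => pd i (pd j (fun τ => ℓ τ y)) σ

/-- `Hᵢ = ∂³l(σ)/∂σᵢ∂σ²`. -/
def HMat (i : Fin s) (σ : Par s) (y : Fin M.N → ℝ) : Matrix (Fin s) (Fin s) ℝ :=
  Matrix.of fun j k => pd i (pd j (pd k (fun τ => ℓ τ y))) σ

/-- `A(σ) = E[∂²l(σ)/∂σ²]`; here and below the expectation is taken at the same `σ` at which the
function is evaluated. -/
def AMat (σ : Par s) : Matrix (Fin s) (Fin s) ℝ :=
  Matrix.of fun i j => ∫ y, M.FMat ℓ σ y i j ∂(M.law σ)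

/-- The second-order approximation `η(σ) = MSE[t(σ)] + E(h'A⁻¹a)²` of the MSE of the EBLUP. -/
def eta (σ : Par s) : ℝ :=
  M.mseBlup σ +
    ∫ y, (M.hVec σ y ⬝ᵥ ((M.AMat ℓ σ)⁻¹ *ᵥ M.aVec ℓ σ y)) ^ 2 ∂(M.law σ)

/-- `b = ∂η(σ)/∂σ`. -/
def bVec (σ : Par s) : Fin s → ℝ := fun i => pd i (M.eta ℓ) σ

/-- `B = ∂²η(σ)/∂σ²`. -/
def BMat (σ : Par s) : Matrix (Fin s) (Fin s) ℝ :=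
  Matrix.of fun i j => pd i (pd j (M.eta ℓ)) σ

/-- `C`, the matrix whose `i`-th row is `a'A⁻¹Hᵢ`. -/
def CMat (σ : Par s) (y : Fin M.N → ℝ) : Matrix (Fin s) (Fin s) ℝ :=
  Matrix.of fun i => M.aVec ℓ σ y ᵥ* ((M.AMat ℓ σ)⁻¹ * M.HMat ℓ i σ y)

/-- `Δ₁(σ) = b'A⁻¹E(FA⁻¹a)`. -/
def Delta1 (σ : Par s) : ℝ :=
  M.bVec ℓ σ ⬝ᵥ ((M.AMat ℓ σ)⁻¹ *ᵥ
    fun i => ∫ y, (M.FMat ℓ σ y *ᵥ ((M.AMat ℓ σ)⁻¹ *ᵥ M.aVec ℓ σ y)) i ∂(M.law σ))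

/-- `Δ₂(σ) = ½ E(a'A⁻¹BA⁻¹a)`. -/
def Delta2 (σ : Par s) : ℝ :=
  (1 / 2 : ℝ) * ∫ y, M.aVec ℓ σ y ⬝ᵥ
    (((M.AMat ℓ σ)⁻¹ * M.BMat ℓ σ * (M.AMat ℓ σ)⁻¹) *ᵥ M.aVec ℓ σ y) ∂(M.law σ)

/-- `Δ₃(σ) = -½ b'A⁻¹E(CA⁻¹a)`. -/
def Delta3 (σ : Par s) : ℝ :=
  -(1 / 2 : ℝ) * (M.bVec ℓ σ ⬝ᵥ ((M.AMat ℓ σ)⁻¹ *ᵥ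
    fun i => ∫ y, (M.CMat ℓ σ y *ᵥ ((M.AMat ℓ σ)⁻¹ *ᵥ M.aVec ℓ σ y)) i ∂(M.law σ)))

/-- `η(σ) - ∑_{j=1}^3 Δⱼ(σ)`: the bias correction without the term `Δ₀`. -/
def corrected (σ : Par s) : ℝ :=
  M.eta ℓ σ - (M.Delta1 ℓ σ + M.Delta2 ℓ σ + M.Delta3 ℓ σ)

/-- `Q(σ) = D⁻¹AD⁻¹` with `D = diag(d₁, …, dₛ)`. -/
def QMat (d : Fin s → ℝ) (σ : Par s) : Matrix (Fin s) (Fin s) ℝ :=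
  (Matrix.diagonal d)⁻¹ * M.AMat ℓ σ * (Matrix.diagonal d)⁻¹

/-- The entries `λᵢ` of `D⁻¹a`. -/
def lam1 (d : Fin s → ℝ) (σ : Par s) (y : Fin M.N → ℝ) (i : Fin s) : ℝ :=
  M.aVec ℓ σ y i / d i

/-- The entries `λᵢⱼ` of `D^{-1/2}(F - A)D^{-1/2}`. -/
def lam2 (d : Fin s → ℝ) (σ : Par s) (y : Fin M.N → ℝ) (i j : Fin s) : ℝ :=
  (M.FMat ℓ σ y i j - M.AMat ℓ σ i j) / Real.sqrt (d i * d j)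

/-- The entries `λᵢⱼₖ` of `D⁻¹HᵢD⁻¹`. -/
def lam3 (d : Fin s → ℝ) (σ : Par s) (y : Fin M.N → ℝ) (i j k : Fin s) : ℝ :=
  M.HMat ℓ i σ y j k / (d j * d k)

/-- `U₁ = (u_{il})`, `u_{il} = E(λᵢλₗ)`. -/
def U1 (d : Fin s → ℝ) (σ : Par s) : Matrix (Fin s) (Fin s) ℝ :=
  Matrix.of fun i l => ∫ y, M.lam1 ℓ d σ y i * M.lam1 ℓ d σ y l ∂(M.law σ)

/-- `U₂ = (u_{jkl})`, `u_{jkl} = E(λⱼₖλₗ)`; the norm of this function space is the maximum of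
the absolute values of the entries. -/
def U2 (d : Fin s → ℝ) (σ : Par s) : Fin s → Fin s → Fin s → ℝ :=
  fun j k l => ∫ y, M.lam2 ℓ d σ y j k * M.lam1 ℓ d σ y l ∂(M.law σ)

/-- `U₃ = (u_{jklmn})`, `u_{jklmn} = E(λⱼₖₘλₗλₙ)`, again with the maximum norm. -/
def U3 (d : Fin s → ℝ) (σ : Par s) : Fin s → Fin s → Fin s → Fin s → Fin s → ℝ :=
  fun j k l m n =>
    ∫ y, M.lam3 ℓ d σ y j k m * M.lam1 ℓ d σ y l * M.lam1 ℓ d σ y n ∂(M.law σ)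

end MixedModel

/-- `d_* = min_i d_i`. -/
def dStar {s : ℕ} (d : Fin s → ℝ) : ℝ := ⨅ i, d i

/-- `S_δ(σ) = {σ̃ : |σ̃ᵢ - σᵢ| ≤ δ d_*/dᵢ, 1 ≤ i ≤ s}`. -/
def SBox {s : ℕ} (d : Fin s → ℝ) (δ : ℝ) (σ : Par s) : Set (Par s) :=
  {τ | ∀ i, |τ i - σ i| ≤ δ * dStar d / d i}

/-- The truncated estimator `η̂` as a function of the value of `σ̂`: it is
`η(σ̂) - ∑_{j=1}^3 Δⱼ(σ̂)` if this is at most `c₀ d_*^lam` in absolute value,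
and `η(σ*)` otherwise. -/
def etaHat {s : ℕ} (M : MixedModel s) (ℓ : Par s → (Fin M.N → ℝ) → ℝ) (d : Fin s → ℝ)
    (c₀ lam : ℝ) (σstar : Par s) (σhat : Par s) : ℝ :=
  if |M.corrected ℓ σhat| ≤ c₀ * dStar d ^ lam then M.corrected ℓ σhat else M.eta ℓ σstar

variable {s : ℕ} (M : ℕ → MixedModel s) (ℓ : ∀ n, Par s → (Fin (M n).N → ℝ) → ℝ)
  (d : ℕ → Fin s → ℝ) (σ₀ : Par s)

/-- The `g`-th moments at the true `σ₀` of the nonnegative quantities `f n` are bounded in `n`. -/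
def MomentBdd (g : ℝ) (f : ∀ n, (Fin (M n).N → ℝ) → ℝ≥0∞) : Prop :=
  ∃ K : ℝ≥0, ∀ n, ∫⁻ y, f n y ^ g ∂((M n).law σ₀) ≤ K

/-- `sup_{σ̃ ∈ S_δ(σ₀)} f n σ̃ → 0` as `δ → 0`, uniformly in `n`. -/
def UnifSmall (f : ℕ → Par s → ℝ) : Prop :=
  ∀ ε > 0, ∃ δ > 0, ∀ n, ∀ τ ∈ SBox (d n) δ σ₀, f n τ ≤ ε

/-- The conditions for the asymptotic representation of `σ̂ - σ` at the true value `σ₀`.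
The parameter spaces may vary with `n`; the neighbourhood of `σ₀` in them may not. -/
structure ScoreConditions (g δ : ℝ) : Prop where
  measurable_crit : ∀ n, ∀ σ ∈ interior (M n).Θ, Measurable (ℓ n σ)
  smooth : ∀ n y, ContDiffOn ℝ 3 (fun σ => ℓ n σ y) (interior (M n).Θ)
  mem_interior : σ₀ ∈ interior (⋂ n, (M n).Θ)
  d_pos : ∀ n i, 0 < d n i
  dStar_tendsto : Tendsto (fun n => dStar (d n)) atTop atTop
  limsup_gt : ⊥ < limsup (fun n => ((lamMax ((M n).QMat (ℓ n) (d n) σ₀) : ℝ) : EReal)) atTop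
  limsup_lt : limsup (fun n => ((lamMax ((M n).QMat (ℓ n) (d n) σ₀) : ℝ) : EReal)) atTop < 0
  g_pos : 0 < g
  δ_pos : 0 < δ
  moment1 : ∀ i, MomentBdd M σ₀ g fun n y =>
    ENNReal.ofReal (1 / d n i * |(M n).aVec (ℓ n) σ₀ y i|)
  moment2 : ∀ i j, MomentBdd M σ₀ g fun n y =>
    ENNReal.ofReal (1 / Real.sqrt (d n i * d n j) *
      |(M n).FMat (ℓ n) σ₀ y i j - ∫ y', (M n).FMat (ℓ n) σ₀ y' i j ∂((M n).law σ₀)|)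
  moment3 : ∀ i j k, MomentBdd M σ₀ g fun n y =>
    ENNReal.ofReal (dStar (d n) / (d n i * d n j * d n k)) *
      ⨆ τ ∈ SBox (d n) δ σ₀, ENNReal.ofReal |pd i (pd j (pd k (fun σ => ℓ n σ y))) τ|

/-- The regularity conditions for the estimation of the MSE, except for the one on `E(a)`. -/
structure MSEConditions (g δ lam : ℝ) : Prop where
  eta_smooth : ∀ n, ContDiffOn ℝ 3 ((M n).eta (ℓ n)) (interior (M n).Θ)
  eta_bdd : ∃ K : ℝ, ∀ n, |(M n).eta (ℓ n) σ₀| ≤ K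
  b_bdd : ∃ K : ℝ, ∀ n, ‖WithLp.toLp 2 ((M n).bVec (ℓ n) σ₀)‖ ≤ K
  B_bdd : ∃ K : ℝ, ∀ n, specNorm ((M n).BMat (ℓ n) σ₀) ≤ K
  eta3_bdd : ∃ K : ℝ, ∀ n, ∀ τ ∈ SBox (d n) δ σ₀, ∀ i j k,
    |pd i (pd j (pd k ((M n).eta (ℓ n)))) τ| ≤ K
  score : ScoreConditions M ℓ d σ₀ g δ
  g_gt : 8 + 4 * lam < g
  smooth4 : ∀ n y, ContDiffOn ℝ 4 (fun σ => ℓ n σ y) (interior (M n).Θ)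
  moment_centered : ∀ i j k, MomentBdd M σ₀ g fun n y =>
    ENNReal.ofReal (1 / Real.sqrt (d n j * d n k) *
      |(M n).HMat (ℓ n) i σ₀ y j k - ∫ y', (M n).HMat (ℓ n) i σ₀ y' j k ∂((M n).law σ₀)|)
  moment_third : ∀ i j k, MomentBdd M σ₀ g fun n y =>
    ENNReal.ofReal (1 / (d n j * d n k) * |(M n).HMat (ℓ n) i σ₀ y j k|)
  moment_fourth : ∀ i j k l, MomentBdd M σ₀ g fun n y =>
    ENNReal.ofReal (dStar (d n) ^ 2 / (d n i * d n j * d n k * d n l)) *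
      ⨆ τ ∈ SBox (d n) δ σ₀, ENNReal.ofReal |pd i (pd j (pd k (pd l (fun σ => ℓ n σ y)))) τ|
  Q_cont : UnifSmall d σ₀ fun n τ =>
    specNorm ((M n).QMat (ℓ n) (d n) τ - (M n).QMat (ℓ n) (d n) σ₀)
  U1_cont : UnifSmall d σ₀ fun n τ =>
    specNorm ((M n).U1 (ℓ n) (d n) τ - (M n).U1 (ℓ n) (d n) σ₀)
  U2_cont : UnifSmall d σ₀ fun n τ => ‖(M n).U2 (ℓ n) (d n) τ - (M n).U2 (ℓ n) (d n) σ₀‖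
  U3_cont : UnifSmall d σ₀ fun n τ => ‖(M n).U3 (ℓ n) (d n) τ - (M n).U3 (ℓ n) (d n) σ₀‖

/-- The expectations which enter `E(a)`, `A`, `U₁`, `U₂`, `U₃` and `Δ₁`, `Δ₂`, `Δ₃` exist. -/
structure ExpectationsExist : Prop where
  int_a : ∀ n, ∀ σ ∈ interior (M n).Θ, ∀ i,
    Integrable (fun y => (M n).aVec (ℓ n) σ y i) ((M n).law σ)
  int_F : ∀ n, ∀ σ ∈ interior (M n).Θ, ∀ i j,
    Integrable (fun y => (M n).FMat (ℓ n) σ y i j) ((M n).law σ)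
  int_aa : ∀ n, ∀ σ ∈ interior (M n).Θ, ∀ i j,
    Integrable (fun y => (M n).aVec (ℓ n) σ y i * (M n).aVec (ℓ n) σ y j) ((M n).law σ)
  int_Fa : ∀ n, ∀ σ ∈ interior (M n).Θ, ∀ i j k,
    Integrable (fun y => (M n).FMat (ℓ n) σ y i j * (M n).aVec (ℓ n) σ y k) ((M n).law σ)
  int_Haa : ∀ n, ∀ σ ∈ interior (M n).Θ, ∀ i j k l m,
    Integrable (fun y => (M n).HMat (ℓ n) i σ y j k * (M n).aVec (ℓ n) σ y l *
      (M n).aVec (ℓ n) σ y m) ((M n).law σ)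

/-- `σ̂` is an estimator of the kind considered: for every `0 < ρ < 1` there are events `B n` with
`P(B nᶜ) ≤ c d_*^{-τg}`, `τ = (1/4) ∧ (1 - ρ)`, such that for large `n` and on `B n` one has
`σ̂ ∈ Θ`, `∂l(σ̂)/∂σ = 0` and `|D(σ̂ - σ)| < d_*^{1-ρ}`. -/
structure IsScoreRoot (g : ℝ) (σhat : ∀ n, (Fin (M n).N → ℝ) → Par s) : Prop where
  measurable : ∀ n, Measurable (σhat n)
  root : ∀ ρ : ℝ, 0 < ρ → ρ < 1 →
    ∃ B : ∀ n, Set (Fin (M n).N → ℝ),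
      (∀ n, MeasurableSet (B n)) ∧
      (∀ᶠ n in atTop, ∀ y ∈ B n,
        σhat n y ∈ (M n).Θ ∧
        (∀ i, (M n).aVec (ℓ n) (σhat n y) y i = 0) ∧
        Real.sqrt (∑ i, (d n i * (σhat n y i - σ₀ i)) ^ 2) < dStar (d n) ^ (1 - ρ)) ∧
      ∃ c : ℝ, ∀ n, (M n).law σ₀ (B n)ᶜ ≤
        ENNReal.ofReal (c * dStar (d n) ^ (-(min (1 / 4) (1 - ρ) * g)))

end EBLUP

end

/-! The scaled error x = D(σ̂ − σ) solves 0 = λ + (Q + L)x + ½h(x, x) + remainder, where λ and Q are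
the standardized score and mean Hessian at σ, while the centred Hessian L and the third derivatives
h carry a factor 1/d_*. As Q is uniformly negative definite, the equation can be solved by
substitution: with P = Q⁻¹ and z = −Pλ, one finds x ≈ z − PLz − ½Ph(z, z) (`abs_sub_expansion_le`).
Inserted into the second-order Taylor polynomial of η this gives η(σ̂) − η(σ) ≈ T, where T
(`leadTerm`) is a polynomial in the standardized derivatives at the true value
(`abs_eta_sub_leadTerm_le`).

The linear part of T has mean zero because E(a) = 0, and the means of its other three parts are
exactly Δ₁, Δ₂, Δ₃ at σ (`integral_leadTerm`). So Δ₁ + Δ₂ + Δ₃ is the bias of η(σ̂) to order d_*⁻².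
Each Δⱼ is a polynomial in b, B, P and the moment arrays U₁, U₂, U₃, with weights of size at most
d_*⁻². By the continuity assumptions, evaluating it at σ̂ instead of σ costs only ε d_*⁻²
(`MSEConditions.exists_closeAt`, `CloseAt.correction`). Subtracting the corrections therefore
removes the bias.

To pass to expectations, take ρ = 3/4. On the event of admissibility |x| ≤ d_*^{1/4}, so the
remainder is an envelope W of the derivatives, cubed, times d_*^{-9/4}. Off the event, of
probability O(d_*^{-g/4}), the truncation bounds η̂ by a multiple of d_*^λ, and g > 8 + 4λ makes the
product o(d_*⁻²). The part of T off the event is controlled by the sixth moment of W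
(`abs_integral_le_of_split`).

Admissible estimators exist because a simplified Newton iteration with the fixed matrix Q is a
contraction whenever the standardized derivatives are of moderate size (`chordRoot_spec`). Markov's
inequality for the gth moments bounds the probability that they are not. -/

noncomputable section

namespace EBLUP

/-! ### Partial derivatives: symmetry, mean value and Taylor estimates. -/

section Calculus

variable {s : ℕ} {f : Par s → ℝ} {U S : Set (Par s)}

lemma ContDiffOn.pd_of_isOpen (hU : IsOpen U) {m n : WithTop ℕ∞} (hf : ContDiffOn ℝ n f U)
    (h : m + 1 ≤ n) (i : Fin s) : ContDiffOn ℝ m (pd i f) U :=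
  (hf.fderiv_of_isOpen hU h).clm_apply contDiffOn_const

lemma fderiv_eq_sum_pd (f : Par s → ℝ) (τ u : Par s) :
    fderiv ℝ f τ u = ∑ i, u i * pd i f τ := by
  have hu : u = ∑ i, u i • EuclideanSpace.single i (1 : ℝ) := by
    ext j
    simp [Finset.sum_apply, Pi.single_apply]
  conv_lhs => rw [hu]
  simp [map_sum, pd]

lemma pd_congr_of_eqOn {g : Par s → ℝ} (hU : IsOpen U) (h : Set.EqOn f g U) (i : Fin s)
    {τ : Par s} (hτ : τ ∈ U) : pd i f τ = pd i g τ := by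
  unfold pd
  rw [Filter.EventuallyEq.fderiv_eq (h.eventuallyEq_of_mem (hU.mem_nhds hτ))]

lemma pd_comm (hU : IsOpen U) (hf : ContDiffOn ℝ 2 f U) (i j : Fin s) {τ : Par s} (hτ : τ ∈ U) :
    pd i (pd j f) τ = pd j (pd i f) τ := by
  have hat : ContDiffAt ℝ 2 f τ := hf.contDiffAt (hU.mem_nhds hτ)
  have hd : DifferentiableAt ℝ (fderiv ℝ f) τ :=
    (hat.fderiv_right (m := 1) (by norm_num)).differentiableAt (by norm_num)
  have key : ∀ i j : Fin s, pd i (pd j f) τ =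
      fderiv ℝ (fderiv ℝ f) τ (EuclideanSpace.single i 1) (EuclideanSpace.single j 1) := by
    intro i j
    have : HasFDerivAt (fun x => fderiv ℝ f x (EuclideanSpace.single j (1 : ℝ)))
        ((fderiv ℝ (fderiv ℝ f) τ).flip (EuclideanSpace.single j 1)) τ := by
      simpa using hd.hasFDerivAt.clm_apply
        (hasFDerivAt_const (EuclideanSpace.single j (1 : ℝ)) τ)
    change fderiv ℝ (fun x => fderiv ℝ f x (EuclideanSpace.single j (1 : ℝ))) τ _ = _
    rw [this.fderiv]
    rfl
  rw [key, key]
  exact (hat.isSymmSndFDerivAt (by simp)).eq _ _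

lemma hasDerivAt_segment {τ u : Par s} {t : ℝ} (hf : DifferentiableAt ℝ f (τ + t • u)) :
    HasDerivAt (fun t : ℝ => f (τ + t • u)) (∑ i, u i * pd i f (τ + t • u)) t := by
  rw [← fderiv_eq_sum_pd]
  have h1 : HasDerivAt (fun t : ℝ => τ + t • u) u t := by
    simpa using ((hasDerivAt_id t).smul_const u).const_add τ
  exact hf.hasFDerivAt.comp_hasDerivAt t h1

/-- A mean value inequality with separate bounds for the partial derivatives. -/
lemma abs_sub_le_sum_of_pd_le (hU : IsOpen U) (hSU : S ⊆ U) (hS : Convex ℝ S)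
    (hf : DifferentiableOn ℝ f U) {K : Fin s → ℝ} (hK : ∀ τ ∈ S, ∀ i, |pd i f τ| ≤ K i)
    {σ τ : Par s} (hσ : σ ∈ S) (hτ : τ ∈ S) :
    |f τ - f σ| ≤ ∑ i, |τ i - σ i| * K i := by
  have h := norm_image_sub_le_of_norm_deriv_le_segment_01'
    (f := fun t : ℝ => f (σ + t • (τ - σ)))
    (f' := fun t => ∑ i, (τ - σ) i * pd i f (σ + t • (τ - σ)))
    (C := ∑ i, |τ i - σ i| * K i)
    (fun t ht => (hasDerivAt_segment (hf.differentiableAt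
      (hU.mem_nhds (hSU (hS.add_smul_sub_mem hσ hτ ht))))).hasDerivWithinAt)
    (fun t ht => by
      refine (Finset.abs_sum_le_sum_abs _ _).trans (Finset.sum_le_sum fun i _ => ?_)
      rw [abs_mul]
      exact mul_le_mul_of_nonneg_left
        (hK _ (hS.add_smul_sub_mem hσ hτ (Set.Ico_subset_Icc_self ht)) i) (abs_nonneg _))
  simpa using h

/-- A one-dimensional third order Taylor estimate on `[0, 1]`. -/
lemma abs_taylor_two_le {φ φ₁ φ₂ φ₃ : ℝ → ℝ} {K : ℝ}
    (h₁ : ∀ t ∈ Set.Icc (0 : ℝ) 1, HasDerivAt φ (φ₁ t) t)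
    (h₂ : ∀ t ∈ Set.Icc (0 : ℝ) 1, HasDerivAt φ₁ (φ₂ t) t)
    (h₃ : ∀ t ∈ Set.Icc (0 : ℝ) 1, HasDerivAt φ₂ (φ₃ t) t)
    (hK : ∀ t ∈ Set.Icc (0 : ℝ) 1, |φ₃ t| ≤ K) :
    |φ 1 - φ 0 - φ₁ 0 - 1 / 2 * φ₂ 0| ≤ K := by
  have K0 : 0 ≤ K := (abs_nonneg _).trans (hK 0 (by simp))
  -- The bound on `φ₃` is integrated three times. Factors t ≤ 1 are simply dropped, so the constant
  -- is K instead of the sharp K/6.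
  have b₂ : ∀ t ∈ Set.Icc (0 : ℝ) 1, |φ₂ t - φ₂ 0| ≤ K := by
    intro t ht
    have := norm_image_sub_le_of_norm_deriv_le_segment' (f := φ₂) (f' := φ₃) (C := K)
      (fun t ht => (h₃ t ht).hasDerivWithinAt)
      (fun t ht => hK t (Set.Ico_subset_Icc_self ht)) t ht
    refine this.trans ?_
    nlinarith [ht.1, ht.2]
  have b₁ : ∀ t ∈ Set.Icc (0 : ℝ) 1, |φ₁ t - φ₁ 0 - t * φ₂ 0| ≤ K := by
    intro t ht
    have := norm_image_sub_le_of_norm_deriv_le_segment' (f := fun t => φ₁ t - t * φ₂ 0)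
      (f' := fun t => φ₂ t - φ₂ 0) (C := K)
      (fun t ht => ((h₂ t ht).sub (by simpa using (hasDerivAt_id t).mul_const (φ₂ 0))).hasDerivWithinAt)
      (fun t ht => b₂ t (Set.Ico_subset_Icc_self ht)) t ht
    have h' : φ₁ t - φ₁ 0 - t * φ₂ 0 = (φ₁ t - t * φ₂ 0) - (φ₁ 0 - 0 * φ₂ 0) := by ring
    rw [h']
    refine this.trans ?_
    nlinarith [ht.1, ht.2]
  have := norm_image_sub_le_of_norm_deriv_le_segment_01'
    (f := fun t => φ t - t * φ₁ 0 - 1 / 2 * t ^ 2 * φ₂ 0)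
    (f' := fun t => φ₁ t - φ₁ 0 - t * φ₂ 0) (C := K)
    (fun t ht => by
      have e1 : HasDerivAt (fun t : ℝ => t * φ₁ 0) (φ₁ 0) t := by
        simpa using (hasDerivAt_id t).mul_const (φ₁ 0)
      have e2 : HasDerivAt (fun t : ℝ => 1 / 2 * t ^ 2 * φ₂ 0) (t * φ₂ 0) t := by
        exact (((hasDerivAt_pow 2 t).const_mul (1 / 2 : ℝ)).mul_const (φ₂ 0)).congr_deriv
          (by norm_num; left; ring)
      exact (((h₁ t ht).sub e1).sub e2).hasDerivWithinAt)
    (fun t ht => b₁ t (Set.Ico_subset_Icc_self ht))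
  have h' : φ 1 - φ 0 - φ₁ 0 - 1 / 2 * φ₂ 0 =
    (φ 1 - 1 * φ₁ 0 - 1 / 2 * 1 ^ 2 * φ₂ 0) - (φ 0 - 0 * φ₁ 0 - 1 / 2 * 0 ^ 2 * φ₂ 0) := by ring
  rw [h']
  exact this

/-- The one-dimensional estimate along the segment from σ to τ. The bound `K` depends on the indices
because each coordinate has its own scale dᵢ, and the factors |τᵢ − σᵢ| must be paired with the
matching scales. -/
lemma abs_taylor_pd_le (hU : IsOpen U) (hSU : S ⊆ U) (hS : Convex ℝ S)
    (hf : ContDiffOn ℝ 3 f U) {K : Fin s → Fin s → Fin s → ℝ}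
    (hK : ∀ τ ∈ S, ∀ i j k, |pd k (pd j (pd i f)) τ| ≤ K i j k)
    {σ τ : Par s} (hσ : σ ∈ S) (hτ : τ ∈ S) :
    |f τ - f σ - ∑ i, (τ i - σ i) * pd i f σ
        - 1 / 2 * ∑ i, (τ i - σ i) * ∑ j, (τ j - σ j) * pd j (pd i f) σ|
      ≤ ∑ i, |τ i - σ i| * ∑ j, |τ j - σ j| * ∑ k, |τ k - σ k| * K i j k := by
  have hf1 : ∀ i, ContDiffOn ℝ 2 (pd i f) U :=
    fun i => ContDiffOn.pd_of_isOpen hU hf (by norm_num) i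
  have hf2 : ∀ i j, ContDiffOn ℝ 1 (pd j (pd i f)) U :=
    fun i j => ContDiffOn.pd_of_isOpen hU (hf1 i) (by norm_num) j
  have mem : ∀ t ∈ Set.Icc (0 : ℝ) 1, U ∈ 𝓝 (σ + t • (τ - σ)) := fun t ht =>
    hU.mem_nhds (hSU (hS.add_smul_sub_mem hσ hτ ht))
  have := abs_taylor_two_le (φ := fun t : ℝ => f (σ + t • (τ - σ)))
    (φ₁ := fun t => ∑ i, (τ - σ) i * pd i f (σ + t • (τ - σ)))
    (φ₂ := fun t => ∑ i, (τ - σ) i * ∑ j, (τ - σ) j * pd j (pd i f) (σ + t • (τ - σ)))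
    (φ₃ := fun t => ∑ i, (τ - σ) i * ∑ j, (τ - σ) j * ∑ k, (τ - σ) k *
      pd k (pd j (pd i f)) (σ + t • (τ - σ)))
    (K := ∑ i, |τ i - σ i| * ∑ j, |τ j - σ j| * ∑ k, |τ k - σ k| * K i j k)
    (fun t ht => hasDerivAt_segment
      ((hf.differentiableOn (by norm_num)).differentiableAt (mem t ht)))
    (fun t ht => by
      refine HasDerivAt.fun_sum fun i _ => (hasDerivAt_segment
        (((hf1 i).differentiableOn (by norm_num)).differentiableAt (mem t ht))).const_mul _)
    (fun t ht => by
      refine HasDerivAt.fun_sum fun i _ => (HasDerivAt.fun_sum fun j _ => (hasDerivAt_segment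
        (((hf2 i j).differentiableOn (by norm_num)).differentiableAt (mem t ht))).const_mul _).const_mul _)
    (fun t ht => by
      have ht' := hS.add_smul_sub_mem hσ hτ ht
      refine (Finset.abs_sum_le_sum_abs _ _).trans (Finset.sum_le_sum fun i _ => ?_)
      rw [abs_mul]
      refine mul_le_mul_of_nonneg_left ?_ (abs_nonneg _)
      refine (Finset.abs_sum_le_sum_abs _ _).trans (Finset.sum_le_sum fun j _ => ?_)
      rw [abs_mul]
      refine mul_le_mul_of_nonneg_left ?_ (abs_nonneg _)
      refine (Finset.abs_sum_le_sum_abs _ _).trans (Finset.sum_le_sum fun k _ => ?_)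
      rw [abs_mul]
      exact mul_le_mul_of_nonneg_left (hK _ ht' i j k) (abs_nonneg _))
  simpa using this

end Calculus

/-! ### Measurability in y of derivatives and suprema, and Markov's inequality. -/

section Measurability

variable {s : ℕ} {Ω : Type*} [MeasurableSpace Ω] {U : Set (Par s)} {f : Par s → Ω → ℝ}

/-- A partial derivative is the pointwise limit of difference quotients along 1/(n + N + 1). The
shift N keeps all evaluation points in U, where measurability is known. -/
lemma measurable_pd (hU : IsOpen U) (hm : ∀ τ ∈ U, Measurable (f τ))
    (hd : ∀ y, DifferentiableOn ℝ (fun τ => f τ y) U) (i : Fin s) {τ : Par s} (hτ : τ ∈ U) :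
    Measurable fun y => pd i (fun τ => f τ y) τ := by
  have hev : ∀ᶠ t : ℝ in 𝓝 0, τ + t • EuclideanSpace.single i (1 : ℝ) ∈ U := by
    have : Continuous fun t : ℝ => τ + t • EuclideanSpace.single i (1 : ℝ) := by fun_prop
    exact this.continuousAt.eventually_mem (by simpa using hU.mem_nhds hτ)
  obtain ⟨N, hN⟩ := ((tendsto_one_div_add_atTop_nhds_zero_nat (𝕜 := ℝ)).eventually hev).exists_forall_of_atTop
  refine measurable_of_tendsto_metrizable (f := fun (n : ℕ) y =>
    (1 / (((n + N : ℕ) : ℝ) + 1))⁻¹ * (f (τ + (1 / (((n + N : ℕ) : ℝ) + 1)) •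
      EuclideanSpace.single i (1 : ℝ)) y - f τ y)) ?_ ?_
  · intro n
    exact ((hm _ (hN (n + N) (by omega))).sub (hm τ hτ)).const_mul _
  · rw [tendsto_pi_nhds]
    intro y
    have hfd : HasDerivAt (fun t : ℝ => f (τ + t • EuclideanSpace.single i (1 : ℝ)) y)
        (pd i (fun τ => f τ y) τ) 0 := by
      have h1 : HasDerivAt (fun t : ℝ => τ + t • EuclideanSpace.single i (1 : ℝ))
          (EuclideanSpace.single i (1 : ℝ)) 0 := by
        simpa using ((hasDerivAt_id (0 : ℝ)).smul_const (EuclideanSpace.single i (1 : ℝ))).const_add τ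
      have h2 : HasFDerivAt (fun τ => f τ y) (fderiv ℝ (fun τ => f τ y) τ)
          (τ + (0 : ℝ) • EuclideanSpace.single i (1 : ℝ)) := by
        simpa using ((hd y).differentiableAt (hU.mem_nhds hτ)).hasFDerivAt
      exact h2.comp_hasDerivAt (0 : ℝ) h1
    have ht := hfd.tendsto_slope_zero
    have hs : Tendsto (fun n : ℕ => 1 / (((n + N : ℕ) : ℝ) + 1)) atTop (𝓝[≠] 0) := by
      rw [tendsto_nhdsWithin_iff]
      refine ⟨(tendsto_one_div_add_atTop_nhds_zero_nat (𝕜 := ℝ)).comp (tendsto_add_atTop_nat N),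
        Eventually.of_forall fun n => ?_⟩
      simp only [Set.mem_compl_iff, Set.mem_singleton_iff]
      positivity
    have := ht.comp hs
    simpa [Function.comp_def] using this

/-- By continuity in the parameter, the supremum may be restricted to a countable dense subset of
`S`. -/
lemma measurable_biSup_of_continuousOn {S : Set (Par s)} (hm : ∀ τ ∈ S, Measurable (f τ))
    (hc : ∀ y, ContinuousOn (fun τ => f τ y) S) :
    Measurable fun y => ⨆ τ ∈ S, ENNReal.ofReal |f τ y| := by
  obtain ⟨T, hTc, hTd⟩ := TopologicalSpace.exists_countable_dense S
  have : (fun y => ⨆ τ ∈ S, ENNReal.ofReal |f τ y|) =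
      fun y => ⨆ τ : T, ENNReal.ofReal |f τ.1 y| := by
    funext y
    rw [iSup_subtype']
    have hcont : Continuous fun τ : S => ENNReal.ofReal |f τ y| :=
      ENNReal.continuous_ofReal.comp ((continuousOn_iff_continuous_domRestrict.1 (hc y)).abs)
    exact (hTd.ciSup' (f := fun τ : S => ENNReal.ofReal |f τ y|) hcont).symm
  rw [this]
  have : Countable T := hTc.to_subtype
  refine Measurable.iSup fun τ => ?_
  exact ENNReal.measurable_ofReal.comp ((hm _ τ.1.2).abs)

lemma measure_gt_le_of_lintegral_rpow {μ : Measure Ω} {F : Ω → ℝ≥0∞} (hF : Measurable F) {g t : ℝ}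
    {K : ℝ≥0} (hg : 0 < g) (ht : 0 < t) (h : ∫⁻ y, F y ^ g ∂μ ≤ K) :
    μ {y | ENNReal.ofReal t < F y} ≤ ENNReal.ofReal (K * t ^ (-g)) := by
  have h1 := mul_meas_ge_le_lintegral (μ := μ) (hF.pow_const g) (ENNReal.ofReal t ^ g)
  have h2 : {y | ENNReal.ofReal t < F y} ⊆ {y | ENNReal.ofReal t ^ g ≤ F y ^ g} := fun y hy =>
    ENNReal.rpow_le_rpow (le_of_lt hy) hg.le
  have h3 : ENNReal.ofReal t ^ g * μ {y | ENNReal.ofReal t < F y} ≤ K :=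
    (mul_le_mul_right (measure_mono h2) _).trans (h1.trans h)
  rw [ENNReal.ofReal_rpow_of_pos ht] at h3
  have hpos : 0 < t ^ g := Real.rpow_pos_of_pos ht g
  calc μ {y | ENNReal.ofReal t < F y} ≤ K / ENNReal.ofReal (t ^ g) := by
        rw [ENNReal.le_div_iff_mul_le (by simp [hpos]) (by simp)]
        rwa [mul_comm]
    _ = ENNReal.ofReal (K * t ^ (-g)) := by
        rw [Real.rpow_neg ht.le, ← div_eq_mul_inv, ENNReal.ofReal_div_of_pos hpos]
        simp

end Measurability

/-! ### Spectral norm, negative definiteness and inverses. -/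

section Matrices

variable {s : ℕ}

lemma abs_apply_le_specNorm (B : Matrix (Fin s) (Fin s) ℝ) (i j : Fin s) :
    |B i j| ≤ specNorm B := by
  have h1 := (Matrix.toEuclideanCLM (n := Fin s) (𝕜 := ℝ) B).le_opNorm
    (EuclideanSpace.single j (1 : ℝ))
  have h2 : (Matrix.toEuclideanCLM (n := Fin s) (𝕜 := ℝ) B) (EuclideanSpace.single j (1 : ℝ)) i
      = B i j := by
    simp [Matrix.ofLp_toEuclideanCLM]
  have h3 := PiLp.norm_apply_le ((Matrix.toEuclideanCLM (n := Fin s) (𝕜 := ℝ) B)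
    (EuclideanSpace.single j (1 : ℝ))) i
  rw [h2] at h3
  simpa [specNorm] using h3.trans h1

lemma abs_dotProduct_mulVec_le (B : Matrix (Fin s) (Fin s) ℝ) (v : Fin s → ℝ) :
    |v ⬝ᵥ (B *ᵥ v)| ≤ specNorm B * (v ⬝ᵥ v) := by
  have h1 := abs_real_inner_le_norm (WithLp.toLp 2 v)
    (Matrix.toEuclideanCLM (n := Fin s) (𝕜 := ℝ) B (WithLp.toLp 2 v))
  have h2 := (Matrix.toEuclideanCLM (n := Fin s) (𝕜 := ℝ) B).le_opNorm (WithLp.toLp 2 v)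
  have h3 : ‖WithLp.toLp 2 v‖ * ‖WithLp.toLp 2 v‖ = v ⬝ᵥ v := by
    rw [← real_inner_self_eq_norm_mul_norm, EuclideanSpace.inner_eq_star_dotProduct]
    simp
  have h4 : inner ℝ (WithLp.toLp 2 v)
    (Matrix.toEuclideanCLM (n := Fin s) (𝕜 := ℝ) B (WithLp.toLp 2 v)) = v ⬝ᵥ (B *ᵥ v) := by
    rw [EuclideanSpace.inner_eq_star_dotProduct]
    simp [dotProduct_comm]
  rw [h4] at h1
  refine h1.trans ?_
  rw [← h3]
  have := norm_nonneg (WithLp.toLp 2 v)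
  unfold specNorm
  nlinarith

/-- The matrix −c·1 − B is Hermitian with nonnegative spectrum, hence positive semidefinite.
Finiteness of the spectrum is needed for `sSup` to be a genuine upper bound. -/
lemma dotProduct_mulVec_le_of_lamMax {B : Matrix (Fin s) (Fin s) ℝ} (hB : B.IsHermitian) {c : ℝ}
    (h : lamMax B ≤ -c) (v : Fin s → ℝ) : v ⬝ᵥ (B *ᵥ v) ≤ -c * (v ⬝ᵥ v) := by
  have hspec : ∀ x ∈ spectrum ℝ B, x ≤ -c := fun x hx => by
    have hfin : (spectrum ℝ B).Finite := by
      rw [hB.spectrum_real_eq_range_eigenvalues]; exact Set.finite_range _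
    exact (le_csSup hfin.bddAbove hx).trans h
  have hpsd : (algebraMap ℝ (Matrix (Fin s) (Fin s) ℝ) (-c) - B).PosSemidef := by
    rw [Matrix.posSemidef_iff_isHermitian_and_spectrum_nonneg]
    refine ⟨?_, ?_⟩
    · refine Matrix.IsHermitian.sub ?_ hB
      rw [Algebra.algebraMap_eq_smul_one]
      simp [Matrix.IsHermitian]
    · intro x hx
      have : -c - x ∈ spectrum ℝ B := by
        have := spectrum.singleton_sub_eq B (-c)
        rw [← this] at hx
        obtain ⟨a, ha, b, hb, hab⟩ := hx
        simp only [Set.mem_singleton_iff] at ha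
        have : -c - x = b := by rw [← hab, ha]; simp
        rwa [this]
      have := hspec _ this
      change 0 ≤ x
      linarith
  have := hpsd.dotProduct_mulVec_nonneg v
  simp only [Algebra.algebraMap_eq_smul_one, Matrix.sub_mulVec, Matrix.smul_mulVec,
    Matrix.one_mulVec, dotProduct_sub, dotProduct_smul, star_trivial, smul_eq_mul] at this
  linarith

/-- A negative definite (not necessarily symmetric) matrix is invertible, with a bound for the
entries of the inverse. -/
lemma inv_bound_of_negDef {B : Matrix (Fin s) (Fin s) ℝ} {c : ℝ} (hc : 0 < c)
    (h : ∀ v : Fin s → ℝ, v ⬝ᵥ (B *ᵥ v) ≤ -c * (v ⬝ᵥ v)) :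
    IsUnit B.det ∧ ∀ i j, |B⁻¹ i j| ≤ 1 / c := by
  have hdet : IsUnit B.det := by
    rw [isUnit_iff_ne_zero]
    intro h0
    obtain ⟨v, hv, hBv⟩ := Matrix.exists_mulVec_eq_zero_iff.2 h0
    have := h v
    rw [hBv, dotProduct_zero] at this
    have hpos : 0 < v ⬝ᵥ v := by
      have h1 : 0 ≤ v ⬝ᵥ v := Finset.sum_nonneg fun i _ => mul_self_nonneg _
      exact lt_of_le_of_ne h1 fun h2 => hv (dotProduct_self_eq_zero.1 h2.symm)
    nlinarith
  refine ⟨hdet, fun i j => ?_⟩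
  set w : Fin s → ℝ := Pi.single j 1
  set v := B⁻¹ *ᵥ w with hv
  have hBv : B *ᵥ v = w := by
    rw [hv, Matrix.mulVec_mulVec, Matrix.mul_nonsing_inv B hdet, Matrix.one_mulVec]
  have h1 := h v
  rw [hBv] at h1
  have h2 : v ⬝ᵥ w = v j := by simp [w]
  have hvi : ∀ i, v i = B⁻¹ i j := fun i => by simp [hv, w]
  have h4 : ∀ i, v i * v i ≤ v ⬝ᵥ v := fun i =>
    Finset.single_le_sum (f := fun i => v i * v i) (fun i _ => mul_self_nonneg _) (Finset.mem_univ i)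
  rw [h2] at h1
  have hvv : 0 ≤ v ⬝ᵥ v := Finset.sum_nonneg fun i _ => mul_self_nonneg _
  -- Here v is column j of the inverse, so c|v|² ≤ −v'Bv = −vⱼ ≤ |vⱼ|. Together with vⱼ² ≤ |v|² this
  -- bounds first |vⱼ|, and then |v| itself.
  have h5 : c * |v j| ≤ 1 := by
    by_contra hlt
    push Not at hlt
    have e1 := h4 j
    rw [← abs_mul_abs_self (v j)] at e1
    have e2 : c * (v ⬝ᵥ v) ≤ |v j| := by linarith [neg_abs_le (v j)]
    have hp : 0 < |v j| := by
      rcases (abs_nonneg (v j)).eq_or_lt with h0 | h0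
      · rw [← h0] at hlt; linarith
      · exact h0
    nlinarith
  have h6 : c * (c * (v ⬝ᵥ v)) ≤ 1 := by
    have e2 : c * (v ⬝ᵥ v) ≤ |v j| := by linarith [neg_abs_le (v j)]
    nlinarith
  rw [← hvi i, le_div_iff₀ hc]
  have h7 := h4 i
  rw [← abs_mul_abs_self (v i)] at h7
  have : (|v i| * c) ^ 2 ≤ 1 := by nlinarith [mul_pos hc hc]
  nlinarith [mul_nonneg (abs_nonneg (v i)) hc.le]

end Matrices

/-! ### The boxes on which the suprema are taken. -/

section Box

variable {s : ℕ} {d : Fin s → ℝ}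

lemma dStar_le (d : Fin s → ℝ) (i : Fin s) : dStar d ≤ d i :=
  ciInf_le (Set.finite_range d).bddBelow i

lemma dStar_pos [Nonempty (Fin s)] (hd : ∀ i, 0 < d i) : 0 < dStar d := by
  obtain ⟨i, hi⟩ := exists_eq_ciInf_of_finite (f := d)
  rw [dStar, ← hi]
  exact hd i

/-- For s = 0 the infimum over the empty family is 0 by convention and cannot tend to infinity. -/
lemma nonempty_of_dStar_tendsto {d : ℕ → Fin s → ℝ}
    (h : Tendsto (fun n => dStar (d n)) atTop atTop) : Nonempty (Fin s) := by
  by_contra hne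
  rw [not_nonempty_iff] at hne
  obtain ⟨n, hn⟩ := (h.eventually_gt_atTop 0).exists
  simp [dStar, Real.iInf_of_isEmpty] at hn

lemma convex_SBox (δ : ℝ) (σ : Par s) : Convex ℝ (SBox d δ σ) := by
  have : SBox d δ σ = ⋂ i, (fun τ : Par s => τ i) ⁻¹' Set.Icc (σ i - δ * dStar d / d i)
      (σ i + δ * dStar d / d i) := by
    ext τ
    simp only [SBox, Set.mem_ofPred_eq, Set.mem_iInter, Set.mem_preimage, Set.mem_Icc, abs_le]
    refine forall_congr' fun i => ?_
    constructor <;> rintro ⟨h1, h2⟩ <;> constructor <;> linarith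
  rw [this]
  refine convex_iInter fun i => (convex_Icc _ _).is_linear_preimage ?_
  exact ⟨fun x y => rfl, fun c x => rfl⟩

lemma self_mem_SBox [Nonempty (Fin s)] (hd : ∀ i, 0 < d i) {δ : ℝ} (hδ : 0 ≤ δ) (σ : Par s) :
    σ ∈ SBox d δ σ := by
  intro i
  have := dStar_pos hd
  have := hd i
  simp only [sub_self, abs_zero]
  positivity

lemma SBox_mono [Nonempty (Fin s)] (hd : ∀ i, 0 < d i) {δ δ' : ℝ} (h : δ ≤ δ') (σ : Par s) :
    SBox d δ σ ⊆ SBox d δ' σ := by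
  intro τ hτ i
  have := dStar_pos hd
  have := hd i
  refine (hτ i).trans ?_
  gcongr

lemma abs_sub_le_of_mem_SBox [Nonempty (Fin s)] (hd : ∀ i, 0 < d i) {δ : ℝ} (hδ : 0 ≤ δ)
    {σ τ : Par s} (hτ : τ ∈ SBox d δ σ) (i : Fin s) : |τ i - σ i| ≤ δ := by
  refine (hτ i).trans ?_
  rw [div_le_iff₀ (hd i)]
  exact mul_le_mul_of_nonneg_left (dStar_le d i) hδ

/-- Since d_* ≤ dᵢ, every box lies in the cube of half-width `δ'` around σ₀, whatever n is. One
radius thus serves all n, provided the neighbourhood of σ₀ does not shrink. -/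
lemma exists_SBox_subset {M : ℕ → MixedModel s} {d : ℕ → Fin s → ℝ} {σ₀ : Par s}
    [Nonempty (Fin s)] (hd : ∀ n i, 0 < d n i) (hσ : σ₀ ∈ interior (⋂ n, (M n).Θ)) {δ : ℝ}
    (hδ : 0 < δ) :
    ∃ δ' > 0, δ' ≤ δ ∧ ∀ n, SBox (d n) δ' σ₀ ⊆ interior (M n).Θ := by
  obtain ⟨r, hr, hball⟩ := Metric.isOpen_iff.1 isOpen_interior σ₀ hσ
  have hs : (0 : ℝ) < s := by
    have : 0 < s := Fin.pos_iff_nonempty.2 inferInstance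
    exact_mod_cast this
  -- With this half-width the ℓ¹ distance to σ₀, hence the Euclidean one, is at most r/2.
  refine ⟨min δ (r / (2 * s)), by positivity, min_le_left _ _, fun n τ hτ => ?_⟩
  have hsub : interior (⋂ n, (M n).Θ) ⊆ interior (M n).Θ :=
    interior_mono (Set.iInter_subset _ n)
  refine hsub (hball ?_)
  rw [Metric.mem_ball, dist_eq_norm]
  have h1 : ‖τ - σ₀‖ ≤ ∑ i, |τ i - σ₀ i| := by
    rw [EuclideanSpace.norm_eq]
    refine (Real.sqrt_le_sqrt (Finset.sum_sq_le_sq_sum_of_nonneg fun i _ => norm_nonneg _)).trans ?_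
    rw [Real.sqrt_sq (Finset.sum_nonneg fun i _ => norm_nonneg _)]
    simp
  refine h1.trans_lt ?_
  calc ∑ i, |τ i - σ₀ i| ≤ ∑ _i : Fin s, r / (2 * s) := Finset.sum_le_sum fun i _ =>
        (abs_sub_le_of_mem_SBox (hd n) (by positivity) hτ i).trans (min_le_right _ _)
    _ = r / 2 := by simp; field_simp
    _ < r := by linarith

end Box

/-! ### Derivatives of the criterion function, and the scaled matrix Q. -/

section Model

variable {s : ℕ} {M : MixedModel s} {ℓ : Par s → (Fin M.N → ℝ) → ℝ} {d : Fin s → ℝ} {σ : Par s}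

instance (M : MixedModel s) (σ : Par s) : IsProbabilityMeasure (M.law σ) := by
  have := M.vLaw_prob σ
  have := M.eLaw_prob σ
  have : IsProbabilityMeasure (M.veLaw σ) := by
    unfold MixedModel.veLaw; infer_instance
  refine Measure.isProbabilityMeasure_map (Measurable.aemeasurable ?_)
  have : Continuous M.obs := by
    unfold MixedModel.obs
    have h1 : Continuous fun w : (Fin M.r → ℝ) × (Fin M.N → ℝ) => M.Z *ᵥ w.1 :=
      Continuous.matrix_mulVec continuous_const continuous_fst
    exact (continuous_const.add h1).add continuous_snd
  exact this.measurable

lemma FMat_comm (hs : ∀ y, ContDiffOn ℝ 3 (fun σ => ℓ σ y) (interior M.Θ))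
    (hσ : σ ∈ interior M.Θ) (y : Fin M.N → ℝ) (i j : Fin s) :
    M.FMat ℓ σ y i j = M.FMat ℓ σ y j i :=
  pd_comm isOpen_interior ((hs y).of_le (by norm_num)) i j hσ

lemma AMat_comm (hs : ∀ y, ContDiffOn ℝ 3 (fun σ => ℓ σ y) (interior M.Θ))
    (hσ : σ ∈ interior M.Θ) (i j : Fin s) :
    M.AMat ℓ σ i j = M.AMat ℓ σ j i := by
  simp only [MixedModel.AMat, Matrix.of_apply]
  congr 1 with y
  exact FMat_comm hs hσ y i j

/-- Taylor expansion of the score component i produces the derivatives in the order k, j, i, whereas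
`HMat` uses i, j, k. Three transpositions of mixed partials reconcile them. -/
lemma pd_pd_pd_eq_HMat (hs : ∀ y, ContDiffOn ℝ 3 (fun σ => ℓ σ y) (interior M.Θ))
    (hσ : σ ∈ interior M.Θ) (y : Fin M.N → ℝ) (i j k : Fin s) :
    pd k (pd j (pd i (fun τ => ℓ τ y))) σ = M.HMat ℓ i σ y j k := by
  have h2 : ContDiffOn ℝ 2 (fun σ => ℓ σ y) (interior M.Θ) := (hs y).of_le (by norm_num)
  have e1 : pd k (pd j (pd i (fun τ => ℓ τ y))) σ = pd k (pd i (pd j (fun τ => ℓ τ y))) σ :=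
    pd_congr_of_eqOn isOpen_interior (fun τ hτ => pd_comm isOpen_interior h2 j i hτ) k hσ
  have e2 : pd k (pd i (pd j (fun τ => ℓ τ y))) σ = pd i (pd k (pd j (fun τ => ℓ τ y))) σ :=
    pd_comm isOpen_interior (ContDiffOn.pd_of_isOpen isOpen_interior (hs y) (by norm_num) j) k i hσ
  have e3 : pd i (pd k (pd j (fun τ => ℓ τ y))) σ = pd i (pd j (pd k (fun τ => ℓ τ y))) σ :=
    pd_congr_of_eqOn isOpen_interior (fun τ hτ => pd_comm isOpen_interior h2 k j hτ) i hσ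
  rw [e1, e2, e3]
  rfl

lemma measurable_aVec (hm : ∀ σ ∈ interior M.Θ, Measurable (ℓ σ))
    (hs : ∀ y, ContDiffOn ℝ 3 (fun σ => ℓ σ y) (interior M.Θ)) (hσ : σ ∈ interior M.Θ)
    (i : Fin s) : Measurable fun y => M.aVec ℓ σ y i :=
  measurable_pd isOpen_interior hm (fun y => (hs y).differentiableOn (by norm_num)) i hσ

lemma measurable_FMat (hm : ∀ σ ∈ interior M.Θ, Measurable (ℓ σ))
    (hs : ∀ y, ContDiffOn ℝ 3 (fun σ => ℓ σ y) (interior M.Θ)) (hσ : σ ∈ interior M.Θ)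
    (i j : Fin s) : Measurable fun y => M.FMat ℓ σ y i j :=
  measurable_pd (f := fun τ y => pd j (fun τ => ℓ τ y) τ) isOpen_interior
    (fun τ hτ => measurable_aVec hm hs hτ j)
    (fun y => (ContDiffOn.pd_of_isOpen (m := 2) isOpen_interior (hs y)
      (by norm_num) j).differentiableOn (by norm_num)) i hσ

lemma measurable_HMat (hm : ∀ σ ∈ interior M.Θ, Measurable (ℓ σ))
    (hs : ∀ y, ContDiffOn ℝ 3 (fun σ => ℓ σ y) (interior M.Θ)) (hσ : σ ∈ interior M.Θ)
    (i j k : Fin s) : Measurable fun y => M.HMat ℓ i σ y j k :=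
  measurable_pd (f := fun τ y => pd j (pd k (fun τ => ℓ τ y)) τ) isOpen_interior
    (fun τ hτ => measurable_FMat hm hs hτ j k)
    (fun y => (ContDiffOn.pd_of_isOpen (m := 1) isOpen_interior
      (ContDiffOn.pd_of_isOpen (m := 2) isOpen_interior (hs y) (by norm_num) k)
      (by norm_num) j).differentiableOn (by norm_num)) i hσ

lemma measurable_pd_HMat (hm : ∀ σ ∈ interior M.Θ, Measurable (ℓ σ))
    (hs : ∀ y, ContDiffOn ℝ 4 (fun σ => ℓ σ y) (interior M.Θ)) (hσ : σ ∈ interior M.Θ)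
    (i j k l : Fin s) : Measurable fun y => pd i (pd j (pd k (pd l (fun σ => ℓ σ y)))) σ :=
  measurable_pd (f := fun τ y => pd j (pd k (pd l (fun τ => ℓ τ y))) τ) isOpen_interior
    (fun τ hτ => measurable_HMat hm (fun y => (hs y).of_le (by norm_num)) hτ j k l)
    (fun y => (ContDiffOn.pd_of_isOpen (m := 1) isOpen_interior
      (ContDiffOn.pd_of_isOpen (m := 2) isOpen_interior
      (ContDiffOn.pd_of_isOpen (m := 3) isOpen_interior (hs y) (by norm_num) l) (by norm_num) k)
      (by norm_num) j).differentiableOn (by norm_num)) i hσ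

lemma measurable_iSup_third (hm : ∀ σ ∈ interior M.Θ, Measurable (ℓ σ))
    (hs : ∀ y, ContDiffOn ℝ 3 (fun σ => ℓ σ y) (interior M.Θ)) {S : Set (Par s)}
    (hS : S ⊆ interior M.Θ) (i j k : Fin s) :
    Measurable fun y => ⨆ τ ∈ S, ENNReal.ofReal |pd i (pd j (pd k (fun σ => ℓ σ y))) τ| :=
  measurable_biSup_of_continuousOn (f := fun τ y => pd i (pd j (pd k (fun σ => ℓ σ y))) τ)
    (fun τ hτ => measurable_HMat hm hs (hS hτ) i j k)
    (fun y => (ContDiffOn.continuousOn (n := 0) (ContDiffOn.pd_of_isOpen isOpen_interior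
      (ContDiffOn.pd_of_isOpen (m := 1) isOpen_interior
      (ContDiffOn.pd_of_isOpen (m := 2) isOpen_interior (hs y) (by norm_num) k) (by norm_num) j)
      (by norm_num) i)).mono hS)

lemma measurable_iSup_fourth (hm : ∀ σ ∈ interior M.Θ, Measurable (ℓ σ))
    (hs : ∀ y, ContDiffOn ℝ 4 (fun σ => ℓ σ y) (interior M.Θ)) {S : Set (Par s)}
    (hS : S ⊆ interior M.Θ) (i j k l : Fin s) :
    Measurable fun y =>
      ⨆ τ ∈ S, ENNReal.ofReal |pd i (pd j (pd k (pd l (fun σ => ℓ σ y)))) τ| :=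
  measurable_biSup_of_continuousOn
    (f := fun τ y => pd i (pd j (pd k (pd l (fun σ => ℓ σ y)))) τ)
    (fun τ hτ => measurable_pd_HMat hm hs (hS hτ) i j k l)
    (fun y => (ContDiffOn.continuousOn (n := 0) (ContDiffOn.pd_of_isOpen isOpen_interior
      (ContDiffOn.pd_of_isOpen (m := 1) isOpen_interior
      (ContDiffOn.pd_of_isOpen (m := 2) isOpen_interior
      (ContDiffOn.pd_of_isOpen (m := 3) isOpen_interior (hs y) (by norm_num) l) (by norm_num) k)
      (by norm_num) j) (by norm_num) i)).mono hS)

lemma inv_diagonal_eq (hd : ∀ i, 0 < d i) :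
    (Matrix.diagonal d)⁻¹ = Matrix.diagonal fun i => (d i)⁻¹ := by
  refine Matrix.inv_eq_right_inv ?_
  rw [Matrix.diagonal_mul_diagonal, ← Matrix.diagonal_one]
  congr 1 with i
  exact mul_inv_cancel₀ (hd i).ne'

lemma QMat_apply (hd : ∀ i, 0 < d i) (i j : Fin s) :
    M.QMat ℓ d σ i j = M.AMat ℓ σ i j / (d i * d j) := by
  rw [MixedModel.QMat, inv_diagonal_eq hd, Matrix.mul_diagonal, Matrix.diagonal_mul]
  field_simp

/-- From Q⁻¹ = D A⁻¹ D. Only D has to be invertible: the product rule for matrix inverses also holds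
for singular A, where both inverses take the default value 0. -/
lemma AMat_inv_apply (hd : ∀ i, 0 < d i) (i j : Fin s) :
    (M.AMat ℓ σ)⁻¹ i j = (M.QMat ℓ d σ)⁻¹ i j / (d i * d j) := by
  have hu : IsUnit (Matrix.diagonal d).det := by
    rw [Matrix.det_diagonal]
    exact (Finset.prod_pos fun i _ => hd i).ne'.isUnit
  have h : (M.QMat ℓ d σ)⁻¹ = Matrix.diagonal d * (M.AMat ℓ σ)⁻¹ * Matrix.diagonal d := by
    rw [MixedModel.QMat, Matrix.mul_inv_rev, Matrix.mul_inv_rev, Matrix.nonsing_inv_nonsing_inv _ hu,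
      mul_assoc]
  rw [h, Matrix.mul_diagonal, Matrix.diagonal_mul]
  have := hd i
  have := hd j
  field_simp

lemma QMat_isHermitian (hd : ∀ i, 0 < d i)
    (hs : ∀ y, ContDiffOn ℝ 3 (fun σ => ℓ σ y) (interior M.Θ))
    (hσ : σ ∈ interior M.Θ) : (M.QMat ℓ d σ).IsHermitian := by
  ext i j
  simp only [Matrix.conjTranspose_apply, star_trivial]
  rw [QMat_apply hd, QMat_apply hd, AMat_comm hs hσ, mul_comm (d j)]

end Model

/-! ### Uniform negative definiteness at the true value. -/

section NegDef

variable {s : ℕ} {M : ℕ → MixedModel s} {ℓ : ∀ n, Par s → (Fin (M n).N → ℝ) → ℝ}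
  {d : ℕ → Fin s → ℝ} {σ₀ : Par s} {g δ : ℝ}

lemma ScoreConditions.mem_interior' (h : ScoreConditions M ℓ d σ₀ g δ) (n : ℕ) :
    σ₀ ∈ interior (M n).Θ :=
  interior_mono (Set.iInter_subset _ n) h.mem_interior

/-- A real number strictly between the limsup and 0 bounds the largest eigenvalue for all large n.
Symmetry of Q turns this into a bound for the quadratic form. -/
lemma ScoreConditions.eventually_negDef (h : ScoreConditions M ℓ d σ₀ g δ) :
    ∃ c > 0, ∀ᶠ n in atTop, ∀ v : Fin s → ℝ,
      v ⬝ᵥ ((M n).QMat (ℓ n) (d n) σ₀ *ᵥ v) ≤ -c * (v ⬝ᵥ v) := by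
  obtain ⟨x, hx1, hx2⟩ := EReal.lt_iff_exists_real_btwn.1 h.limsup_lt
  have hx : x < 0 := by exact_mod_cast hx2
  refine ⟨-x, by linarith, ?_⟩
  filter_upwards [eventually_lt_of_limsup_lt hx1] with n hn v
  have hn' : lamMax ((M n).QMat (ℓ n) (d n) σ₀) < x := by exact_mod_cast hn
  exact dotProduct_mulVec_le_of_lamMax
    (QMat_isHermitian (h.d_pos n) (h.smooth n) (h.mem_interior' n)) (by linarith) v

end NegDef

/-! ### A simplified Newton iteration for the score equation. -/

section Chord

variable {s : ℕ}

/-- The point `σ + D⁻¹x`. -/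
def scaledPoint (d : Fin s → ℝ) (σ : Par s) (x : Fin s → ℝ) : Par s :=
  σ + WithLp.toLp 2 fun i => x i / d i

/-- The coordinatewise truncation of `x` to `[-R, R]`. -/
def clamp (R : ℝ) (x : Fin s → ℝ) : Fin s → ℝ := fun i => max (-R) (min R (x i))

variable (M : MixedModel s) (ℓ : Par s → (Fin M.N → ℝ) → ℝ) (d : Fin s → ℝ) (σ : Par s) (R : ℝ)

/-- One step of the chord iteration `x ↦ x - Q⁻¹D⁻¹a(σ + D⁻¹x)` for the score equation, the
argument of `a` being truncated. -/
def chordStep (y : Fin M.N → ℝ) (x : Fin s → ℝ) : Fin s → ℝ :=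
  x - (M.QMat ℓ d σ)⁻¹ *ᵥ fun j => M.aVec ℓ (scaledPoint d σ (clamp R x)) y j / d j

/-- The (upper) limit of the chord iteration started at `σ`. -/
def chordRoot (y : Fin M.N → ℝ) : Par s :=
  scaledPoint d σ (clamp R fun i => limsup (fun k => (chordStep M ℓ d σ R y)^[k] 0 i) atTop)

variable {M ℓ d σ R}

@[simp] lemma scaledPoint_apply (x : Fin s → ℝ) (i : Fin s) :
    scaledPoint d σ x i = σ i + x i / d i := rfl

lemma clamp_eq_self {x : Fin s → ℝ} (hx : ∀ i, |x i| ≤ R) : clamp R x = x := by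
  funext i
  obtain ⟨h1, h2⟩ := abs_le.1 (hx i)
  simp [clamp, h1, h2]

lemma abs_clamp_le (hR : 0 ≤ R) (x : Fin s → ℝ) (i : Fin s) : |clamp R x i| ≤ R := by
  rw [abs_le]
  refine ⟨le_max_left _ _, max_le (by linarith) (min_le_left _ _)⟩

lemma continuous_clamp : Continuous (clamp (s := s) R) := by
  unfold clamp
  fun_prop

lemma continuous_scaledPoint : Continuous (scaledPoint d σ) := by
  unfold scaledPoint
  refine continuous_const.add ((PiLp.continuous_toLp 2 _).comp ?_)
  fun_prop

lemma scaledPoint_mem_SBox [Nonempty (Fin s)] (hd : ∀ i, 0 < d i) {r : ℝ} {x : Fin s → ℝ}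
    (hx : ∀ i, |x i| ≤ r) : scaledPoint d σ x ∈ SBox d (r / dStar d) σ := by
  intro i
  have h1 := dStar_pos hd
  have h2 := hd i
  rw [scaledPoint_apply, add_sub_cancel_left, abs_div, abs_of_pos h2, div_mul_cancel₀ _ h1.ne']
  gcongr
  exact hx i

lemma abs_mulVec_le {P : Matrix (Fin s) (Fin s) ℝ} {p b : ℝ} (hP : ∀ i j, |P i j| ≤ p)
    {v : Fin s → ℝ} (hv : ∀ i, |v i| ≤ b) (i : Fin s) : |(P *ᵥ v) i| ≤ s * (p * b) := by
  simp only [Matrix.mulVec, dotProduct]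
  refine (Finset.abs_sum_le_sum_abs _ _).trans ?_
  calc ∑ j, |P i j * v j| ≤ ∑ _j : Fin s, p * b := Finset.sum_le_sum fun j _ => by
        rw [abs_mul]
        exact mul_le_mul (hP i j) (hv j) (abs_nonneg _) ((abs_nonneg _).trans (hP i j))
    _ = s * (p * b) := by simp

/-- Clamping keeps the argument of the score in the interior of Θ for every y, also where the
iteration diverges. The score is then continuous in x and measurable in y, hence jointly measurable,
and so are the iterates. The coordinatewise limsup is measurable without any convergence. -/
lemma measurable_chordRoot [Nonempty (Fin s)] (hd : ∀ i, 0 < d i) (hR : 0 ≤ R)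
    (hm : ∀ σ ∈ interior M.Θ, Measurable (ℓ σ))
    (hs : ∀ y, ContDiffOn ℝ 3 (fun σ => ℓ σ y) (interior M.Θ))
    (hsub : SBox d (R / dStar d) σ ⊆ interior M.Θ) :
    Measurable (chordRoot M ℓ d σ R) := by
  have hmem : ∀ x, scaledPoint d σ (clamp R x) ∈ interior M.Θ := fun x =>
    hsub (scaledPoint_mem_SBox hd (abs_clamp_le hR x))
  have hjoint : ∀ j, Measurable (Function.uncurry fun (x : Fin s → ℝ) (y : Fin M.N → ℝ) =>
      M.aVec ℓ (scaledPoint d σ (clamp R x)) y j) := by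
    intro j
    refine measurable_uncurry_of_continuous_of_measurable (fun y => ?_) (fun x => ?_)
    · have hc : ContinuousOn (fun τ => M.aVec ℓ τ y j) (interior M.Θ) :=
        (ContDiffOn.pd_of_isOpen (m := 2) isOpen_interior (hs y) (by norm_num) j).continuousOn
      exact hc.comp_continuous (continuous_scaledPoint.comp continuous_clamp) hmem
    · exact measurable_aVec hm hs (hmem x) j
  have hiter : ∀ k, Measurable fun y => (chordStep M ℓ d σ R y)^[k] 0 := by
    intro k
    induction k with
    | zero => simp
    | succ k ih =>
      simp only [Function.iterate_succ_apply']
      unfold chordStep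
      refine Measurable.sub ih ?_
      refine measurable_pi_lambda _ fun i => ?_
      simp only [Matrix.mulVec, dotProduct]
      refine Finset.measurable_sum _ fun j _ => Measurable.const_mul (Measurable.div_const ?_ _) _
      exact (hjoint j).comp (ih.prodMk measurable_id)
  refine (continuous_scaledPoint.comp continuous_clamp).measurable.comp ?_
  refine measurable_pi_lambda _ fun i => ?_
  exact Measurable.limsup fun k => (measurable_pi_apply i).comp (hiter k)

lemma chordRoot_mem [Nonempty (Fin s)] (hd : ∀ i, 0 < d i) (hR : 0 ≤ R) (y : Fin M.N → ℝ) :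
    chordRoot M ℓ d σ R y ∈ SBox d (R / dStar d) σ :=
  scaledPoint_mem_SBox hd (abs_clamp_le hR _)

/-- On the event that the standardized derivatives of the criterion function are of moderate size,
`chordStep` is a contraction. -/
lemma chordStep_sub_le [Nonempty (Fin s)] (hd : ∀ i, 0 < d i)
    (hs : ∀ y, ContDiffOn ℝ 3 (fun σ => ℓ σ y) (interior M.Θ)) {r κ p : ℝ} (hr : 0 < r)
    (hrR : r ≤ R)
    (hsub : SBox d (R / dStar d) σ ⊆ interior M.Θ) (hdet : IsUnit (M.QMat ℓ d σ).det)
    (hP : ∀ i j, |(M.QMat ℓ d σ)⁻¹ i j| ≤ p) {y : Fin M.N → ℝ}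
    (h2 : ∀ i j, 1 / Real.sqrt (d i * d j) * |M.FMat ℓ σ y i j - M.AMat ℓ σ i j| ≤ κ * dStar d)
    (h3 : ∀ i j k, ∀ τ ∈ SBox d (R / dStar d) σ,
      dStar d / (d i * d j * d k) * |pd i (pd j (pd k (fun σ => ℓ σ y))) τ| ≤ κ * dStar d / r)
    {x x' : Fin s → ℝ} (hx : ∀ i, |x i| ≤ r) (hx' : ∀ i, |x' i| ≤ r) (i : Fin s) :
    |chordStep M ℓ d σ R y x i - chordStep M ℓ d σ R y x' i|
      ≤ s * (p * (s * ((s + 1) * κ) * ‖x - x'‖)) := by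
  have hD := dStar_pos hd
  have hκ : 0 ≤ κ := by
    have i0 : Fin s := Classical.arbitrary _
    have := (by positivity : (0 : ℝ) ≤ _).trans (h2 i0 i0)
    exact nonneg_of_mul_nonneg_left this hD
  have hsmall : SBox d (r / dStar d) σ ⊆ SBox d (R / dStar d) σ :=
    SBox_mono hd (by gcongr) σ
  have hσ : σ ∈ SBox d (r / dStar d) σ := self_mem_SBox hd (by positivity) σ
  -- The Hessian near σ deviates from A by κ through the centred Hessian at σ, where d_* ≤ √(d_k
  -- d_j) is used, and by sκ through the third derivatives on the way from σ to τ.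
  have hF : ∀ j k, ∀ τ ∈ SBox d (r / dStar d) σ,
      |M.FMat ℓ τ y k j - M.AMat ℓ σ k j| ≤ (s + 1) * κ * (d k * d j) := by
    intro j k τ hτ
    have e1 : |M.FMat ℓ σ y k j - M.AMat ℓ σ k j| ≤ κ * (d k * d j) := by
      have h := h2 k j
      have hk := hd k
      have hj := hd j
      have hq : dStar d * Real.sqrt (d k * d j) ≤ d k * d j := by
        have : dStar d ≤ Real.sqrt (d k * d j) := by
          rw [Real.le_sqrt' hD, sq]
          exact mul_le_mul (dStar_le d k) (dStar_le d j) hD.le hk.le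
        calc dStar d * Real.sqrt (d k * d j) ≤ Real.sqrt (d k * d j) * Real.sqrt (d k * d j) := by
              gcongr
          _ = d k * d j := Real.mul_self_sqrt (by positivity)
      have hq0 : 0 < Real.sqrt (d k * d j) := Real.sqrt_pos.2 (by positivity)
      rw [one_div, inv_mul_le_iff₀ hq0] at h
      calc _ ≤ _ := h
        _ = κ * (dStar d * Real.sqrt (d k * d j)) := by ring
        _ ≤ _ := by gcongr
    have e2 : |M.FMat ℓ τ y k j - M.FMat ℓ σ y k j| ≤ s * κ * (d k * d j) := by
      have hdiff : DifferentiableOn ℝ (fun τ => M.FMat ℓ τ y k j) (interior M.Θ) :=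
        (ContDiffOn.pd_of_isOpen (m := 1) isOpen_interior
          (ContDiffOn.pd_of_isOpen (m := 2) isOpen_interior (hs y) (by norm_num) j)
          (by norm_num) k).differentiableOn (by norm_num)
      have := abs_sub_le_sum_of_pd_le (K := fun m => κ / r * (d m * d k * d j)) isOpen_interior
        (hsmall.trans hsub) (convex_SBox _ σ) hdiff (fun ξ hξ m => by
          have h := h3 m k j ξ (hsmall hξ)
          have hm := hd m
          have hk := hd k
          have hj := hd j
          rw [div_mul_eq_mul_div, div_le_iff₀ (by positivity)] at h
          have h' : dStar d * |pd m (pd k (pd j (fun σ => ℓ σ y))) ξ|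
              ≤ dStar d * (κ / r * (d m * d k * d j)) := by
            calc _ ≤ _ := h
              _ = _ := by ring
          exact le_of_mul_le_mul_left h' hD) hσ hτ
      refine this.trans ?_
      calc ∑ m, |τ m - σ m| * (κ / r * (d m * d k * d j))
          ≤ ∑ _m : Fin s, κ * (d k * d j) := Finset.sum_le_sum fun m _ => by
            have hm := hd m
            have hk := hd k
            have hj := hd j
            have h := hτ m
            rw [div_mul_cancel₀ _ hD.ne'] at h
            calc |τ m - σ m| * (κ / r * (d m * d k * d j))
                ≤ r / d m * (κ / r * (d m * d k * d j)) := by gcongr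
              _ = κ * (d k * d j) := by field_simp
        _ = s * κ * (d k * d j) := by simp [mul_assoc]
    calc |M.FMat ℓ τ y k j - M.AMat ℓ σ k j|
        = |(M.FMat ℓ τ y k j - M.FMat ℓ σ y k j) + (M.FMat ℓ σ y k j - M.AMat ℓ σ k j)| := by
          congr 1; ring
      _ ≤ _ := (abs_add_le _ _).trans (add_le_add e2 e1)
      _ = _ := by ring
  -- The score minus its mean linear part. Its gradient F − A is small by `hF`, which makes the
  -- iteration contract.
  set f : Fin s → Par s → ℝ := fun j τ =>
    pd j (fun σ => ℓ σ y) τ - ∑ k, M.AMat ℓ σ k j * τ k with hf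
  have hpd1 : ∀ j, DifferentiableOn ℝ (pd j (fun σ => ℓ σ y)) (interior M.Θ) := fun j =>
    (ContDiffOn.pd_of_isOpen (m := 2) isOpen_interior (hs y) (by norm_num) j).differentiableOn
      (by norm_num)
  have hlin : ∀ j τ, HasFDerivAt (fun τ : Par s => ∑ k, M.AMat ℓ σ k j * τ k)
      (∑ k, M.AMat ℓ σ k j • (EuclideanSpace.proj k : Par s →L[ℝ] ℝ)) τ := by
    intro j τ
    refine HasFDerivAt.fun_sum fun k _ => ?_
    exact ((EuclideanSpace.proj k : Par s →L[ℝ] ℝ).hasFDerivAt).const_mul _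
  have hfd : ∀ j, DifferentiableOn ℝ (f j) (interior M.Θ) := fun j =>
    (hpd1 j).sub fun τ _ => (hlin j τ).differentiableAt.differentiableWithinAt
  have hfpd : ∀ j k, ∀ τ ∈ interior M.Θ,
      pd k (f j) τ = M.FMat ℓ τ y k j - M.AMat ℓ σ k j := by
    intro j k τ hτ
    have h := ((hpd1 j).differentiableAt (isOpen_interior.mem_nhds hτ)).hasFDerivAt.sub (hlin j τ)
    have h' : fderiv ℝ (f j) τ = _ := h.fderiv
    unfold pd at h' ⊢
    rw [h']
    simp [MixedModel.FMat, pd]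
    rfl
  set τ := scaledPoint d σ x
  set τ' := scaledPoint d σ x'
  have hτ : τ ∈ SBox d (r / dStar d) σ := scaledPoint_mem_SBox hd hx
  have hτ' : τ' ∈ SBox d (r / dStar d) σ := scaledPoint_mem_SBox hd hx'
  have hfdiff : ∀ j, |(f j τ - f j τ') / d j| ≤ s * ((s + 1) * κ) * ‖x - x'‖ := by
    intro j
    have hj := hd j
    have := abs_sub_le_sum_of_pd_le (K := fun k => (s + 1) * κ * (d k * d j)) isOpen_interior
      (hsmall.trans hsub) (convex_SBox _ σ) (hfd j) (fun ξ hξ k => by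
        rw [hfpd j k ξ (hsub (hsmall hξ))]
        exact hF j k ξ hξ) hτ' hτ
    rw [abs_div, abs_of_pos hj, div_le_iff₀ hj]
    refine this.trans ?_
    calc ∑ k, |τ k - τ' k| * ((s + 1) * κ * (d k * d j))
        ≤ ∑ _k : Fin s, (s + 1) * κ * ‖x - x'‖ * d j := Finset.sum_le_sum fun k _ => by
          have hk := hd k
          have e : τ k - τ' k = (x - x') k / d k := by
            simp only [τ, τ', scaledPoint_apply, Pi.sub_apply]; ring
          have hn : |(x - x') k| ≤ ‖x - x'‖ := norm_le_pi_norm (x - x') k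
          rw [e, abs_div, abs_of_pos hk]
          calc |(x - x') k| / d k * ((s + 1) * κ * (d k * d j))
              = (s + 1) * κ * |(x - x') k| * d j := by field_simp
            _ ≤ _ := by gcongr
      _ = _ := by simp; ring
  -- Since Q⁻¹Q = 1, the identity part of the step cancels the mean linear part of the score, and
  -- only the differences of `f` survive.
  have hid : chordStep M ℓ d σ R y x - chordStep M ℓ d σ R y x'
      = -((M.QMat ℓ d σ)⁻¹ *ᵥ fun j => (f j τ - f j τ') / d j) := by
    have hAsym : ∀ k j, M.AMat ℓ σ k j = M.AMat ℓ σ j k := fun k j =>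
      AMat_comm hs (hsub (hsmall hσ)) k j
    have e0 : (fun j => (f j τ - f j τ') / d j) =
        ((fun j => M.aVec ℓ τ y j / d j) - fun j => M.aVec ℓ τ' y j / d j)
          - M.QMat ℓ d σ *ᵥ (x - x') := by
      funext j
      simp only [Pi.sub_apply, Matrix.mulVec, dotProduct, hf, MixedModel.aVec]
      have e1 : ∑ k, M.QMat ℓ d σ j k * (x k - x' k)
          = (∑ k, M.AMat ℓ σ k j * τ k - ∑ k, M.AMat ℓ σ k j * τ' k) / d j := by
        rw [← Finset.sum_sub_distrib, Finset.sum_div]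
        refine Finset.sum_congr rfl fun k _ => ?_
        rw [QMat_apply hd, hAsym k j]
        simp only [τ, τ', scaledPoint_apply]
        have hk := hd k
        have hj := hd j
        field_simp
        ring
      rw [e1]
      ring
    rw [e0, Matrix.mulVec_sub, Matrix.mulVec_mulVec, Matrix.nonsing_inv_mul _ hdet,
      Matrix.one_mulVec, Matrix.mulVec_sub]
    unfold chordStep
    rw [clamp_eq_self fun i => (hx i).trans hrR, clamp_eq_self fun i => (hx' i).trans hrR]
    abel
  have h := congrFun hid i
  simp only [Pi.sub_apply, Pi.neg_apply] at h
  rw [h, abs_neg]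
  exact abs_mulVec_le hP hfdiff i

/-- On the same event the chord iteration converges to a root of the score equation. -/
lemma chordRoot_spec [Nonempty (Fin s)] (hd : ∀ i, 0 < d i)
    (hs : ∀ y, ContDiffOn ℝ 3 (fun σ => ℓ σ y) (interior M.Θ)) {r κ p : ℝ} (hr : 0 < r)
    (hrR : r ≤ R) (hp : 0 < p) (hκ : s * (p * (s * ((s + 1) * κ))) ≤ 1 / 2)
    (hsub : SBox d (R / dStar d) σ ⊆ interior M.Θ) (hdet : IsUnit (M.QMat ℓ d σ).det)
    (hP : ∀ i j, |(M.QMat ℓ d σ)⁻¹ i j| ≤ p) {y : Fin M.N → ℝ}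
    (h1 : ∀ i, 1 / d i * |M.aVec ℓ σ y i| ≤ κ * r)
    (h2 : ∀ i j, 1 / Real.sqrt (d i * d j) * |M.FMat ℓ σ y i j - M.AMat ℓ σ i j| ≤ κ * dStar d)
    (h3 : ∀ i j k, ∀ τ ∈ SBox d (R / dStar d) σ,
      dStar d / (d i * d j * d k) * |pd i (pd j (pd k (fun σ => ℓ σ y))) τ| ≤ κ * dStar d / r) :
    (∀ i, M.aVec ℓ (chordRoot M ℓ d σ R y) y i = 0) ∧
      ∀ i, |d i * (chordRoot M ℓ d σ R y i - σ i)| ≤ r := by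
  have hD := dStar_pos hd
  have hκ0 : 0 ≤ κ := by
    have i0 : Fin s := Classical.arbitrary _
    have := (by positivity : (0 : ℝ) ≤ _).trans (h2 i0 i0)
    exact nonneg_of_mul_nonneg_left this hD
  have hs1 : (1 : ℝ) ≤ s := by
    have : 0 < s := Fin.pos_iff_nonempty.2 inferInstance
    exact_mod_cast this
  set T := chordStep M ℓ d σ R y with hT
  have hlip : ∀ x x' : Fin s → ℝ, ‖x‖ ≤ r → ‖x'‖ ≤ r → ‖T x - T x'‖ ≤ 1 / 2 * ‖x - x'‖ := by
    intro x x' hx hx'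
    rw [pi_norm_le_iff_of_nonneg (by positivity)]
    intro i
    refine (chordStep_sub_le hd hs hr hrR hsub hdet hP h2 h3
      (fun i => (norm_le_pi_norm x i).trans hx) (fun i => (norm_le_pi_norm x' i).trans hx') i).trans ?_
    have := mul_le_mul_of_nonneg_right hκ (norm_nonneg (x - x'))
    linarith
  -- The first step is −Q⁻¹D⁻¹a(σ), bounded by spκr. With the Lipschitz constant 1/2 this makes `T`
  -- map the ball of radius r into itself.
  have hT0 : ‖T 0‖ ≤ r / 2 := by
    rw [pi_norm_le_iff_of_nonneg (by positivity)]
    intro i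
    have hR : 0 ≤ R := hr.le.trans hrR
    have e : T 0 = -((M.QMat ℓ d σ)⁻¹ *ᵥ fun j => M.aVec ℓ σ y j / d j) := by
      have : scaledPoint d σ (clamp R 0) = σ := by
        rw [clamp_eq_self (by simpa using hR)]
        ext i
        simp
      rw [hT, chordStep, this, zero_sub]
    rw [e, Pi.neg_apply, norm_neg]
    refine (abs_mulVec_le hP (b := κ * r) (fun j => ?_) i).trans ?_
    · rw [abs_div, abs_of_pos (hd j), div_eq_inv_mul, ← one_div]
      exact h1 j
    · have e1 : (1 : ℝ) ≤ s * (s + 1) := by nlinarith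
      have e2 : 0 ≤ s * (p * κ) * r := by positivity
      have e3 := mul_le_mul_of_nonneg_right hκ hr.le
      nlinarith
  have hmaps : Set.MapsTo T (Metric.closedBall 0 r) (Metric.closedBall 0 r) := by
    intro x hx
    rw [mem_closedBall_zero_iff] at hx ⊢
    have e1 := hlip x 0 hx (by simpa using hr.le)
    calc ‖T x‖ = ‖(T x - T 0) + T 0‖ := by simp
      _ ≤ ‖T x - T 0‖ + ‖T 0‖ := norm_add_le _ _
      _ ≤ 1 / 2 * ‖x - 0‖ + r / 2 := add_le_add e1 hT0
      _ ≤ r := by rw [sub_zero]; linarith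
  have hcontr : ContractingWith (1 / 2 : ℝ≥0) (hmaps.restrict T _ _) := by
    refine ⟨by rw [← NNReal.coe_lt_coe]; norm_num, LipschitzWith.of_dist_le_mul fun x x' => ?_⟩
    rw [Subtype.dist_eq, Subtype.dist_eq, dist_eq_norm, dist_eq_norm]
    have := hlip x.1 x'.1 (mem_closedBall_zero_iff.1 x.2) (mem_closedBall_zero_iff.1 x'.2)
    simpa using this
  obtain ⟨x, hx, hfix, hlim, -⟩ := hcontr.exists_fixedPoint' Metric.isClosed_closedBall.isComplete
    hmaps (Metric.mem_closedBall_self hr.le) (edist_ne_top _ _)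
  rw [mem_closedBall_zero_iff] at hx
  have hxi : ∀ i, |x i| ≤ r := fun i => (norm_le_pi_norm x i).trans hx
  have hroot : chordRoot M ℓ d σ R y = scaledPoint d σ x := by
    have : (fun i => limsup (fun k => (chordStep M ℓ d σ R y)^[k] 0 i) atTop) = x := by
      funext i
      exact ((tendsto_pi_nhds.1 hlim) i).limsup_eq
    rw [chordRoot, this, clamp_eq_self fun i => (hxi i).trans hrR]
  rw [hroot]
  refine ⟨fun i => ?_, fun i => ?_⟩
  · have hfix' : x - (M.QMat ℓ d σ)⁻¹ *ᵥ (fun j => M.aVec ℓ (scaledPoint d σ x) y j / d j) = x := by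
      have : T x = x := hfix
      rwa [hT, chordStep, clamp_eq_self fun i => (hxi i).trans hrR] at this
    -- At a fixed point Q⁻¹ annihilates the scaled score, so multiplying by Q shows that the score
    -- vanishes.
    have h0 : (M.QMat ℓ d σ)⁻¹ *ᵥ (fun j => M.aVec ℓ (scaledPoint d σ x) y j / d j) = 0 := by
      simpa using hfix'
    have h0' : (fun j => M.aVec ℓ (scaledPoint d σ x) y j / d j) = 0 := by
      have := congrArg (fun v => M.QMat ℓ d σ *ᵥ v) h0
      simpa [Matrix.mulVec_mulVec, Matrix.mul_nonsing_inv _ hdet] using this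
    have := congrFun h0' i
    simp only [Pi.zero_apply, div_eq_zero_iff, (hd i).ne', or_false] at this
    exact this
  · rw [scaledPoint_apply, add_sub_cancel_left, mul_div_cancel₀ _ (hd i).ne']
    exact hxi i

end Chord

/-! ### Existence of admissible estimators. -/

section Existence

variable {s : ℕ} {M : ℕ → MixedModel s} {ℓ : ∀ n, Par s → (Fin (M n).N → ℝ) → ℝ}
  {d : ℕ → Fin s → ℝ} {σ₀ : Par s} {g δ : ℝ}

lemma MomentBdd.mono {f f' : ∀ n, (Fin (M n).N → ℝ) → ℝ≥0∞} (hg : 0 ≤ g)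
    (h : MomentBdd M σ₀ g f) (hle : ∀ n y, f' n y ≤ f n y) : MomentBdd M σ₀ g f' := by
  obtain ⟨K, hK⟩ := h
  exact ⟨K, fun n => (lintegral_mono fun y => ENNReal.rpow_le_rpow (hle n y) hg).trans (hK n)⟩

/-- A polynomial tail bound for quantities with bounded moments. -/
lemma MomentBdd.exists_tail_le {f : ∀ n, (Fin (M n).N → ℝ) → ℝ≥0∞} (hg : 0 < g)
    (h : MomentBdd M σ₀ g f) (hf : ∀ n, Measurable (f n)) {κ e τ : ℝ} (hκ : 0 < κ) (he : τ ≤ e) :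
    ∃ C : ℝ, 0 ≤ C ∧ ∀ n, 1 ≤ dStar (d n) →
      (M n).law σ₀ {y | ENNReal.ofReal (κ * dStar (d n) ^ e) < f n y}
        ≤ ENNReal.ofReal (C * dStar (d n) ^ (-(τ * g))) := by
  obtain ⟨K, hK⟩ := h
  refine ⟨K * κ ^ (-g), by positivity, fun n hn => ?_⟩
  have hD : 0 < dStar (d n) := by linarith
  refine (measure_gt_le_of_lintegral_rpow (hf n) hg (by positivity) (hK n)).trans ?_
  refine ENNReal.ofReal_le_ofReal ?_
  rw [Real.mul_rpow hκ.le (by positivity), ← Real.rpow_mul hD.le, mul_assoc]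
  refine mul_le_mul_of_nonneg_left ?_ K.2
  refine mul_le_mul_of_nonneg_left ?_ (by positivity)
  refine Real.rpow_le_rpow_of_exponent_le hn ?_
  nlinarith

/-- Probabilities are at most 1, so the finitely many exceptional n can be absorbed into the
constant. -/
lemma exists_const_of_eventually_le [Nonempty (Fin s)] (hd : ∀ n i, 0 < d n i) {p : ℕ → ℝ≥0∞}
    (hp : ∀ n, p n ≤ 1) {c t : ℝ} (h : ∀ᶠ n in atTop, p n ≤ ENNReal.ofReal (c * dStar (d n) ^ t)) :
    ∃ c' : ℝ, ∀ n, p n ≤ ENNReal.ofReal (c' * dStar (d n) ^ t) := by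
  obtain ⟨N, hN⟩ := eventually_atTop.1 h
  have hpos : ∀ n, 0 < dStar (d n) ^ t := fun n => Real.rpow_pos_of_pos (dStar_pos (hd n)) t
  have hsum : 0 ≤ ∑ n ∈ Finset.range N, (dStar (d n) ^ t)⁻¹ :=
    Finset.sum_nonneg fun n _ => (inv_pos.2 (hpos n)).le
  refine ⟨|c| + ∑ n ∈ Finset.range N, (dStar (d n) ^ t)⁻¹, fun n => ?_⟩
  rcases le_or_gt N n with hn | hn
  · refine (hN n hn).trans (ENNReal.ofReal_le_ofReal ?_)
    refine mul_le_mul_of_nonneg_right ?_ (hpos n).le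
    linarith [le_abs_self c]
  · refine (hp n).trans ?_
    rw [← ENNReal.ofReal_one]
    refine ENNReal.ofReal_le_ofReal ?_
    have h1 : (dStar (d n) ^ t)⁻¹ ≤ ∑ n ∈ Finset.range N, (dStar (d n) ^ t)⁻¹ :=
      Finset.single_le_sum (f := fun n => (dStar (d n) ^ t)⁻¹)
        (fun n _ => (inv_pos.2 (hpos n)).le) (Finset.mem_range.2 hn)
    rw [← div_le_iff₀ (hpos n), one_div]
    linarith [abs_nonneg c]

/-- The chord root is defined without reference to ρ, so one sequence of estimators serves all ρ;
only the events depend on it. On each event `chordRoot_spec` gives a root within the required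
distance, and polynomial tails bound the complement. -/
theorem exists_scoreRoot (h : ScoreConditions M ℓ d σ₀ g δ) :
    ∃ σhat : ∀ n, (Fin (M n).N → ℝ) → Par s,
      IsScoreRoot M ℓ d σ₀ g σhat ∧ ∀ n y, σhat n y ∈ interior (M n).Θ := by
  have hne : Nonempty (Fin s) := nonempty_of_dStar_tendsto h.dStar_tendsto
  have hsN : 0 < s := Fin.pos_iff_nonempty.2 inferInstance
  have hs1 : (1 : ℝ) ≤ s := by exact_mod_cast hsN
  obtain ⟨δ', hδ', hδδ, hsub⟩ := exists_SBox_subset h.d_pos h.mem_interior h.δ_pos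
  obtain ⟨c, hc, hneg⟩ := h.eventually_negDef
  have hDpos : ∀ n, 0 < dStar (d n) := fun n => dStar_pos (h.d_pos n)
  have hquot : ∀ n, δ' * dStar (d n) / dStar (d n) = δ' := fun n =>
    mul_div_cancel_right₀ _ (hDpos n).ne'
  have hR : ∀ n, 0 ≤ δ' * dStar (d n) := fun n => mul_nonneg hδ'.le (hDpos n).le
  refine ⟨fun n => chordRoot (M n) (ℓ n) (d n) σ₀ (δ' * dStar (d n)), ⟨fun n => ?_, ?_⟩,
    fun n y => ?_⟩
  · exact measurable_chordRoot (h.d_pos n) (hR n) (h.measurable_crit n) (h.smooth n)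
      (by rw [hquot]; exact hsub n)
  swap
  · exact hsub n (by simpa only [hquot] using chordRoot_mem (h.d_pos n) (hR n) y)
  intro ρ hρ0 hρ1
  -- The three kinds of derivatives have tails with exponents 1 − ρ', 1 and ρ' times g, and each
  -- factor must be at least τ. Raising ρ to at least 1/4 secures this and only shrinks the allowed
  -- radius.
  set ρ' := max ρ (1 / 4) with hρ'
  have hρ'0 : 0 < ρ' := lt_max_of_lt_left hρ0
  have hρ'1 : ρ' < 1 := max_lt hρ1 (by norm_num)
  set τ := min (1 / 4) (1 - ρ) with hτ
  have hτ1 : τ ≤ 1 - ρ' := by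
    rcases le_total ρ (1 / 4) with h4 | h4
    · rw [hρ', max_eq_right h4]
      exact (min_le_left _ _).trans (by norm_num)
    · rw [hρ', max_eq_left h4]
      exact min_le_right _ _
  have hτ2 : τ ≤ 1 := (min_le_left _ _).trans (by norm_num)
  have hτ3 : τ ≤ ρ' := (min_le_left _ _).trans (le_max_right _ _)
  set p : ℝ := 1 / c with hp
  have hp0 : 0 < p := by positivity
  -- The value for which the Lipschitz constant of the iteration is exactly 1/2.
  set κ : ℝ := 1 / (2 * (s * (p * (s * (s + 1))))) with hκ
  have hκ0 : 0 < κ := by positivity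
  have hκ' : s * (p * (s * ((s + 1) * κ))) ≤ 1 / 2 := by
    rw [hκ]; field_simp; norm_num
  -- The divisor 2s turns the coordinatewise bound r into a Euclidean bound of half the allowed
  -- radius, hence a strict inequality.
  set r : ℕ → ℝ := fun n => dStar (d n) ^ (1 - ρ') / (2 * s) with hr
  have hm1 : ∀ n i, Measurable fun y =>
      ENNReal.ofReal (1 / d n i * |(M n).aVec (ℓ n) σ₀ y i|) := fun n i =>
    ENNReal.measurable_ofReal.comp (((measurable_aVec (h.measurable_crit n) (h.smooth n)
      (h.mem_interior' n) i).abs).const_mul _)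
  have hm2 : ∀ n i j, Measurable fun y => ENNReal.ofReal (1 / Real.sqrt (d n i * d n j) *
      |(M n).FMat (ℓ n) σ₀ y i j - ∫ y', (M n).FMat (ℓ n) σ₀ y' i j ∂((M n).law σ₀)|) :=
    fun n i j => ENNReal.measurable_ofReal.comp ((((measurable_FMat (h.measurable_crit n)
      (h.smooth n) (h.mem_interior' n) i j).sub_const _).abs).const_mul _)
  have hm3 : ∀ n i j k, Measurable fun y =>
      ENNReal.ofReal (dStar (d n) / (d n i * d n j * d n k)) *
        ⨆ τ ∈ SBox (d n) δ' σ₀, ENNReal.ofReal |pd i (pd j (pd k (fun σ => ℓ n σ y))) τ| :=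
    fun n i j k => (measurable_iSup_third (h.measurable_crit n) (h.smooth n) (hsub n)
      i j k).const_mul _
  have hmom3 : ∀ i j k, MomentBdd M σ₀ g fun n y =>
      ENNReal.ofReal (dStar (d n) / (d n i * d n j * d n k)) *
        ⨆ τ ∈ SBox (d n) δ' σ₀, ENNReal.ofReal |pd i (pd j (pd k (fun σ => ℓ n σ y))) τ| :=
    fun i j k => (h.moment3 i j k).mono h.g_pos.le fun n y => 
      mul_le_mul_right (biSup_mono fun τ hτ => SBox_mono (h.d_pos n) hδδ σ₀ hτ) _
  choose C₁ hC₁0 hC₁ using fun i => (h.moment1 i).exists_tail_le (d := d) h.g_pos (fun n => hm1 n i)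
    (κ := κ / (2 * s)) (by positivity) hτ1
  choose C₂ hC₂0 hC₂ using fun i j => (h.moment2 i j).exists_tail_le (d := d) h.g_pos
    (fun n => hm2 n i j) hκ0 hτ2
  choose C₃ hC₃0 hC₃ using fun i j k => (hmom3 i j k).exists_tail_le (d := d) h.g_pos
    (fun n => hm3 n i j k) (κ := κ * (2 * s)) (by positivity) hτ3
  -- The exceptional sets are the failures of the three bounds in `chordRoot_spec`: κr for the
  -- score, κd_* for the centred Hessian and κd_*/r = 2sκ d_*^ρ' for the third derivatives.
  set E₁ : ∀ n, Fin s → Set (Fin (M n).N → ℝ) := fun n i =>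
    {y | ENNReal.ofReal (κ / (2 * s) * dStar (d n) ^ (1 - ρ')) <
      ENNReal.ofReal (1 / d n i * |(M n).aVec (ℓ n) σ₀ y i|)} with hE₁
  set E₂ : ∀ n, Fin s → Fin s → Set (Fin (M n).N → ℝ) := fun n i j =>
    {y | ENNReal.ofReal (κ * dStar (d n) ^ (1 : ℝ)) <
      ENNReal.ofReal (1 / Real.sqrt (d n i * d n j) * |(M n).FMat (ℓ n) σ₀ y i j -
        ∫ y', (M n).FMat (ℓ n) σ₀ y' i j ∂((M n).law σ₀)|)} with hE₂
  set E₃ : ∀ n, Fin s → Fin s → Fin s → Set (Fin (M n).N → ℝ) := fun n i j k =>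
    {y | ENNReal.ofReal (κ * (2 * s) * dStar (d n) ^ ρ') <
      ENNReal.ofReal (dStar (d n) / (d n i * d n j * d n k)) *
        ⨆ τ ∈ SBox (d n) δ' σ₀, ENNReal.ofReal |pd i (pd j (pd k (fun σ => ℓ n σ y))) τ|} with hE₃
  set E : ∀ n, Set (Fin (M n).N → ℝ) := fun n =>
    (⋃ i, E₁ n i) ∪ (⋃ i, ⋃ j, E₂ n i j) ∪ ⋃ i, ⋃ j, ⋃ k, E₃ n i j k with hE
  refine ⟨fun n => (E n)ᶜ, fun n => ?_, ?_, ?_⟩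
  · refine MeasurableSet.compl (((MeasurableSet.iUnion fun i => ?_).union
      (MeasurableSet.iUnion fun i => MeasurableSet.iUnion fun j => ?_)).union
      (MeasurableSet.iUnion fun i => MeasurableSet.iUnion fun j => MeasurableSet.iUnion fun k => ?_))
    · exact measurableSet_lt measurable_const (hm1 n i)
    · exact measurableSet_lt measurable_const (hm2 n i j)
    · exact measurableSet_lt measurable_const (hm3 n i j k)
  · have hev : ∀ᶠ n in atTop, r n ≤ δ' * dStar (d n) := by
      have h1 : Tendsto (fun n => dStar (d n) ^ (-ρ')) atTop (𝓝 0) :=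
        (tendsto_rpow_neg_atTop hρ'0).comp h.dStar_tendsto
      filter_upwards [h1.eventually_le_const hδ'] with n hn
      have e : dStar (d n) ^ (1 - ρ') = dStar (d n) ^ (-ρ') * dStar (d n) := by
        rw [sub_eq_add_neg, Real.rpow_add (hDpos n), Real.rpow_one, mul_comm]
      have hle : r n ≤ dStar (d n) ^ (1 - ρ') :=
        div_le_self (Real.rpow_nonneg (hDpos n).le _) (by linarith)
      rw [e] at hle
      exact hle.trans (mul_le_mul_of_nonneg_right hn (hDpos n).le)
    filter_upwards [hneg, hev, h.dStar_tendsto.eventually_ge_atTop 1] with n hn hrn hD1 y hy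
    obtain ⟨hdet, hP⟩ := inv_bound_of_negDef hc hn
    have hrpos : 0 < r n := by have := hDpos n; positivity
    have hy1 : ∀ i, y ∉ E₁ n i := fun i hi => hy (Or.inl (Or.inl (Set.mem_iUnion.2 ⟨i, hi⟩)))
    have hy2 : ∀ i j, y ∉ E₂ n i j := fun i j hi =>
      hy (Or.inl (Or.inr (Set.mem_iUnion₂.2 ⟨i, j, hi⟩)))
    have hy3 : ∀ i j k, y ∉ E₃ n i j k := fun i j k hi =>
      hy (Or.inr (Set.mem_iUnion.2 ⟨i, Set.mem_iUnion₂.2 ⟨j, k, hi⟩⟩))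
    simp only [hE₁, Set.mem_ofPred_eq, not_lt] at hy1
    simp only [hE₂, Set.mem_ofPred_eq, not_lt] at hy2
    simp only [hE₃, Set.mem_ofPred_eq, not_lt] at hy3
    obtain ⟨hroot, hclose⟩ := chordRoot_spec (R := δ' * dStar (d n)) (y := y) (h.d_pos n) (h.smooth n)
      hrpos hrn hp0 hκ' (by rw [hquot]; exact hsub n) hdet hP
      (fun i => by
        have := hy1 i
        rw [ENNReal.ofReal_le_ofReal_iff (by have := hDpos n; positivity)] at this
        refine this.trans (le_of_eq ?_)
        rw [hr]; ring)
      (fun i j => by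
        have := hy2 i j
        rw [ENNReal.ofReal_le_ofReal_iff (by have := hDpos n; positivity), Real.rpow_one] at this
        exact this)
      (fun i j k τ hτ => by
        rw [hquot] at hτ
        have h1 := hy3 i j k
        have h2 : ENNReal.ofReal (dStar (d n) / (d n i * d n j * d n k) *
            |pd i (pd j (pd k (fun σ => ℓ n σ y))) τ|) ≤
            ENNReal.ofReal (κ * (2 * s) * dStar (d n) ^ ρ') := by
          refine le_trans ?_ h1
          rw [ENNReal.ofReal_mul (by
            have := hDpos n; have := h.d_pos n i; have := h.d_pos n j; have := h.d_pos n k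
            positivity)]
          gcongr
          exact le_biSup (fun τ => ENNReal.ofReal |pd i (pd j (pd k (fun σ => ℓ n σ y))) τ|) hτ
        rw [ENNReal.ofReal_le_ofReal_iff (by have := hDpos n; positivity)] at h2
        refine h2.trans (le_of_eq ?_)
        have e : dStar (d n) = dStar (d n) ^ ρ' * dStar (d n) ^ (1 - ρ') := by
          rw [← Real.rpow_add (hDpos n)]; simp
        have := Real.rpow_pos_of_pos (hDpos n) (1 - ρ')
        rw [hr, eq_div_iff (by positivity)]
        conv_rhs => rw [e]
        field_simp)
    refine ⟨interior_subset (hsub n (by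
      simpa only [hquot] using chordRoot_mem (h.d_pos n) (hR n) y)), hroot, ?_⟩
    have hstep : Real.sqrt (∑ i, (d n i *
        (chordRoot (M n) (ℓ n) (d n) σ₀ (δ' * dStar (d n)) y i - σ₀ i)) ^ 2) ≤ s * r n := by
      rw [Real.sqrt_le_left (by positivity)]
      calc _ ≤ ∑ _i : Fin s, r n ^ 2 := Finset.sum_le_sum fun i _ => by
            rw [← sq_abs]; gcongr; exact hclose i
        _ = s * r n ^ 2 := by simp
        _ ≤ (s * r n) ^ 2 := by
            have e : (0 : ℝ) ≤ s * (s - 1) := mul_nonneg (by positivity) (sub_nonneg.2 hs1)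
            nlinarith [mul_nonneg e (sq_nonneg (r n))]
    refine hstep.trans_lt ?_
    have e1 : s * r n = dStar (d n) ^ (1 - ρ') / 2 := by rw [hr]; field_simp
    have e2 : 0 < dStar (d n) ^ (1 - ρ') := Real.rpow_pos_of_pos (hDpos n) _
    have e3 : dStar (d n) ^ (1 - ρ') ≤ dStar (d n) ^ (1 - ρ) :=
      Real.rpow_le_rpow_of_exponent_le hD1 (by linarith [le_max_left ρ (1 / 4)])
    rw [e1]; linarith
  · refine exists_const_of_eventually_le h.d_pos (fun n => prob_le_one)
      (c := ∑ i, C₁ i + ∑ i, ∑ j, C₂ i j + ∑ i, ∑ j, ∑ k, C₃ i j k) ?_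
    filter_upwards [h.dStar_tendsto.eventually_ge_atTop 1] with n hD1
    rw [compl_compl]
    have hz : 0 ≤ dStar (d n) ^ (-(τ * g)) := Real.rpow_nonneg (hDpos n).le _
    have u1 : (M n).law σ₀ (⋃ i, E₁ n i) ≤
        ENNReal.ofReal (∑ i, C₁ i * dStar (d n) ^ (-(τ * g))) := by
      rw [ENNReal.ofReal_sum_of_nonneg fun i _ => mul_nonneg (hC₁0 i) hz]
      exact (measure_iUnion_fintype_le _ _).trans (Finset.sum_le_sum fun i _ => hC₁ i n hD1)
    have u2 : (M n).law σ₀ (⋃ i, ⋃ j, E₂ n i j) ≤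
        ENNReal.ofReal (∑ i, ∑ j, C₂ i j * dStar (d n) ^ (-(τ * g))) := by
      rw [ENNReal.ofReal_sum_of_nonneg fun i _ => Finset.sum_nonneg fun j _ =>
        mul_nonneg (hC₂0 i j) hz]
      refine (measure_iUnion_fintype_le _ _).trans (Finset.sum_le_sum fun i _ => ?_)
      rw [ENNReal.ofReal_sum_of_nonneg fun j _ => mul_nonneg (hC₂0 i j) hz]
      exact (measure_iUnion_fintype_le _ _).trans (Finset.sum_le_sum fun j _ => hC₂ i j n hD1)
    have u3 : (M n).law σ₀ (⋃ i, ⋃ j, ⋃ k, E₃ n i j k) ≤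
        ENNReal.ofReal (∑ i, ∑ j, ∑ k, C₃ i j k * dStar (d n) ^ (-(τ * g))) := by
      rw [ENNReal.ofReal_sum_of_nonneg fun i _ => Finset.sum_nonneg fun j _ =>
        Finset.sum_nonneg fun k _ => mul_nonneg (hC₃0 i j k) hz]
      refine (measure_iUnion_fintype_le _ _).trans (Finset.sum_le_sum fun i _ => ?_)
      rw [ENNReal.ofReal_sum_of_nonneg fun j _ =>
        Finset.sum_nonneg fun k _ => mul_nonneg (hC₃0 i j k) hz]
      refine (measure_iUnion_fintype_le _ _).trans (Finset.sum_le_sum fun j _ => ?_)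
      rw [ENNReal.ofReal_sum_of_nonneg fun k _ => mul_nonneg (hC₃0 i j k) hz]
      exact (measure_iUnion_fintype_le _ _).trans (Finset.sum_le_sum fun k _ => hC₃ i j k n hD1)
    refine (measure_union_le _ _).trans ((add_le_add_left (measure_union_le _ _) _).trans ?_)
    refine (add_le_add (add_le_add u1 u2) u3).trans (le_of_eq ?_)
    have n1 := Finset.sum_nonneg fun i (_ : i ∈ Finset.univ) => mul_nonneg (hC₁0 i) hz
    have n2 := Finset.sum_nonneg fun i (_ : i ∈ Finset.univ) =>
      Finset.sum_nonneg fun j (_ : j ∈ Finset.univ) => mul_nonneg (hC₂0 i j) hz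
    have n3 := Finset.sum_nonneg fun i (_ : i ∈ Finset.univ) =>
      Finset.sum_nonneg fun j (_ : j ∈ Finset.univ) =>
        Finset.sum_nonneg fun k (_ : k ∈ Finset.univ) => mul_nonneg (hC₃0 i j k) hz
    rw [← ENNReal.ofReal_add n1 n2, ← ENNReal.ofReal_add (add_nonneg n1 n2) n3]
    simp only [← Finset.sum_mul, ← add_mul]

end Existence

/-! ### Solving the standardized score equation by substitution. -/

section Expansion

variable {s : ℕ}

lemma abs_dotProduct_le {v w : Fin s → ℝ} {a b : ℝ} (hv : ∀ i, |v i| ≤ a) (hw : ∀ i, |w i| ≤ b) :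
    |v ⬝ᵥ w| ≤ s * (a * b) := by
  simp only [dotProduct]
  refine (Finset.abs_sum_le_sum_abs _ _).trans ?_
  calc ∑ j, |v j * w j| ≤ ∑ _j : Fin s, a * b := Finset.sum_le_sum fun j _ => by
        rw [abs_mul]
        exact mul_le_mul (hv j) (hw j) (abs_nonneg _) ((abs_nonneg _).trans (hv j))
    _ = s * (a * b) := by simp

lemma abs_quadratic_sub_le {B : Matrix (Fin s) (Fin s) ℝ} {x z : Fin s → ℝ} {k e a b : ℝ}
    (hB : ∀ i j, |B i j| ≤ k) (hx : ∀ i, |x i| ≤ a) (hz : ∀ i, |z i| ≤ b)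
    (he : ∀ i, |x i - z i| ≤ e) :
    |x ⬝ᵥ (B *ᵥ x) - z ⬝ᵥ (B *ᵥ z)| ≤ s * (s * (k * e)) * (a + b) := by
  have h : x ⬝ᵥ (B *ᵥ x) - z ⬝ᵥ (B *ᵥ z) = (x - z) ⬝ᵥ (B *ᵥ x) + z ⬝ᵥ (B *ᵥ (x - z)) := by
    rw [Matrix.mulVec_sub, sub_dotProduct, dotProduct_sub]; ring
  rw [h]
  have e1 := abs_dotProduct_le (v := x - z) he (abs_mulVec_le hB hx)
  have e2 := abs_dotProduct_le hz (abs_mulVec_le hB (v := x - z) he)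
  refine (abs_add_le _ _).trans ((add_le_add e1 e2).trans (le_of_eq ?_))
  ring

/-- The first three terms of the stochastic expansion of the solution `x` of the standardized
score equation `0 = λ + (Q + L)x + ½h(x, x) + ⋯`, where `z = -Q⁻¹λ`. -/
def expansion (P L : Matrix (Fin s) (Fin s) ℝ) (h : Fin s → Matrix (Fin s) (Fin s) ℝ)
    (z : Fin s → ℝ) : Fin s → ℝ :=
  z - P *ᵥ (L *ᵥ z) - P *ᵥ fun i => 1 / 2 * (z ⬝ᵥ (h i *ᵥ z))

/-- Applying P to the equation gives x − z = −P(Lx + q(x) − ρ), with q the quadratic term and ρ the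
residual. The right side is O(WX²/D), which is the first claim. Replacing x by z in L and q with
this error gives the second. Here `X` bounds x, `W` the derivatives, and `D` stands for d_*. -/
lemma abs_sub_expansion_le (hs1 : (1 : ℝ) ≤ s) {P Q L : Matrix (Fin s) (Fin s) ℝ}
    {h : Fin s → Matrix (Fin s) (Fin s) ℝ} {lam x : Fin s → ℝ} {p W X D : ℝ}
    (hPQ : P * Q = 1) (hp : 1 ≤ p) (hW : 1 ≤ W) (hX : 1 ≤ X) (hXD : X ≤ D)
    (hP : ∀ i j, |P i j| ≤ p) (hL : ∀ i j, |L i j| ≤ W / D) (hh : ∀ i j k, |h i j k| ≤ W / D)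
    (hlam : ∀ i, |lam i| ≤ W) (hx : ∀ i, |x i| ≤ X)
    (hscore : ∀ i, |lam i + ((Q + L) *ᵥ x) i + 1 / 2 * (x ⬝ᵥ (h i *ᵥ x))| ≤ W * X ^ 3 / D ^ 2) :
    (∀ i, |x i - (-(P *ᵥ lam)) i| ≤ 3 * s ^ 3 * p * (W * X ^ 2 / D)) ∧
    ∀ i, |x i - expansion P L h (-(P *ᵥ lam)) i|
      ≤ s * p * (3 * s ^ 4 * p + 3 * s ^ 6 * p ^ 2 + 1) * (W ^ 3 * X ^ 3 / D ^ 2) := by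
  have hD : 1 ≤ D := hX.trans hXD
  have hD0 : 0 < D := by linarith
  have hW0 : 0 < W := by linarith
  have hX0 : 0 < X := by linarith
  have hs0 : (0 : ℝ) < s := by linarith
  have hp0 : 0 < p := by linarith
  set z := -(P *ᵥ lam) with hz
  set ρ : Fin s → ℝ := fun i => lam i + ((Q + L) *ᵥ x) i + 1 / 2 * (x ⬝ᵥ (h i *ᵥ x)) with hρ
  set q : (Fin s → ℝ) → Fin s → ℝ := fun v i => 1 / 2 * (v ⬝ᵥ (h i *ᵥ v)) with hq
  have hzb : ∀ i, |z i| ≤ s * (p * W) := fun i => by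
    rw [hz, Pi.neg_apply, abs_neg]; exact abs_mulVec_le hP hlam i
  have hxe : x - z = -(P *ᵥ (L *ᵥ x + q x - ρ)) := by
    have e1 : ρ = lam + Q *ᵥ x + L *ᵥ x + q x := by
      funext i
      simp only [hρ, hq, Matrix.add_mulVec, Pi.add_apply]; ring
    have e2 : P *ᵥ (Q *ᵥ x) = x := by rw [Matrix.mulVec_mulVec, hPQ, Matrix.one_mulVec]
    have e3 : L *ᵥ x + q x - ρ = -lam - Q *ᵥ x := by rw [e1]; abel
    rw [e3, Matrix.mulVec_sub, e2, Matrix.mulVec_neg, hz]; abel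
  have hqx : ∀ i, |q x i| ≤ s ^ 2 * (W * X ^ 2 / D) := fun i => by
    have := abs_dotProduct_le hx (abs_mulVec_le (hh i) hx)
    rw [hq]
    simp only [abs_mul]
    rw [abs_of_pos (by norm_num : (0 : ℝ) < 1 / 2)]
    have e : (s : ℝ) * (X * (s * (W / D * X))) = s ^ 2 * (W * X ^ 2 / D) := by ring
    rw [e] at this
    have : 0 ≤ (s : ℝ) ^ 2 * (W * X ^ 2 / D) := by positivity
    linarith
  have hρb : ∀ i, |ρ i| ≤ W * X ^ 3 / D ^ 2 := hscore
  -- As X ≤ D, the cubic residual is no larger than the quadratic term, so it does not spoil the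
  -- first-order bound.
  have hXD2 : W * X ^ 3 / D ^ 2 ≤ W * X ^ 2 / D := by
    rw [div_le_div_iff₀ (by positivity) hD0]
    have : X ^ 3 * D ≤ X ^ 2 * D ^ 2 := by
      have : X ^ 2 * D * X ≤ X ^ 2 * D * D := by gcongr
      linarith
    nlinarith
  have hWX : 0 ≤ W * X ^ 2 / D := by positivity
  have hs2 : (1 : ℝ) ≤ s ^ 2 := one_le_pow₀ hs1
  have hss : (s : ℝ) ≤ s ^ 2 := by nlinarith
  have hfirst : ∀ i, |x i - z i| ≤ 3 * s ^ 3 * p * (W * X ^ 2 / D) := by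
    intro i
    have e1 : ∀ i, |(L *ᵥ x + q x - ρ) i| ≤ 3 * s ^ 2 * (W * X ^ 2 / D) := by
      intro i
      have a1 := abs_mulVec_le hL hx i
      have a2 : (s : ℝ) * (W / D * X) ≤ s ^ 2 * (W * X ^ 2 / D) := by
        have : W / D * X ≤ W * X ^ 2 / D := by
          rw [div_mul_eq_mul_div]
          have : X ≤ X ^ 2 := by nlinarith
          gcongr
        exact mul_le_mul hss this (by positivity) (by positivity)
      have a3 := abs_sub ((L *ᵥ x) i + q x i) (ρ i)
      have a4 := abs_add_le ((L *ᵥ x) i) (q x i)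
      have a5 := hqx i
      have a6 := hρb i
      simp only [Pi.sub_apply, Pi.add_apply]
      have a7 : W * X ^ 2 / D ≤ s ^ 2 * (W * X ^ 2 / D) := le_mul_of_one_le_left hWX hs2
      linarith
    have h0 := congrFun hxe i
    simp only [Pi.sub_apply, Pi.neg_apply] at h0
    rw [h0, abs_neg]
    refine (abs_mulVec_le hP e1 i).trans (le_of_eq ?_)
    ring
  refine ⟨hfirst, fun i => ?_⟩
  have hid : x - expansion P L h z = -(P *ᵥ (L *ᵥ (x - z) + (q x - q z) - ρ)) := by
    have e0 : expansion P L h z = z - P *ᵥ (L *ᵥ z) - P *ᵥ q z := rfl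
    have e1 : P *ᵥ (L *ᵥ (x - z) + (q x - q z) - ρ) =
        P *ᵥ (L *ᵥ x + q x - ρ) - P *ᵥ (L *ᵥ z) - P *ᵥ q z := by
      simp only [Matrix.mulVec_sub, Matrix.mulVec_add]; abel
    have e2 : P *ᵥ (L *ᵥ x + q x - ρ) = z - x := by rw [← neg_inj, ← hxe]; abel
    rw [e1, e2, e0]; abel
  have hb : ∀ i, |(L *ᵥ (x - z) + (q x - q z) - ρ) i| ≤
      (3 * s ^ 4 * p + 3 * s ^ 6 * p ^ 2 + 1) * (W ^ 3 * X ^ 3 / D ^ 2) := by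
    intro i
    have a1 := abs_mulVec_le hL (v := x - z) hfirst i
    have a2 : |q x i - q z i| ≤ 1 / 2 *
        (s * (s * (W / D * (3 * s ^ 3 * p * (W * X ^ 2 / D)))) * (X + s * (p * W))) := by
      have := abs_quadratic_sub_le (hh i) hx hzb hfirst
      simp only [hq, ← mul_sub, abs_mul]
      rw [abs_of_pos (by norm_num : (0 : ℝ) < 1 / 2)]
      linarith
    have a3 := abs_sub ((L *ᵥ (x - z)) i + (q x i - q z i)) (ρ i)
    have a4 := abs_add_le ((L *ᵥ (x - z)) i) (q x i - q z i)
    have a6 := hρb i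
    have hsp : 1 ≤ s * p := by nlinarith
    have hWW : 1 ≤ W ^ 2 := one_le_pow₀ hW
    have b1 : (s : ℝ) * (W / D * (3 * s ^ 3 * p * (W * X ^ 2 / D)))
        ≤ 3 * s ^ 4 * p * (W ^ 3 * X ^ 3 / D ^ 2) := by
      have : W ^ 2 * X ^ 2 ≤ W ^ 3 * X ^ 3 :=
        mul_le_mul (pow_le_pow_right₀ hW (by norm_num)) (pow_le_pow_right₀ hX (by norm_num))
          (by positivity) (by positivity)
      calc (s : ℝ) * (W / D * (3 * s ^ 3 * p * (W * X ^ 2 / D)))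
          = 3 * s ^ 4 * p * (W ^ 2 * X ^ 2 / D ^ 2) := by field_simp
        _ ≤ _ := by gcongr
    have b2 : 1 / 2 * (s * (s * (W / D * (3 * s ^ 3 * p * (W * X ^ 2 / D)))) * (X + s * (p * W)))
        ≤ 3 * s ^ 6 * p ^ 2 * (W ^ 3 * X ^ 3 / D ^ 2) := by
      have c1 : X + s * (p * W) ≤ 2 * (s * p * W * X) := by
        have c2 : 1 ≤ s * p * W := by nlinarith
        nlinarith
      calc 1 / 2 * (s * (s * (W / D * (3 * s ^ 3 * p * (W * X ^ 2 / D)))) * (X + s * (p * W)))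
          ≤ 1 / 2 * (s * (s * (W / D * (3 * s ^ 3 * p * (W * X ^ 2 / D)))) *
              (2 * (s * p * W * X))) := by gcongr
        _ = _ := by field_simp
    have b3 : W * X ^ 3 / D ^ 2 ≤ W ^ 3 * X ^ 3 / D ^ 2 := by
      have : W ≤ W ^ 3 := by nlinarith
      gcongr
    simp only [Pi.sub_apply, Pi.add_apply]
    linarith
  have h0 := congrFun hid i
  simp only [Pi.sub_apply, Pi.neg_apply] at h0
  rw [h0, abs_neg]
  refine (abs_mulVec_le hP hb i).trans (le_of_eq ?_)
  ring

/-- The quadratic approximation of `η` at the solution of the score equation. -/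
lemma abs_quadratic_expansion_le (hs1 : (1 : ℝ) ≤ s) {P Q L : Matrix (Fin s) (Fin s) ℝ}
    {h : Fin s → Matrix (Fin s) (Fin s) ℝ} {lam x : Fin s → ℝ} {p W X D : ℝ}
    (hPQ : P * Q = 1) (hp : 1 ≤ p) (hW : 1 ≤ W) (hX : 1 ≤ X) (hXD : X ≤ D)
    (hP : ∀ i j, |P i j| ≤ p) (hL : ∀ i j, |L i j| ≤ W / D) (hh : ∀ i j k, |h i j k| ≤ W / D)
    (hlam : ∀ i, |lam i| ≤ W) (hx : ∀ i, |x i| ≤ X)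
    (hscore : ∀ i, |lam i + ((Q + L) *ᵥ x) i + 1 / 2 * (x ⬝ᵥ (h i *ᵥ x))| ≤ W * X ^ 3 / D ^ 2)
    {b : Fin s → ℝ} {B : Matrix (Fin s) (Fin s) ℝ} {K : ℝ} (hb : ∀ i, |b i| ≤ K / D)
    (hB : ∀ i j, |B i j| ≤ K / D ^ 2) :
    |(b ⬝ᵥ x + 1 / 2 * (x ⬝ᵥ (B *ᵥ x))) - (b ⬝ᵥ expansion P L h (-(P *ᵥ lam)) +
        1 / 2 * ((-(P *ᵥ lam)) ⬝ᵥ (B *ᵥ (-(P *ᵥ lam)))))|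
      ≤ (s ^ 2 * p * (3 * s ^ 4 * p + 3 * s ^ 6 * p ^ 2 + 1) + 3 * s ^ 6 * p ^ 2) * K *
        (W ^ 3 * X ^ 3 / D ^ 3) := by
  obtain ⟨h1, h2⟩ := abs_sub_expansion_le hs1 hPQ hp hW hX hXD hP hL hh hlam hx hscore
  have hD0 : 0 < D := by linarith
  have hW0 : 0 < W := by linarith
  have hX0 : 0 < X := by linarith
  have hs0 : (0 : ℝ) < s := by linarith
  have hp0 : 0 < p := by linarith
  have hK : 0 ≤ K := by
    have i0 : Fin s := ⟨0, by exact_mod_cast hs0⟩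
    have := (abs_nonneg _).trans (hb i0)
    by_contra hneg
    push Not at hneg
    have := div_neg_of_neg_of_pos hneg hD0
    linarith
  set z := -(P *ᵥ lam) with hz
  have hzb : ∀ i, |z i| ≤ s * (p * W) := fun i => by
    rw [hz, Pi.neg_apply, abs_neg]; exact abs_mulVec_le hP hlam i
  -- The linear term, of weight 1/D, needs the full expansion of x. In the quadratic term, of weight
  -- 1/D², the first approximation z already suffices.
  have a1 := abs_dotProduct_le hb (w := x - expansion P L h z) h2
  have a2 := abs_quadratic_sub_le hB hx hzb h1
  have hid : (b ⬝ᵥ x + 1 / 2 * (x ⬝ᵥ (B *ᵥ x))) - (b ⬝ᵥ expansion P L h z +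
        1 / 2 * (z ⬝ᵥ (B *ᵥ z))) = b ⬝ᵥ (x - expansion P L h z) +
        1 / 2 * (x ⬝ᵥ (B *ᵥ x) - z ⬝ᵥ (B *ᵥ z)) := by
    rw [dotProduct_sub]; ring
  rw [hid]
  refine (abs_add_le _ _).trans ?_
  rw [abs_mul, abs_of_pos (by norm_num : (0 : ℝ) < 1 / 2)]
  have b1 : (s : ℝ) * (K / D * (s * p * (3 * s ^ 4 * p + 3 * s ^ 6 * p ^ 2 + 1) *
      (W ^ 3 * X ^ 3 / D ^ 2))) =
      s ^ 2 * p * (3 * s ^ 4 * p + 3 * s ^ 6 * p ^ 2 + 1) * K * (W ^ 3 * X ^ 3 / D ^ 3) := by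
    field_simp
  have hsp : 1 ≤ s * p := by nlinarith
  have b2 : 1 / 2 * (s * (s * (K / D ^ 2 * (3 * s ^ 3 * p * (W * X ^ 2 / D)))) *
      (X + s * (p * W))) ≤ 3 * s ^ 6 * p ^ 2 * K * (W ^ 3 * X ^ 3 / D ^ 3) := by
    have c1 : X + s * (p * W) ≤ 2 * (s * p * W * X) := by
      have c2 : 1 ≤ s * p * W := by nlinarith
      nlinarith
    have c3 : W ^ 2 ≤ W ^ 3 := pow_le_pow_right₀ hW (by norm_num)
    calc 1 / 2 * (s * (s * (K / D ^ 2 * (3 * s ^ 3 * p * (W * X ^ 2 / D)))) * (X + s * (p * W)))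
        ≤ 1 / 2 * (s * (s * (K / D ^ 2 * (3 * s ^ 3 * p * (W * X ^ 2 / D)))) *
            (2 * (s * p * W * X))) := by gcongr
      _ = 3 * s ^ 6 * p ^ 2 * K * (W ^ 2 * X ^ 3 / D ^ 3) := by field_simp
      _ ≤ _ := by gcongr
  linarith

end Expansion

/-! ### The corrections as polynomials, and stability of such polynomials. -/

section Corrections

variable {s : ℕ}

/-- `Δ₁` as a function of `b`, `P = Q⁻¹` and `U₂`. -/
def corr1 (d b : Fin s → ℝ) (P : Matrix (Fin s) (Fin s) ℝ) (U : Fin s → Fin s → Fin s → ℝ) : ℝ :=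
  ∑ i, ∑ j, ∑ k, ∑ l, b i / d i * P i j * (U j k l / Real.sqrt (d j * d k)) * P k l

/-- `Δ₂` as a function of `B`, `P = Q⁻¹` and `U₁`. -/
def corr2 (d : Fin s → ℝ) (B P : Matrix (Fin s) (Fin s) ℝ) (U : Fin s → Fin s → ℝ) : ℝ :=
  1 / 2 * ∑ i, ∑ j, ∑ k, ∑ l, P i j * (B j k / (d j * d k)) * P k l * U i l

/-- `Δ₃` as a function of `b`, `P = Q⁻¹` and `U₃`. -/
def corr3 (d b : Fin s → ℝ) (P : Matrix (Fin s) (Fin s) ℝ)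
    (U : Fin s → Fin s → Fin s → Fin s → Fin s → ℝ) : ℝ :=
  -(1 / 2) * ∑ i, ∑ j, ∑ k, ∑ l, ∑ m, ∑ n,
    b i / d i * (P i j / d j) * P l k * P m n * U j k l m n

/-- The leading term in the expansion of `η(σ̂) - η(σ)`. -/
def leadTerm (d b : Fin s → ℝ) (B P : Matrix (Fin s) (Fin s) ℝ) (lam₁ : Fin s → ℝ)
    (lam₂ : Fin s → Fin s → ℝ) (lam₃ : Fin s → Fin s → Fin s → ℝ) : ℝ :=
  -(∑ i, ∑ j, b i / d i * P i j * lam₁ j) + corr1 d b P (fun j k l => lam₂ j k * lam₁ l)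
    + corr2 d B P (fun i l => lam₁ i * lam₁ l)
    + corr3 d b P (fun j k l m n => lam₃ j k m * lam₁ l * lam₁ n)

/-- Multiplying out the expansion at z = −Pλ: the sign of z is lost in the quadratic terms and turns
the one in −PLz into a plus. Symmetry of P serves to match the index order in `corr2` and `corr3`.
-/
lemma leadTerm_eq {d b : Fin s → ℝ} {B P : Matrix (Fin s) (Fin s) ℝ} (hP : ∀ i j, P i j = P j i)
    (lam₁ : Fin s → ℝ) (lam₂ : Fin s → Fin s → ℝ) (lam₃ : Fin s → Fin s → Fin s → ℝ) :
    leadTerm d b B P lam₁ lam₂ lam₃ = (fun i => b i / d i) ⬝ᵥ expansion P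
        (Matrix.of fun i j => lam₂ i j / Real.sqrt (d i * d j))
        (fun i => Matrix.of fun j k => lam₃ i j k / d i) (-(P *ᵥ lam₁))
      + 1 / 2 * ((-(P *ᵥ lam₁)) ⬝ᵥ
          ((Matrix.of fun i j => B i j / (d i * d j)) *ᵥ (-(P *ᵥ lam₁)))) := by
  have e1 : (fun i => b i / d i) ⬝ᵥ (P *ᵥ lam₁) = ∑ i, ∑ j, b i / d i * P i j * lam₁ j := by
    simp only [dotProduct, Matrix.mulVec, Finset.mul_sum]
    exact Finset.sum_congr rfl fun i _ => Finset.sum_congr rfl fun j _ => by ring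
  have e2 : (fun i => b i / d i) ⬝ᵥ (P *ᵥ ((Matrix.of fun i j => lam₂ i j /
      Real.sqrt (d i * d j)) *ᵥ (P *ᵥ lam₁))) = corr1 d b P (fun j k l => lam₂ j k * lam₁ l) := by
    simp only [corr1, dotProduct, Matrix.mulVec, Finset.mul_sum, Matrix.of_apply]
    exact Finset.sum_congr rfl fun i _ => Finset.sum_congr rfl fun j _ =>
      Finset.sum_congr rfl fun k _ => Finset.sum_congr rfl fun l _ => by ring
  have e3 : 1 / 2 * ((P *ᵥ lam₁) ⬝ᵥ ((Matrix.of fun i j => B i j / (d i * d j)) *ᵥ (P *ᵥ lam₁)))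
      = corr2 d B P (fun i l => lam₁ i * lam₁ l) := by
    simp only [corr2, dotProduct, Matrix.mulVec, Matrix.of_apply]
    congr 1
    rw [Finset.sum_comm]
    refine Finset.sum_congr rfl fun j _ => ?_
    rw [Finset.sum_mul]
    refine Finset.sum_congr rfl fun i _ => ?_
    simp only [Finset.mul_sum]
    exact Finset.sum_congr rfl fun k _ => Finset.sum_congr rfl fun l _ => by
      rw [hP j i]; ring
  have e4 : (fun i => b i / d i) ⬝ᵥ (P *ᵥ fun i => 1 / 2 * ((P *ᵥ lam₁) ⬝ᵥ
      ((Matrix.of fun j k => lam₃ i j k / d i) *ᵥ (P *ᵥ lam₁)))) =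
      -corr3 d b P (fun j k l m n => lam₃ j k m * lam₁ l * lam₁ n) := by
    simp only [corr3, dotProduct, Matrix.mulVec, Matrix.of_apply]
    rw [neg_mul, neg_neg, Finset.mul_sum]
    refine Finset.sum_congr rfl fun i _ => ?_
    rw [Finset.mul_sum, Finset.mul_sum]
    refine Finset.sum_congr rfl fun j _ => ?_
    rw [Finset.mul_sum, Finset.mul_sum, Finset.mul_sum, Finset.mul_sum]
    refine Finset.sum_congr rfl fun k _ => ?_
    rw [Finset.sum_mul, Finset.mul_sum, Finset.mul_sum, Finset.mul_sum, Finset.mul_sum]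
    refine Finset.sum_congr rfl fun l _ => ?_
    simp only [Finset.mul_sum]
    exact Finset.sum_congr rfl fun m _ => Finset.sum_congr rfl fun n _ => by
      rw [hP l k]; ring
  unfold leadTerm expansion
  simp only [Matrix.mulVec_neg, neg_dotProduct, dotProduct_neg, neg_neg, dotProduct_sub, e1, e2, e3, e4]
  ring

/-- `x` and `x'` are bounded by `K` and at a distance of at most `Kε`. -/
def Close (K ε x x' : ℝ) : Prop := |x| ≤ K ∧ |x'| ≤ K ∧ |x - x'| ≤ K * ε

lemma Close.nonneg {K ε x x' : ℝ} (h : Close K ε x x') : 0 ≤ K := (abs_nonneg _).trans h.1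

/-- The factor 2 comes from the product rule for differences. It is harmless in the bounds on the
products themselves. -/
lemma Close.mul {K L ε x x' y y' : ℝ} (h : Close K ε x x') (h' : Close L ε y y') :
    Close (2 * K * L) ε (x * y) (x' * y') := by
  have hK := h.nonneg
  have hL := h'.nonneg
  have hKL := mul_nonneg hK hL
  refine ⟨?_, ?_, ?_⟩
  · rw [abs_mul]
    have := mul_le_mul h.1 h'.1 (abs_nonneg _) hK
    linarith
  · rw [abs_mul]
    have := mul_le_mul h.2.1 h'.2.1 (abs_nonneg _) hK
    linarith
  · have e : x * y - x' * y' = (x - x') * y + x' * (y - y') := by ring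
    rw [e]
    refine (abs_add_le _ _).trans ?_
    rw [abs_mul, abs_mul]
    have e1 := mul_le_mul h.2.2 h'.1 (abs_nonneg _) ((abs_nonneg _).trans h.2.2)
    have e2 := mul_le_mul h.2.1 h'.2.2 (abs_nonneg _) hK
    linarith

lemma Close.mul_const {K ε x x' w : ℝ} (h : Close K ε x x') (hw : |w| ≤ 1) :
    Close K ε (x * w) (x' * w) := by
  refine ⟨?_, ?_, ?_⟩
  · rw [abs_mul]; exact (mul_le_of_le_one_right (abs_nonneg _) hw).trans h.1
  · rw [abs_mul]; exact (mul_le_of_le_one_right (abs_nonneg _) hw).trans h.2.1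
  · rw [← sub_mul, abs_mul]; exact (mul_le_of_le_one_right (abs_nonneg _) hw).trans h.2.2

lemma Close.add {K L ε x x' y y' : ℝ} (h : Close K ε x x') (h' : Close L ε y y') :
    Close (K + L) ε (x + y) (x' + y') := by
  refine ⟨(abs_add_le _ _).trans (add_le_add h.1 h'.1),
    (abs_add_le _ _).trans (add_le_add h.2.1 h'.2.1), ?_⟩
  rw [add_sub_add_comm, add_mul]
  exact (abs_add_le _ _).trans (add_le_add h.2.2 h'.2.2)

lemma Close.sum {K ε : ℝ} {f f' : Fin s → ℝ} (h : ∀ i, Close K ε (f i) (f' i)) :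
    Close (s * K) ε (∑ i, f i) (∑ i, f' i) := by
  refine ⟨?_, ?_, ?_⟩
  · refine (Finset.abs_sum_le_sum_abs _ _).trans ((Finset.sum_le_sum fun i _ => (h i).1).trans ?_)
    simp
  · refine (Finset.abs_sum_le_sum_abs _ _).trans ((Finset.sum_le_sum fun i _ => (h i).2.1).trans ?_)
    simp
  · rw [← Finset.sum_sub_distrib]
    refine (Finset.abs_sum_le_sum_abs _ _).trans ((Finset.sum_le_sum fun i _ => (h i).2.2).trans ?_)
    simp [mul_assoc]

variable {d : Fin s → ℝ} {b b' : Fin s → ℝ} {P P' B B' : Matrix (Fin s) (Fin s) ℝ}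
  {Kb KB KP KU ε : ℝ}

lemma dStar_le_sqrt [Nonempty (Fin s)] (hd : ∀ i, 0 < d i) (j k : Fin s) :
    dStar d ≤ Real.sqrt (d j * d k) := by
  rw [Real.le_sqrt' (dStar_pos hd), sq]
  exact mul_le_mul (dStar_le d j) (dStar_le d k) (dStar_pos hd).le (hd j).le

lemma abs_dStar_div_le [Nonempty (Fin s)] (hd : ∀ i, 0 < d i) {a : ℝ} (ha : dStar d ≤ a) :
    |dStar d / a| ≤ 1 := by
  have hD := dStar_pos hd
  rw [abs_of_nonneg (div_nonneg hD.le (hD.le.trans ha))]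
  exact (div_le_one (hD.trans_le ha)).2 ha

/-- Each summand has two weights of size at most 1/d_*, which the factor d_*² compensates. After
this rescaling the correction is a polynomial in bounded quantities with coefficients at most 1,
uniformly in the scales; `close_corr2` and `close_corr3` use the same argument. -/
lemma close_corr1 [Nonempty (Fin s)] (hd : ∀ i, 0 < d i) (hb : ∀ i, Close Kb ε (b i) (b' i))
    (hP : ∀ i j, Close KP ε (P i j) (P' i j)) {U U' : Fin s → Fin s → Fin s → ℝ}
    (hU : ∀ i j k, Close KU ε (U i j k) (U' i j k)) :
    Close (s * (s * (s * (s * (2 * (2 * (2 * Kb * KP) * KU) * KP))))) ε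
      (corr1 d b P U * dStar d ^ 2) (corr1 d b' P' U' * dStar d ^ 2) := by
  have key : ∀ (b : Fin s → ℝ) (P : Matrix (Fin s) (Fin s) ℝ) (U : Fin s → Fin s → Fin s → ℝ),
      corr1 d b P U * dStar d ^ 2 = ∑ i, ∑ j, ∑ k, ∑ l, b i * P i j * U j k l * P k l *
        (dStar d / d i) * (dStar d / Real.sqrt (d j * d k)) := by
    intro b P U
    simp only [corr1, Finset.sum_mul]
    exact Finset.sum_congr rfl fun i _ => Finset.sum_congr rfl fun j _ =>
      Finset.sum_congr rfl fun k _ => Finset.sum_congr rfl fun l _ => by ring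
  rw [key, key]
  refine Close.sum fun i => Close.sum fun j => Close.sum fun k => Close.sum fun l => ?_
  exact ((((hb i).mul (hP i j)).mul (hU j k l)).mul (hP k l)).mul_const
    (abs_dStar_div_le hd (dStar_le d i)) |>.mul_const (abs_dStar_div_le hd (dStar_le_sqrt hd j k))

lemma close_corr2 [Nonempty (Fin s)] (hd : ∀ i, 0 < d i)
    (hB : ∀ i j, Close KB ε (B i j) (B' i j))
    (hP : ∀ i j, Close KP ε (P i j) (P' i j)) {U U' : Fin s → Fin s → ℝ}
    (hU : ∀ i j, Close KU ε (U i j) (U' i j)) :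
    Close (s * (s * (s * (s * (2 * (2 * (2 * KP * KB) * KP) * KU))))) ε
      (corr2 d B P U * dStar d ^ 2) (corr2 d B' P' U' * dStar d ^ 2) := by
  have key : ∀ (B P : Matrix (Fin s) (Fin s) ℝ) (U : Fin s → Fin s → ℝ),
      corr2 d B P U * dStar d ^ 2 = (∑ i, ∑ j, ∑ k, ∑ l, P i j * B j k * P k l * U i l *
        (dStar d / d j) * (dStar d / d k)) * (1 / 2) := by
    intro B P U
    simp only [corr2, Finset.sum_mul, Finset.mul_sum]
    exact Finset.sum_congr rfl fun i _ => Finset.sum_congr rfl fun j _ =>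
      Finset.sum_congr rfl fun k _ => Finset.sum_congr rfl fun l _ => by ring
  rw [key, key]
  refine Close.mul_const ?_ (by rw [abs_of_pos] <;> norm_num)
  refine Close.sum fun i => Close.sum fun j => Close.sum fun k => Close.sum fun l => ?_
  exact ((((hP i j).mul (hB j k)).mul (hP k l)).mul (hU i l)).mul_const
    (abs_dStar_div_le hd (dStar_le d j)) |>.mul_const (abs_dStar_div_le hd (dStar_le d k))

lemma close_corr3 [Nonempty (Fin s)] (hd : ∀ i, 0 < d i) (hb : ∀ i, Close Kb ε (b i) (b' i))
    (hP : ∀ i j, Close KP ε (P i j) (P' i j))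
    {U U' : Fin s → Fin s → Fin s → Fin s → Fin s → ℝ}
    (hU : ∀ i j k l m, Close KU ε (U i j k l m) (U' i j k l m)) :
    Close (s * (s * (s * (s * (s * (s * (2 * (2 * (2 * (2 * Kb * KP) * KP) * KP) * KU))))))) ε
      (corr3 d b P U * dStar d ^ 2) (corr3 d b' P' U' * dStar d ^ 2) := by
  have key : ∀ (b : Fin s → ℝ) (P : Matrix (Fin s) (Fin s) ℝ)
      (U : Fin s → Fin s → Fin s → Fin s → Fin s → ℝ),
      corr3 d b P U * dStar d ^ 2 = (∑ i, ∑ j, ∑ k, ∑ l, ∑ m, ∑ n,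
        b i * P i j * P l k * P m n * U j k l m n *
        (dStar d / d i) * (dStar d / d j)) * (-(1 / 2)) := by
    intro b P U
    simp only [corr3, Finset.sum_mul, Finset.mul_sum]
    exact Finset.sum_congr rfl fun i _ => Finset.sum_congr rfl fun j _ =>
      Finset.sum_congr rfl fun k _ => Finset.sum_congr rfl fun l _ =>
      Finset.sum_congr rfl fun m _ => Finset.sum_congr rfl fun n _ => by ring
  rw [key, key]
  refine Close.mul_const ?_ (by rw [abs_neg, abs_of_pos] <;> norm_num)
  refine Close.sum fun i => Close.sum fun j => Close.sum fun k => Close.sum fun l =>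
    Close.sum fun m => Close.sum fun n => ?_
  exact (((((hb i).mul (hP i j)).mul (hP l k)).mul (hP m n)).mul (hU j k l m n)).mul_const
    (abs_dStar_div_le hd (dStar_le d i)) |>.mul_const (abs_dStar_div_le hd (dStar_le d j))

end Corrections

/-! ### The corrections as expectations of the leading term. -/

section Deltas

variable {s : ℕ} {M : MixedModel s} {ℓ : Par s → (Fin M.N → ℝ) → ℝ} {d : Fin s → ℝ} {σ : Par s}

/-- Centring F by its mean A changes nothing here, because E(a) = 0. This is where Δ₁, defined with
F, meets U₂, defined with F − A. -/
lemma integral_FMat_mul_aVec (hd : ∀ i, 0 < d i)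
    (ha : ∀ i, Integrable (fun y => M.aVec ℓ σ y i) (M.law σ))
    (hFa : ∀ i j k, Integrable (fun y => M.FMat ℓ σ y i j * M.aVec ℓ σ y k) (M.law σ))
    (hE : ∀ i, ∫ y, M.aVec ℓ σ y i ∂(M.law σ) = 0) (j k l : Fin s) :
    ∫ y, M.FMat ℓ σ y j k * M.aVec ℓ σ y l ∂(M.law σ)
      = M.U2 ℓ d σ j k l * (Real.sqrt (d j * d k) * d l) := by
  have hq : 0 < Real.sqrt (d j * d k) := Real.sqrt_pos.2 (mul_pos (hd j) (hd k))
  have hl := hd l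
  have e : ∀ y, M.lam2 ℓ d σ y j k * M.lam1 ℓ d σ y l =
      (M.FMat ℓ σ y j k * M.aVec ℓ σ y l - M.AMat ℓ σ j k * M.aVec ℓ σ y l) *
        (Real.sqrt (d j * d k) * d l)⁻¹ := by
    intro y
    simp only [MixedModel.lam2, MixedModel.lam1]
    field_simp
  simp only [MixedModel.U2, e]
  rw [integral_mul_const, integral_sub (hFa j k l) ((ha l).const_mul _), integral_const_mul, hE,
    mul_zero, sub_zero, inv_mul_cancel_right₀ (by positivity)]

/-- All powers of d coming from the scaling of A⁻¹, F and a cancel except the two weights in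
`corr1`. In this form Δ₁ can be compared at different parameter values. -/
lemma Delta1_eq_corr1 (hd : ∀ i, 0 < d i)
    (ha : ∀ i, Integrable (fun y => M.aVec ℓ σ y i) (M.law σ))
    (hFa : ∀ i j k, Integrable (fun y => M.FMat ℓ σ y i j * M.aVec ℓ σ y k) (M.law σ))
    (hE : ∀ i, ∫ y, M.aVec ℓ σ y i ∂(M.law σ) = 0) :
    M.Delta1 ℓ σ = corr1 d (M.bVec ℓ σ) (M.QMat ℓ d σ)⁻¹ (M.U2 ℓ d σ) := by
  have hint : ∀ j, ∫ y, (M.FMat ℓ σ y *ᵥ ((M.AMat ℓ σ)⁻¹ *ᵥ M.aVec ℓ σ y)) j ∂(M.law σ)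
      = ∑ k, ∑ l, (M.AMat ℓ σ)⁻¹ k l * (M.U2 ℓ d σ j k l * (Real.sqrt (d j * d k) * d l)) := by
    intro j
    have e : ∀ y, (M.FMat ℓ σ y *ᵥ ((M.AMat ℓ σ)⁻¹ *ᵥ M.aVec ℓ σ y)) j =
        ∑ k, ∑ l, (M.AMat ℓ σ)⁻¹ k l * (M.FMat ℓ σ y j k * M.aVec ℓ σ y l) := by
      intro y
      simp only [Matrix.mulVec, dotProduct, Finset.mul_sum]
      exact Finset.sum_congr rfl fun k _ => Finset.sum_congr rfl fun l _ => by ring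
    have w : ∀ k l, Integrable (fun y => (M.AMat ℓ σ)⁻¹ k l * (M.FMat ℓ σ y j k *
        M.aVec ℓ σ y l)) (M.law σ) := fun k l => (hFa j k l).const_mul _
    simp only [e]
    rw [integral_finsetSum _ fun k _ => integrable_finsetSum _ fun l _ => w k l]
    refine Finset.sum_congr rfl fun k _ => ?_
    rw [integral_finsetSum _ fun l _ => w k l]
    refine Finset.sum_congr rfl fun l _ => ?_
    rw [integral_const_mul, integral_FMat_mul_aVec hd ha hFa hE]
  simp only [MixedModel.Delta1, hint, corr1]
  simp only [dotProduct, Matrix.mulVec, Finset.mul_sum]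
  refine Finset.sum_congr rfl fun i _ => Finset.sum_congr rfl fun j _ =>
      Finset.sum_congr rfl fun k _ => Finset.sum_congr rfl fun l _ => ?_
  have hi := hd i
  have hj := hd j
  have hk := hd k
  have hl := hd l
  have hq : 0 < Real.sqrt (d j * d k) := Real.sqrt_pos.2 (mul_pos hj hk)
  have hsq : d j * d k = Real.sqrt (d j * d k) * Real.sqrt (d j * d k) :=
    (Real.mul_self_sqrt (by positivity)).symm
  rw [AMat_inv_apply hd, AMat_inv_apply hd]
  set q := Real.sqrt (d j * d k)
  have e1 : (M.QMat ℓ d σ)⁻¹ i j / (d i * d j) * ((M.QMat ℓ d σ)⁻¹ k l / (d k * d l) *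
      (M.U2 ℓ d σ j k l * (q * d l))) =
      (M.QMat ℓ d σ)⁻¹ i j * (M.QMat ℓ d σ)⁻¹ k l * M.U2 ℓ d σ j k l * q /
        (d i * (d j * d k)) := by
    field_simp
  rw [e1, hsq]
  field_simp

lemma Delta2_eq_corr2 (hd : ∀ i, 0 < d i)
    (haa : ∀ i j, Integrable (fun y => M.aVec ℓ σ y i * M.aVec ℓ σ y j) (M.law σ)) :
    M.Delta2 ℓ σ = corr2 d (M.BMat ℓ σ) (M.QMat ℓ d σ)⁻¹ (M.U1 ℓ d σ) := by
  have hU : ∀ i l, ∫ y, M.aVec ℓ σ y i * M.aVec ℓ σ y l ∂(M.law σ)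
      = M.U1 ℓ d σ i l * (d i * d l) := by
    intro i l
    have hi := hd i
    have hl := hd l
    have e : ∀ y, M.lam1 ℓ d σ y i * M.lam1 ℓ d σ y l =
        M.aVec ℓ σ y i * M.aVec ℓ σ y l * (d i * d l)⁻¹ := by
      intro y
      simp only [MixedModel.lam1]
      field_simp
    simp only [MixedModel.U1, Matrix.of_apply, e]
    rw [integral_mul_const, inv_mul_cancel_right₀ (by positivity)]
  have e : ∀ y, M.aVec ℓ σ y ⬝ᵥ
      (((M.AMat ℓ σ)⁻¹ * M.BMat ℓ σ * (M.AMat ℓ σ)⁻¹) *ᵥ M.aVec ℓ σ y) =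
      ∑ i, ∑ j, ∑ k, ∑ l, (M.AMat ℓ σ)⁻¹ i j * M.BMat ℓ σ j k * (M.AMat ℓ σ)⁻¹ k l *
        (M.aVec ℓ σ y i * M.aVec ℓ σ y l) := by
    intro y
    rw [← Matrix.mulVec_mulVec, ← Matrix.mulVec_mulVec]
    simp only [Matrix.mulVec, dotProduct, Finset.mul_sum]
    exact Finset.sum_congr rfl fun i _ => Finset.sum_congr rfl fun j _ =>
      Finset.sum_congr rfl fun k _ => Finset.sum_congr rfl fun l _ => by ring
  simp only [MixedModel.Delta2, corr2, e]
  congr 1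
  rw [integral_finsetSum _ fun i _ => integrable_finsetSum _ fun j _ =>
    integrable_finsetSum _ fun k _ => integrable_finsetSum _ fun l _ => (haa i l).const_mul _]
  refine Finset.sum_congr rfl fun i _ => ?_
  rw [integral_finsetSum _ fun j _ =>
    integrable_finsetSum _ fun k _ => integrable_finsetSum _ fun l _ => (haa i l).const_mul _]
  refine Finset.sum_congr rfl fun j _ => ?_
  rw [integral_finsetSum _ fun k _ => integrable_finsetSum _ fun l _ => (haa i l).const_mul _]
  refine Finset.sum_congr rfl fun k _ => ?_
  rw [integral_finsetSum _ fun l _ => (haa i l).const_mul _]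
  refine Finset.sum_congr rfl fun l _ => ?_
  rw [integral_const_mul, hU, AMat_inv_apply hd, AMat_inv_apply hd]
  have hi := hd i
  have hj := hd j
  have hk := hd k
  have hl := hd l
  field_simp

lemma Delta3_eq_corr3 (hd : ∀ i, 0 < d i)
    (hHaa : ∀ i j k l m, Integrable (fun y => M.HMat ℓ i σ y j k * M.aVec ℓ σ y l *
      M.aVec ℓ σ y m) (M.law σ)) :
    M.Delta3 ℓ σ = corr3 d (M.bVec ℓ σ) (M.QMat ℓ d σ)⁻¹ (M.U3 ℓ d σ) := by
  have hU : ∀ j k l m n, ∫ y, M.HMat ℓ j σ y k m * M.aVec ℓ σ y l * M.aVec ℓ σ y n ∂(M.law σ)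
      = M.U3 ℓ d σ j k l m n * (d k * d m * d l * d n) := by
    intro j k l m n
    have hk := hd k
    have hm := hd m
    have hl := hd l
    have hn := hd n
    have e : ∀ y, M.lam3 ℓ d σ y j k m * M.lam1 ℓ d σ y l * M.lam1 ℓ d σ y n =
        M.HMat ℓ j σ y k m * M.aVec ℓ σ y l * M.aVec ℓ σ y n * (d k * d m * d l * d n)⁻¹ := by
      intro y
      simp only [MixedModel.lam1, MixedModel.lam3]
      field_simp
    simp only [MixedModel.U3, e]
    rw [integral_mul_const, inv_mul_cancel_right₀ (by positivity)]
  have e : ∀ y j, (M.CMat ℓ σ y *ᵥ ((M.AMat ℓ σ)⁻¹ *ᵥ M.aVec ℓ σ y)) j =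
      ∑ k, ∑ l, ∑ m, ∑ n, (M.AMat ℓ σ)⁻¹ l k * (M.AMat ℓ σ)⁻¹ m n *
        (M.HMat ℓ j σ y k m * M.aVec ℓ σ y l * M.aVec ℓ σ y n) := by
    intro y j
    have e0 : (M.CMat ℓ σ y *ᵥ ((M.AMat ℓ σ)⁻¹ *ᵥ M.aVec ℓ σ y)) j =
        (M.aVec ℓ σ y ᵥ* (M.AMat ℓ σ)⁻¹) ⬝ᵥ
          (M.HMat ℓ j σ y *ᵥ ((M.AMat ℓ σ)⁻¹ *ᵥ M.aVec ℓ σ y)) := by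
      rw [Matrix.dotProduct_mulVec, Matrix.vecMul_vecMul]
      rfl
    rw [e0]
    simp only [Matrix.mulVec, Matrix.vecMul, dotProduct]
    refine Finset.sum_congr rfl fun k _ => ?_
    rw [Finset.sum_mul]
    refine Finset.sum_congr rfl fun l _ => ?_
    simp only [Finset.mul_sum]
    exact Finset.sum_congr rfl fun m _ => Finset.sum_congr rfl fun n _ => by ring
  have hint : ∀ j, ∫ y, (M.CMat ℓ σ y *ᵥ ((M.AMat ℓ σ)⁻¹ *ᵥ M.aVec ℓ σ y)) j ∂(M.law σ) =
      ∑ k, ∑ l, ∑ m, ∑ n, (M.AMat ℓ σ)⁻¹ l k * (M.AMat ℓ σ)⁻¹ m n *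
        (M.U3 ℓ d σ j k l m n * (d k * d m * d l * d n)) := by
    intro j
    simp only [e]
    rw [integral_finsetSum _ fun k _ => integrable_finsetSum _ fun l _ =>
      integrable_finsetSum _ fun m _ => integrable_finsetSum _ fun n _ =>
        (hHaa j k m l n).const_mul _]
    refine Finset.sum_congr rfl fun k _ => ?_
    rw [integral_finsetSum _ fun l _ =>
      integrable_finsetSum _ fun m _ => integrable_finsetSum _ fun n _ =>
        (hHaa j k m l n).const_mul _]
    refine Finset.sum_congr rfl fun l _ => ?_
    rw [integral_finsetSum _ fun m _ => integrable_finsetSum _ fun n _ =>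
        (hHaa j k m l n).const_mul _]
    refine Finset.sum_congr rfl fun m _ => ?_
    rw [integral_finsetSum _ fun n _ => (hHaa j k m l n).const_mul _]
    refine Finset.sum_congr rfl fun n _ => ?_
    rw [integral_const_mul, hU]
  simp only [MixedModel.Delta3, hint, corr3]
  congr 1
  simp only [dotProduct, Matrix.mulVec, Finset.mul_sum]
  refine Finset.sum_congr rfl fun i _ => Finset.sum_congr rfl fun j _ =>
      Finset.sum_congr rfl fun k _ => Finset.sum_congr rfl fun l _ =>
      Finset.sum_congr rfl fun m _ => Finset.sum_congr rfl fun n _ => ?_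
  rw [AMat_inv_apply hd, AMat_inv_apply hd, AMat_inv_apply hd]
  have hi := hd i
  have hj := hd j
  have hk := hd k
  have hl := hd l
  have hm := hd m
  have hn := hd n
  field_simp

/-- The leading term is an unbiased estimator of the total correction. -/
lemma integral_leadTerm (hd : ∀ i, 0 < d i)
    (ha : ∀ i, Integrable (fun y => M.aVec ℓ σ y i) (M.law σ))
    (haa : ∀ i j, Integrable (fun y => M.aVec ℓ σ y i * M.aVec ℓ σ y j) (M.law σ))
    (hFa : ∀ i j k, Integrable (fun y => M.FMat ℓ σ y i j * M.aVec ℓ σ y k) (M.law σ))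
    (hHaa : ∀ i j k l m, Integrable (fun y => M.HMat ℓ i σ y j k * M.aVec ℓ σ y l *
      M.aVec ℓ σ y m) (M.law σ))
    (hE : ∀ i, ∫ y, M.aVec ℓ σ y i ∂(M.law σ) = 0) :
    Integrable (fun y => leadTerm d (M.bVec ℓ σ) (M.BMat ℓ σ) (M.QMat ℓ d σ)⁻¹ (M.lam1 ℓ d σ y)
      (M.lam2 ℓ d σ y) (M.lam3 ℓ d σ y)) (M.law σ) ∧
    ∫ y, leadTerm d (M.bVec ℓ σ) (M.BMat ℓ σ) (M.QMat ℓ d σ)⁻¹ (M.lam1 ℓ d σ y)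
      (M.lam2 ℓ d σ y) (M.lam3 ℓ d σ y) ∂(M.law σ)
      = M.Delta1 ℓ σ + M.Delta2 ℓ σ + M.Delta3 ℓ σ := by
  have i1 : ∀ i, Integrable (fun y => M.lam1 ℓ d σ y i) (M.law σ) := fun i => (ha i).div_const _
  have i11 : ∀ i l, Integrable (fun y => M.lam1 ℓ d σ y i * M.lam1 ℓ d σ y l) (M.law σ) := by
    intro i l
    refine ((haa i l).div_const (d i * d l)).congr (Eventually.of_forall fun y => ?_)
    simp only [MixedModel.lam1]
    rw [div_mul_div_comm]
  have i21 : ∀ j k l, Integrable (fun y => M.lam2 ℓ d σ y j k * M.lam1 ℓ d σ y l) (M.law σ) := by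
    intro j k l
    refine (((hFa j k l).sub ((ha l).const_mul (M.AMat ℓ σ j k))).div_const
      (Real.sqrt (d j * d k) * d l)).congr (Eventually.of_forall fun y => ?_)
    simp only [MixedModel.lam1, MixedModel.lam2, Pi.sub_apply]
    rw [div_mul_div_comm, sub_mul]
  have i311 : ∀ j k l m n, Integrable (fun y => M.lam3 ℓ d σ y j k m * M.lam1 ℓ d σ y l *
      M.lam1 ℓ d σ y n) (M.law σ) := by
    intro j k l m n
    refine ((hHaa j k m l n).div_const (d k * d m * d l * d n)).congr
      (Eventually.of_forall fun y => ?_)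
    simp only [MixedModel.lam1, MixedModel.lam3]
    rw [div_mul_div_comm, div_mul_div_comm]
  set b := M.bVec ℓ σ
  set B := M.BMat ℓ σ
  set P := (M.QMat ℓ d σ)⁻¹
  have t0 : Integrable (fun y => ∑ i, ∑ j, b i / d i * P i j * M.lam1 ℓ d σ y j) (M.law σ) :=
    integrable_finsetSum _ fun i _ => integrable_finsetSum _ fun j _ => (i1 j).const_mul _
  -- The linear term is of order 1/d_* and would dominate all the others. It disappears only because
  -- E(a) = 0, so no further correction is needed.
  have v0 : ∫ y, ∑ i, ∑ j, b i / d i * P i j * M.lam1 ℓ d σ y j ∂(M.law σ) = 0 := by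
    rw [integral_finsetSum _ fun i _ => integrable_finsetSum _ fun j _ => (i1 j).const_mul _]
    refine Finset.sum_eq_zero fun i _ => ?_
    rw [integral_finsetSum _ fun j _ => (i1 j).const_mul _]
    refine Finset.sum_eq_zero fun j _ => ?_
    simp only [MixedModel.lam1]
    rw [integral_const_mul, integral_div, hE]
    simp
  have w1 : ∀ i j k l, Integrable (fun y => b i / d i * P i j * (M.lam2 ℓ d σ y j k *
      M.lam1 ℓ d σ y l / Real.sqrt (d j * d k)) * P k l) (M.law σ) := fun i j k l =>
    (((i21 j k l).div_const _).const_mul _).mul_const _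
  have t1 : Integrable (fun y => corr1 d b P
      (fun j k l => M.lam2 ℓ d σ y j k * M.lam1 ℓ d σ y l)) (M.law σ) :=
    integrable_finsetSum _ fun i _ => integrable_finsetSum _ fun j _ =>
      integrable_finsetSum _ fun k _ => integrable_finsetSum _ fun l _ => w1 i j k l
  have v1 : ∫ y, corr1 d b P (fun j k l => M.lam2 ℓ d σ y j k * M.lam1 ℓ d σ y l) ∂(M.law σ)
      = corr1 d b P (M.U2 ℓ d σ) := by
    unfold corr1
    rw [integral_finsetSum _ fun i _ => integrable_finsetSum _ fun j _ =>
      integrable_finsetSum _ fun k _ => integrable_finsetSum _ fun l _ => w1 i j k l]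
    refine Finset.sum_congr rfl fun i _ => ?_
    rw [integral_finsetSum _ fun j _ =>
      integrable_finsetSum _ fun k _ => integrable_finsetSum _ fun l _ => w1 i j k l]
    refine Finset.sum_congr rfl fun j _ => ?_
    rw [integral_finsetSum _ fun k _ => integrable_finsetSum _ fun l _ => w1 i j k l]
    refine Finset.sum_congr rfl fun k _ => ?_
    rw [integral_finsetSum _ fun l _ => w1 i j k l]
    refine Finset.sum_congr rfl fun l _ => ?_
    rw [integral_mul_const, integral_const_mul, integral_div]
    rfl
  have w2 : ∀ i j k l, Integrable (fun y => P i j * (B j k / (d j * d k)) * P k l *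
      (M.lam1 ℓ d σ y i * M.lam1 ℓ d σ y l)) (M.law σ) := fun i j k l => (i11 i l).const_mul _
  have t2 : Integrable (fun y => corr2 d B P
      (fun i l => M.lam1 ℓ d σ y i * M.lam1 ℓ d σ y l)) (M.law σ) :=
    (integrable_finsetSum _ fun i _ => integrable_finsetSum _ fun j _ =>
      integrable_finsetSum _ fun k _ => integrable_finsetSum _ fun l _ => w2 i j k l).const_mul _
  have v2 : ∫ y, corr2 d B P (fun i l => M.lam1 ℓ d σ y i * M.lam1 ℓ d σ y l) ∂(M.law σ)
      = corr2 d B P (M.U1 ℓ d σ) := by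
    unfold corr2
    rw [integral_const_mul, integral_finsetSum _ fun i _ => integrable_finsetSum _ fun j _ =>
      integrable_finsetSum _ fun k _ => integrable_finsetSum _ fun l _ => w2 i j k l]
    congr 1
    refine Finset.sum_congr rfl fun i _ => ?_
    rw [integral_finsetSum _ fun j _ =>
      integrable_finsetSum _ fun k _ => integrable_finsetSum _ fun l _ => w2 i j k l]
    refine Finset.sum_congr rfl fun j _ => ?_
    rw [integral_finsetSum _ fun k _ => integrable_finsetSum _ fun l _ => w2 i j k l]
    refine Finset.sum_congr rfl fun k _ => ?_
    rw [integral_finsetSum _ fun l _ => w2 i j k l]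
    refine Finset.sum_congr rfl fun l _ => ?_
    rw [integral_const_mul]
    rfl
  have w3 : ∀ i j k l m n, Integrable (fun y => b i / d i * (P i j / d j) * P l k * P m n *
      (M.lam3 ℓ d σ y j k m * M.lam1 ℓ d σ y l * M.lam1 ℓ d σ y n)) (M.law σ) :=
    fun i j k l m n => (i311 j k l m n).const_mul _
  have t3 : Integrable (fun y => corr3 d b P
      (fun j k l m n => M.lam3 ℓ d σ y j k m * M.lam1 ℓ d σ y l * M.lam1 ℓ d σ y n)) (M.law σ) :=
    (integrable_finsetSum _ fun i _ => integrable_finsetSum _ fun j _ =>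
      integrable_finsetSum _ fun k _ => integrable_finsetSum _ fun l _ =>
      integrable_finsetSum _ fun m _ => integrable_finsetSum _ fun n _ =>
        w3 i j k l m n).const_mul _
  have v3 : ∫ y, corr3 d b P (fun j k l m n => M.lam3 ℓ d σ y j k m * M.lam1 ℓ d σ y l *
      M.lam1 ℓ d σ y n) ∂(M.law σ) = corr3 d b P (M.U3 ℓ d σ) := by
    unfold corr3
    rw [integral_const_mul, integral_finsetSum _ fun i _ => integrable_finsetSum _ fun j _ =>
      integrable_finsetSum _ fun k _ => integrable_finsetSum _ fun l _ =>
      integrable_finsetSum _ fun m _ => integrable_finsetSum _ fun n _ => w3 i j k l m n]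
    congr 1
    refine Finset.sum_congr rfl fun i _ => ?_
    rw [integral_finsetSum _ fun j _ =>
      integrable_finsetSum _ fun k _ => integrable_finsetSum _ fun l _ =>
      integrable_finsetSum _ fun m _ => integrable_finsetSum _ fun n _ => w3 i j k l m n]
    refine Finset.sum_congr rfl fun j _ => ?_
    rw [integral_finsetSum _ fun k _ => integrable_finsetSum _ fun l _ =>
      integrable_finsetSum _ fun m _ => integrable_finsetSum _ fun n _ => w3 i j k l m n]
    refine Finset.sum_congr rfl fun k _ => ?_
    rw [integral_finsetSum _ fun l _ =>
      integrable_finsetSum _ fun m _ => integrable_finsetSum _ fun n _ => w3 i j k l m n]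
    refine Finset.sum_congr rfl fun l _ => ?_
    rw [integral_finsetSum _ fun m _ => integrable_finsetSum _ fun n _ => w3 i j k l m n]
    refine Finset.sum_congr rfl fun m _ => ?_
    rw [integral_finsetSum _ fun n _ => w3 i j k l m n]
    refine Finset.sum_congr rfl fun n _ => ?_
    rw [integral_const_mul]
    rfl
  have hsum : ∀ {f₀ f₁ f₂ f₃ : (Fin M.N → ℝ) → ℝ}, Integrable f₀ (M.law σ) →
      Integrable f₁ (M.law σ) → Integrable f₂ (M.law σ) → Integrable f₃ (M.law σ) →
      ∫ y, (-f₀ y + f₁ y + f₂ y + f₃ y) ∂(M.law σ) = -(∫ y, f₀ y ∂(M.law σ)) +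
        ∫ y, f₁ y ∂(M.law σ) + ∫ y, f₂ y ∂(M.law σ) + ∫ y, f₃ y ∂(M.law σ) := by
    intro f₀ f₁ f₂ f₃ h₀ h₁ h₂ h₃
    have q₀ : Integrable (fun y => -f₀ y) (M.law σ) := h₀.neg
    have q₁ : Integrable (fun y => -f₀ y + f₁ y) (M.law σ) := q₀.add h₁
    have q₂ : Integrable (fun y => -f₀ y + f₁ y + f₂ y) (M.law σ) := q₁.add h₂
    rw [integral_add q₂ h₃, integral_add q₁ h₂, integral_add q₀ h₁, integral_neg]
  unfold leadTerm
  refine ⟨((t0.neg.add t1).add t2).add t3, ?_⟩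
  rw [hsum t0 t1 t2 t3, v0, v1, v2, v3, Delta1_eq_corr1 hd ha hFa hE,
    Delta2_eq_corr2 hd haa, Delta3_eq_corr3 hd hHaa]
  ring

/-- A crude bound for the leading term. -/
lemma abs_leadTerm_le [Nonempty (Fin s)] (hd : ∀ i, 0 < d i) (hD : 1 ≤ dStar d)
    {b : Fin s → ℝ} {B P : Matrix (Fin s) (Fin s) ℝ} {lam₁ : Fin s → ℝ}
    {lam₂ : Fin s → Fin s → ℝ} {lam₃ : Fin s → Fin s → Fin s → ℝ} {K W : ℝ} (hK : 1 ≤ K)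
    (hW : 1 ≤ W) (hb : ∀ i, |b i| ≤ K) (hB : ∀ i j, |B i j| ≤ K) (hP : ∀ i j, |P i j| ≤ K)
    (h₁ : ∀ i, |lam₁ i| ≤ W) (h₂ : ∀ i j, |lam₂ i j| ≤ W) (h₃ : ∀ i j k, |lam₃ i j k| ≤ W) :
    |leadTerm d b B P lam₁ lam₂ lam₃| ≤ (s ^ 2 * K ^ 2 + 16 * s ^ 4 * K ^ 3 + 16 * s ^ 6 * K ^ 4)
      * W ^ 3 / dStar d := by
  have hD0 : 0 < dStar d := by linarith
  have hW0 : 0 ≤ W := by linarith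
  have hK0 : 0 ≤ K := by linarith
  -- With equal arguments and ε = 0 the closeness lemmas reduce to plain bounds.
  have cl : ∀ {x L : ℝ}, |x| ≤ L → Close L 0 x x := fun h => ⟨h, h, by simp⟩
  have a0 : |∑ i, ∑ j, b i / d i * P i j * lam₁ j| ≤ s ^ 2 * K ^ 2 * (W ^ 3 / dStar d) := by
    have : ∀ i j, |b i / d i * P i j * lam₁ j| ≤ K ^ 2 * (W ^ 3 / dStar d) := by
      intro i j
      rw [abs_mul, abs_mul, abs_div, abs_of_pos (hd i)]
      have e1 : |b i| / d i ≤ K / dStar d := div_le_div₀ hK0 (hb i) hD0 (dStar_le d i)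
      have e3 : W ≤ W ^ 3 := le_self_pow₀ hW (by norm_num)
      calc |b i| / d i * |P i j| * |lam₁ j| ≤ K / dStar d * K * W ^ 3 := by
            gcongr
            · exact hP i j
            · exact (h₁ j).trans e3
        _ = _ := by ring
    refine (Finset.abs_sum_le_sum_abs _ _).trans ((Finset.sum_le_sum fun i _ =>
      (Finset.abs_sum_le_sum_abs _ _).trans (Finset.sum_le_sum fun j _ => this i j)).trans
      (le_of_eq ?_))
    simp
    ring
  have hWW : ∀ {x y : ℝ}, |x| ≤ W → |y| ≤ W → |x * y| ≤ W ^ 2 := fun hx hy => by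
    rw [abs_mul, sq]; exact mul_le_mul hx hy (abs_nonneg _) hW0
  have hWWW : ∀ {x y z : ℝ}, |x| ≤ W → |y| ≤ W → |z| ≤ W → |x * y * z| ≤ W ^ 3 :=
    fun hx hy hz => by
      rw [abs_mul, pow_succ]; exact mul_le_mul (hWW hx hy) hz (abs_nonneg _) (by positivity)
  have a1 := (close_corr1 (ε := 0) hd (fun i => cl (hb i)) (fun i j => cl (hP i j))
    (U := fun j k l => lam₂ j k * lam₁ l) (fun j k l => cl (hWW (h₂ j k) (h₁ l)))).1
  have a2 := (close_corr2 (ε := 0) hd (fun i j => cl (hB i j)) (fun i j => cl (hP i j))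
    (U := fun i l => lam₁ i * lam₁ l) (fun i l => cl (hWW (h₁ i) (h₁ l)))).1
  have a3 := (close_corr3 (ε := 0) hd (fun i => cl (hb i)) (fun i j => cl (hP i j))
    (U := fun j k l m n => lam₃ j k m * lam₁ l * lam₁ n)
    (fun j k l m n => cl (hWWW (h₃ j k m) (h₁ l) (h₁ n)))).1
  -- The corrections are of order d_*⁻², but the linear term is only of order d_*⁻¹, so everything
  -- is stated at that weaker rate.
  have conv : ∀ {x C : ℝ}, 0 ≤ C → |x * dStar d ^ 2| ≤ C → |x| ≤ C / dStar d := by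
    intro x C hC h
    rw [abs_mul, abs_of_pos (by positivity : 0 < dStar d ^ 2)] at h
    rw [le_div_iff₀ hD0]
    have : |x| * dStar d ≤ |x| * dStar d ^ 2 := by
      gcongr
      exact le_self_pow₀ hD (by norm_num)
    linarith
  have hW23 : W ^ 2 ≤ W ^ 3 := pow_le_pow_right₀ hW (by norm_num)
  have b1 := conv (C := 8 * s ^ 4 * K ^ 3 * W ^ 3) (by positivity) (a1.trans (by
    calc _ = 8 * s ^ 4 * K ^ 3 * W ^ 2 := by ring
      _ ≤ _ := by gcongr))
  have b2 := conv (C := 8 * s ^ 4 * K ^ 3 * W ^ 3) (by positivity) (a2.trans (by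
    calc _ = 8 * s ^ 4 * K ^ 3 * W ^ 2 := by ring
      _ ≤ _ := by gcongr))
  have b3 := conv (C := 16 * s ^ 6 * K ^ 4 * W ^ 3) (by positivity) (a3.trans (le_of_eq (by ring)))
  unfold leadTerm
  refine (abs_add_le _ _).trans ?_
  refine (add_le_add ((abs_add_le _ _).trans (add_le_add ((abs_add_le _ _).trans
    (add_le_add ((abs_neg _).trans_le a0) b1)) b2)) b3).trans (le_of_eq ?_)
  ring

end Deltas

/-! ### One random bound for all standardized derivatives. -/

section Envelope

variable {s : ℕ}

/-- An envelope of the standardized derivatives of the criterion function. -/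
def envelope (M : MixedModel s) (ℓ : Par s → (Fin M.N → ℝ) → ℝ) (d : Fin s → ℝ) (δ : ℝ)
    (σ : Par s) (y : Fin M.N → ℝ) : ℝ :=
  1 + ∑ i, |M.lam1 ℓ d σ y i| + ∑ i, ∑ j, |M.lam2 ℓ d σ y i j|
    + ∑ i, ∑ j, ∑ k, |M.lam3 ℓ d σ y i j k|
    + ∑ i, ∑ j, ∑ k, ∑ l, (ENNReal.ofReal (dStar d ^ 2 / (d i * d j * d k * d l)) *
      ⨆ τ ∈ SBox d δ σ, ENNReal.ofReal |pd i (pd j (pd k (pd l (fun σ => ℓ σ y)))) τ|).toReal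

variable {M : MixedModel s} {ℓ : Par s → (Fin M.N → ℝ) → ℝ} {d : Fin s → ℝ} {δ : ℝ} {σ : Par s}
  {y : Fin M.N → ℝ}

lemma envelope_nonneg_parts :
    0 ≤ ∑ i, |M.lam1 ℓ d σ y i| ∧ 0 ≤ ∑ i, ∑ j, |M.lam2 ℓ d σ y i j| ∧
    0 ≤ ∑ i, ∑ j, ∑ k, |M.lam3 ℓ d σ y i j k| ∧
    0 ≤ ∑ i, ∑ j, ∑ k, ∑ l, (ENNReal.ofReal (dStar d ^ 2 / (d i * d j * d k * d l)) *
      ⨆ τ ∈ SBox d δ σ, ENNReal.ofReal |pd i (pd j (pd k (pd l (fun σ => ℓ σ y)))) τ|).toReal :=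
  ⟨Finset.sum_nonneg fun _ _ => abs_nonneg _,
    Finset.sum_nonneg fun _ _ => Finset.sum_nonneg fun _ _ => abs_nonneg _,
    Finset.sum_nonneg fun _ _ => Finset.sum_nonneg fun _ _ => Finset.sum_nonneg fun _ _ =>
      abs_nonneg _,
    Finset.sum_nonneg fun _ _ => Finset.sum_nonneg fun _ _ => Finset.sum_nonneg fun _ _ =>
      Finset.sum_nonneg fun _ _ => ENNReal.toReal_nonneg⟩

/-- The summand 1 makes the powers of the envelope increasing, so every lower power is dominated by
the sixth. -/
lemma one_le_envelope : 1 ≤ envelope M ℓ d δ σ y := by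
  obtain ⟨h1, h2, h3, h4⟩ := envelope_nonneg_parts (M := M) (ℓ := ℓ) (d := d) (δ := δ) (σ := σ) (y := y)
  unfold envelope
  linarith

lemma abs_lam1_le_envelope (i : Fin s) : |M.lam1 ℓ d σ y i| ≤ envelope M ℓ d δ σ y := by
  obtain ⟨h1, h2, h3, h4⟩ := envelope_nonneg_parts (M := M) (ℓ := ℓ) (d := d) (δ := δ) (σ := σ) (y := y)
  have := Finset.single_le_sum (f := fun i => |M.lam1 ℓ d σ y i|) (fun _ _ => abs_nonneg _)
    (Finset.mem_univ i)
  unfold envelope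
  linarith

lemma abs_lam2_le_envelope (i j : Fin s) : |M.lam2 ℓ d σ y i j| ≤ envelope M ℓ d δ σ y := by
  obtain ⟨h1, h2, h3, h4⟩ := envelope_nonneg_parts (M := M) (ℓ := ℓ) (d := d) (δ := δ) (σ := σ) (y := y)
  have e1 := Finset.single_le_sum (f := fun j => |M.lam2 ℓ d σ y i j|) (fun _ _ => abs_nonneg _)
    (Finset.mem_univ j)
  have e2 := Finset.single_le_sum (f := fun i => ∑ j, |M.lam2 ℓ d σ y i j|)
    (fun _ _ => Finset.sum_nonneg fun _ _ => abs_nonneg _) (Finset.mem_univ i)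
  unfold envelope
  linarith

lemma abs_lam3_le_envelope (i j k : Fin s) :
    |M.lam3 ℓ d σ y i j k| ≤ envelope M ℓ d δ σ y := by
  obtain ⟨h1, h2, h3, h4⟩ := envelope_nonneg_parts (M := M) (ℓ := ℓ) (d := d) (δ := δ) (σ := σ) (y := y)
  have e0 := Finset.single_le_sum (f := fun k => |M.lam3 ℓ d σ y i j k|) (fun _ _ => abs_nonneg _)
    (Finset.mem_univ k)
  have e1 := Finset.single_le_sum (f := fun j => ∑ k, |M.lam3 ℓ d σ y i j k|)
    (fun _ _ => Finset.sum_nonneg fun _ _ => abs_nonneg _) (Finset.mem_univ j)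
  have e2 := Finset.single_le_sum (f := fun i => ∑ j, ∑ k, |M.lam3 ℓ d σ y i j k|)
    (fun _ _ => Finset.sum_nonneg fun _ _ => Finset.sum_nonneg fun _ _ => abs_nonneg _)
    (Finset.mem_univ i)
  unfold envelope
  linarith

lemma measurable_envelope (hm : ∀ σ ∈ interior M.Θ, Measurable (ℓ σ))
    (hs : ∀ y, ContDiffOn ℝ 4 (fun σ => ℓ σ y) (interior M.Θ))
    (hS : SBox d δ σ ⊆ interior M.Θ) (hσ : σ ∈ interior M.Θ) :
    Measurable (envelope M ℓ d δ σ) := by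
  have hs3 : ∀ y, ContDiffOn ℝ 3 (fun σ => ℓ σ y) (interior M.Θ) := fun y =>
    (hs y).of_le (by norm_num)
  unfold envelope
  refine (((measurable_const.add ?_).add ?_).add ?_).add ?_
  · exact Finset.measurable_sum _ fun i _ => ((measurable_aVec hm hs3 hσ i).div_const _).abs
  · exact Finset.measurable_sum _ fun i _ => Finset.measurable_sum _ fun j _ =>
      (((measurable_FMat hm hs3 hσ i j).sub_const _).div_const _).abs
  · exact Finset.measurable_sum _ fun i _ => Finset.measurable_sum _ fun j _ =>
      Finset.measurable_sum _ fun k _ => ((measurable_HMat hm hs3 hσ i j k).div_const _).abs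
  · exact Finset.measurable_sum _ fun i _ => Finset.measurable_sum _ fun j _ =>
      Finset.measurable_sum _ fun k _ => Finset.measurable_sum _ fun l _ =>
      ((measurable_iSup_fourth hm hs hS i j k l).const_mul _).ennreal_toReal

end Envelope

/-! ### Moments of the envelope. -/

section Moments

variable {s : ℕ} {M : ℕ → MixedModel s} {σ₀ : Par s} {g : ℝ}

/-- Convexity: (x + y)^g ≤ 2^(g−1)(x^g + y^g) for g ≥ 1. -/
lemma MomentBdd.add {f h : ∀ n, (Fin (M n).N → ℝ) → ℝ≥0∞} (hg : 1 ≤ g) (hf : MomentBdd M σ₀ g f)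
    (hh : MomentBdd M σ₀ g h) (hm : ∀ n, Measurable (f n)) :
    MomentBdd M σ₀ g fun n y => f n y + h n y := by
  obtain ⟨K, hK⟩ := hf
  obtain ⟨L, hL⟩ := hh
  refine ⟨2 ^ (g - 1) * (K + L), fun n => ?_⟩
  calc ∫⁻ y, (f n y + h n y) ^ g ∂((M n).law σ₀)
      ≤ ∫⁻ y, 2 ^ (g - 1) * (f n y ^ g + h n y ^ g) ∂((M n).law σ₀) :=
        lintegral_mono fun y => ENNReal.rpow_add_le_mul_rpow_add_rpow _ _ hg
    _ = 2 ^ (g - 1) * (∫⁻ y, f n y ^ g ∂((M n).law σ₀) + ∫⁻ y, h n y ^ g ∂((M n).law σ₀)) := by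
        rw [lintegral_const_mul' _ _ (ENNReal.rpow_ne_top_of_nonneg (by linarith) (by simp)),
          lintegral_add_left ((hm n).pow_const g)]
    _ ≤ 2 ^ (g - 1) * (K + L) := by gcongr; exacts [hK n, hL n]
    _ = _ := by
        push_cast
        rw [ENNReal.coe_rpow_of_nonneg _ (by linarith)]
        simp

lemma MomentBdd.sum {f : Fin s → ∀ n, (Fin (M n).N → ℝ) → ℝ≥0∞} (hg : 1 ≤ g)
    (hf : ∀ i, MomentBdd M σ₀ g (f i)) (hm : ∀ i n, Measurable (f i n)) :
    MomentBdd M σ₀ g fun n y => ∑ i, f i n y := by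
  suffices h : ∀ t : Finset (Fin s), MomentBdd M σ₀ g fun n y => ∑ i ∈ t, f i n y from h _
  intro t
  induction t using Finset.induction_on with
  | empty =>
    refine ⟨0, fun n => ?_⟩
    simp [ENNReal.zero_rpow_of_pos (by linarith : 0 < g)]
  | insert i t hi ih =>
    simp only [Finset.sum_insert hi]
    exact (hf i).add hg ih (hm i)

variable {ℓ : ∀ n, Par s → (Fin (M n).N → ℝ) → ℝ} {d : ℕ → Fin s → ℝ} {δ lam : ℝ}

/-- The error bounds are cubic in the envelope, and splitting off a small event squares the cube,
whence the sixth moment. It is available because g > 8 + 4λ. The second claim recovers the fourth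
derivatives on the box from their supremum. -/
lemma MSEConditions.envelope_moment (h : MSEConditions M ℓ d σ₀ g δ lam) (hlam : 0 < lam) {δ' : ℝ}
    (hδ : δ' ≤ δ) (hsub : ∀ n, SBox (d n) δ' σ₀ ⊆ interior (M n).Θ) :
    (∃ K : ℝ, 0 ≤ K ∧ ∀ n, Integrable (fun y => envelope (M n) (ℓ n) (d n) δ' σ₀ y ^ 6) ((M n).law σ₀) ∧
      ∫ y, envelope (M n) (ℓ n) (d n) δ' σ₀ y ^ 6 ∂((M n).law σ₀) ≤ K) ∧
    ∀ n, ∀ᵐ y ∂((M n).law σ₀), ∀ i j k l, ∀ τ ∈ SBox (d n) δ' σ₀,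
      |pd i (pd j (pd k (pd l (fun σ => ℓ n σ y)))) τ| ≤
        (ENNReal.ofReal (dStar (d n) ^ 2 / (d n i * d n j * d n k * d n l)) *
          ⨆ τ ∈ SBox (d n) δ' σ₀, ENNReal.ofReal
            |pd i (pd j (pd k (pd l (fun σ => ℓ n σ y)))) τ|).toReal *
          (d n i * d n j * d n k * d n l / dStar (d n) ^ 2) := by
  have hsc := h.score
  have hne : Nonempty (Fin s) := nonempty_of_dStar_tendsto hsc.dStar_tendsto
  have hg6 : 6 ≤ g := by linarith [h.g_gt]
  have hg1 : 1 ≤ g := by linarith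
  have hg0 : 0 < g := by linarith
  have hσ : ∀ n, σ₀ ∈ interior (M n).Θ := hsc.mem_interior'
  have hm4 : ∀ i j k l n, Measurable fun y =>
      ENNReal.ofReal (dStar (d n) ^ 2 / (d n i * d n j * d n k * d n l)) *
        ⨆ τ ∈ SBox (d n) δ' σ₀, ENNReal.ofReal |pd i (pd j (pd k (pd l (fun σ => ℓ n σ y)))) τ| :=
    fun i j k l n => (measurable_iSup_fourth (hsc.measurable_crit n) (h.smooth4 n) (hsub n)
      i j k l).const_mul _
  have hmom4 : ∀ i j k l, MomentBdd M σ₀ g fun n y =>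
      ENNReal.ofReal (dStar (d n) ^ 2 / (d n i * d n j * d n k * d n l)) *
        ⨆ τ ∈ SBox (d n) δ' σ₀, ENNReal.ofReal |pd i (pd j (pd k (pd l (fun σ => ℓ n σ y)))) τ| :=
    fun i j k l => (h.moment_fourth i j k l).mono hg0.le fun n y =>
      mul_le_mul_right (biSup_mono fun τ hτ => SBox_mono (hsc.d_pos n) hδ σ₀ hτ) _
  have hm1 : ∀ i n, Measurable fun y => ENNReal.ofReal |(M n).lam1 (ℓ n) (d n) σ₀ y i| :=
    fun i n => ENNReal.measurable_ofReal.comp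
      ((measurable_aVec (hsc.measurable_crit n) (hsc.smooth n) (hσ n) i).div_const _).abs
  have hm2 : ∀ i j n, Measurable fun y => ENNReal.ofReal |(M n).lam2 (ℓ n) (d n) σ₀ y i j| :=
    fun i j n => ENNReal.measurable_ofReal.comp
      (((measurable_FMat (hsc.measurable_crit n) (hsc.smooth n) (hσ n) i j).sub_const _).div_const
        _).abs
  have hm3 : ∀ i j k n, Measurable fun y => ENNReal.ofReal |(M n).lam3 (ℓ n) (d n) σ₀ y i j k| :=
    fun i j k n => ENNReal.measurable_ofReal.comp
      ((measurable_HMat (hsc.measurable_crit n) (hsc.smooth n) (hσ n) i j k).div_const _).abs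
  have mom1 : ∀ i, MomentBdd M σ₀ g fun n y => ENNReal.ofReal |(M n).lam1 (ℓ n) (d n) σ₀ y i| :=
    fun i => (hsc.moment1 i).mono hg0.le fun n y => by
      refine ENNReal.ofReal_le_ofReal (le_of_eq ?_)
      rw [MixedModel.lam1, abs_div, abs_of_pos (hsc.d_pos n i)]; ring
  have mom2 : ∀ i j, MomentBdd M σ₀ g fun n y =>
      ENNReal.ofReal |(M n).lam2 (ℓ n) (d n) σ₀ y i j| :=
    fun i j => (hsc.moment2 i j).mono hg0.le fun n y => by
      refine ENNReal.ofReal_le_ofReal (le_of_eq ?_)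
      rw [MixedModel.lam2, abs_div, abs_of_nonneg (Real.sqrt_nonneg _), div_eq_mul_inv, mul_comm,
        one_div]
      rfl
  have mom3 : ∀ i j k, MomentBdd M σ₀ g fun n y =>
      ENNReal.ofReal |(M n).lam3 (ℓ n) (d n) σ₀ y i j k| :=
    fun i j k => (h.moment_third i j k).mono hg0.le fun n y => by
      refine ENNReal.ofReal_le_ofReal (le_of_eq ?_)
      rw [MixedModel.lam3, abs_div, abs_of_pos (mul_pos (hsc.d_pos n j) (hsc.d_pos n k))]; ring
  have momW : MomentBdd M σ₀ g fun n y => ENNReal.ofReal (envelope (M n) (ℓ n) (d n) δ' σ₀ y) := by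
    have m1 : ∀ n, Measurable fun y => ∑ i, ENNReal.ofReal |(M n).lam1 (ℓ n) (d n) σ₀ y i| :=
      fun n => Finset.measurable_sum _ fun i _ => hm1 i n
    have m2 : ∀ n, Measurable fun y => ∑ i, ∑ j, ENNReal.ofReal |(M n).lam2 (ℓ n) (d n) σ₀ y i j| :=
      fun n => Finset.measurable_sum _ fun i _ => Finset.measurable_sum _ fun j _ => hm2 i j n
    have m3 : ∀ n, Measurable fun y => ∑ i, ∑ j, ∑ k,
        ENNReal.ofReal |(M n).lam3 (ℓ n) (d n) σ₀ y i j k| :=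
      fun n => Finset.measurable_sum _ fun i _ => Finset.measurable_sum _ fun j _ =>
        Finset.measurable_sum _ fun k _ => hm3 i j k n
    have s0 : MomentBdd M σ₀ g fun n y => (1 : ℝ≥0∞) := ⟨1, fun n => by simp⟩
    have s1 := MomentBdd.sum hg1 mom1 hm1
    have s2 := MomentBdd.sum hg1 (fun i => MomentBdd.sum hg1 (mom2 i) (hm2 i))
      (fun i n => Finset.measurable_sum _ fun j _ => hm2 i j n)
    have s3 := MomentBdd.sum hg1 (fun i => MomentBdd.sum hg1
      (fun j => MomentBdd.sum hg1 (mom3 i j) (hm3 i j))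
      (fun j n => Finset.measurable_sum _ fun k _ => hm3 i j k n))
      (fun i n => Finset.measurable_sum _ fun j _ => Finset.measurable_sum _ fun k _ => hm3 i j k n)
    have s4 := MomentBdd.sum hg1 (fun i => MomentBdd.sum hg1
      (fun j => MomentBdd.sum hg1 (fun k => MomentBdd.sum hg1 (hmom4 i j k) (hm4 i j k))
      (fun k n => Finset.measurable_sum _ fun l _ => hm4 i j k l n))
      (fun j n => Finset.measurable_sum _ fun k _ => Finset.measurable_sum _ fun l _ =>
        hm4 i j k l n))
      (fun i n => Finset.measurable_sum _ fun j _ => Finset.measurable_sum _ fun k _ =>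
        Finset.measurable_sum _ fun l _ => hm4 i j k l n)
    have stot := (((s0.add hg1 s1 (fun n => measurable_const)).add hg1 s2
      (fun n => measurable_const.add (m1 n))).add hg1 s3
      (fun n => (measurable_const.add (m1 n)).add (m2 n))).add hg1 s4
      (fun n => ((measurable_const.add (m1 n)).add (m2 n)).add (m3 n))
    refine stot.mono hg0.le fun n y => ?_
    have osum : ∀ (f : Fin s → ℝ) (F : Fin s → ℝ≥0∞), (∀ i, 0 ≤ f i) →
        (∀ i, ENNReal.ofReal (f i) ≤ F i) → ENNReal.ofReal (∑ i, f i) ≤ ∑ i, F i := by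
      intro f F hf hF
      rw [ENNReal.ofReal_sum_of_nonneg fun i _ => hf i]
      exact Finset.sum_le_sum fun i _ => hF i
    unfold envelope
    refine ENNReal.ofReal_add_le.trans (add_le_add (ENNReal.ofReal_add_le.trans (add_le_add
      (ENNReal.ofReal_add_le.trans (add_le_add (ENNReal.ofReal_add_le.trans (add_le_add ?_ ?_)) ?_))
      ?_)) ?_)
    · simp
    · exact osum _ _ (fun _ => abs_nonneg _) fun _ => le_rfl
    · exact osum _ _ (fun _ => Finset.sum_nonneg fun _ _ => abs_nonneg _) fun _ =>
        osum _ _ (fun _ => abs_nonneg _) fun _ => le_rfl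
    · exact osum _ _ (fun _ => Finset.sum_nonneg fun _ _ => Finset.sum_nonneg fun _ _ =>
        abs_nonneg _) fun _ => osum _ _ (fun _ => Finset.sum_nonneg fun _ _ => abs_nonneg _)
          fun _ => osum _ _ (fun _ => abs_nonneg _) fun _ => le_rfl
    · exact osum _ _ (fun _ => Finset.sum_nonneg fun _ _ => Finset.sum_nonneg fun _ _ =>
        Finset.sum_nonneg fun _ _ => ENNReal.toReal_nonneg) fun _ =>
          osum _ _ (fun _ => Finset.sum_nonneg fun _ _ =>
            Finset.sum_nonneg fun _ _ => ENNReal.toReal_nonneg) fun _ =>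
          osum _ _ (fun _ => Finset.sum_nonneg fun _ _ => ENNReal.toReal_nonneg) fun _ =>
          osum _ _ (fun _ => ENNReal.toReal_nonneg) fun _ => ENNReal.ofReal_toReal_le
  refine ⟨?_, fun n => ?_⟩
  · obtain ⟨K, hK⟩ := momW
    refine ⟨K, K.2, fun n => ?_⟩
    have hmeas := measurable_envelope (δ := δ') (hsc.measurable_crit n) (h.smooth4 n) (hsub n) (hσ n)
    have hlin : ∫⁻ y, ENNReal.ofReal (envelope (M n) (ℓ n) (d n) δ' σ₀ y ^ 6) ∂((M n).law σ₀) ≤ K := by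
      refine (lintegral_mono fun y => ?_).trans (hK n)
      have h1 : (1 : ℝ≥0∞) ≤ ENNReal.ofReal (envelope (M n) (ℓ n) (d n) δ' σ₀ y) := by
        rw [← ENNReal.ofReal_one]; exact ENNReal.ofReal_le_ofReal one_le_envelope
      rw [ENNReal.ofReal_pow (zero_le_one.trans one_le_envelope)]
      calc _ = ENNReal.ofReal (envelope (M n) (ℓ n) (d n) δ' σ₀ y) ^ ((6 : ℕ) : ℝ) := by
            rw [ENNReal.rpow_natCast]
        _ ≤ _ := ENNReal.rpow_le_rpow_of_exponent_le h1 (by exact_mod_cast hg6)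
    have hnn : ∀ y, 0 ≤ envelope (M n) (ℓ n) (d n) δ' σ₀ y ^ 6 := fun y =>
      pow_nonneg (zero_le_one.trans one_le_envelope) 6
    have hint : Integrable (fun y => envelope (M n) (ℓ n) (d n) δ' σ₀ y ^ 6) ((M n).law σ₀) := by
      refine ⟨(hmeas.pow_const 6).aestronglyMeasurable, ?_⟩
      rw [hasFiniteIntegral_iff_ofReal (Eventually.of_forall hnn)]
      exact hlin.trans_lt ENNReal.coe_lt_top
    refine ⟨hint, ?_⟩
    rw [integral_eq_lintegral_of_nonneg_ae (Eventually.of_forall hnn) hint.1]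
    exact ENNReal.toReal_le_of_le_ofReal K.2 (by simpa using hlin)
  · simp only [ae_all_iff]
    intro i j k l
    obtain ⟨K, hK⟩ := hmom4 i j k l
    have hae := ae_lt_top ((hm4 i j k l n).pow_const g) ((hK n).trans_lt ENNReal.coe_lt_top).ne
    filter_upwards [hae] with y hy τ hτ
    -- An infinite supremum would be turned into 0 by `toReal` and the bound would be lost. The
    -- moment condition excludes this almost surely.
    have hfin : ENNReal.ofReal (dStar (d n) ^ 2 / (d n i * d n j * d n k * d n l)) *
        ⨆ τ ∈ SBox (d n) δ' σ₀, ENNReal.ofReal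
          |pd i (pd j (pd k (pd l (fun σ => ℓ n σ y)))) τ| ≠ ⊤ := by
      intro htop
      rw [htop, ENNReal.top_rpow_of_pos hg0] at hy
      exact lt_irrefl _ hy
    have hD := dStar_pos (hsc.d_pos n)
    have h1 := hsc.d_pos n i
    have h2 := hsc.d_pos n j
    have h3 := hsc.d_pos n k
    have h4 := hsc.d_pos n l
    have hle : ENNReal.ofReal (dStar (d n) ^ 2 / (d n i * d n j * d n k * d n l) *
        |pd i (pd j (pd k (pd l (fun σ => ℓ n σ y)))) τ|) ≤
        ENNReal.ofReal (dStar (d n) ^ 2 / (d n i * d n j * d n k * d n l)) *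
        ⨆ τ ∈ SBox (d n) δ' σ₀, ENNReal.ofReal
          |pd i (pd j (pd k (pd l (fun σ => ℓ n σ y)))) τ| := by
      rw [ENNReal.ofReal_mul (by positivity)]
      gcongr
      exact le_biSup (fun τ => ENNReal.ofReal |pd i (pd j (pd k (pd l (fun σ => ℓ n σ y)))) τ|) hτ
    have hle' := (ENNReal.ofReal_le_iff_le_toReal hfin).1 hle
    have e : |pd i (pd j (pd k (pd l (fun σ => ℓ n σ y)))) τ| =
        (dStar (d n) ^ 2 / (d n i * d n j * d n k * d n l) *
        |pd i (pd j (pd k (pd l (fun σ => ℓ n σ y)))) τ|) *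
          (d n i * d n j * d n k * d n l / dStar (d n) ^ 2) := by field_simp
    calc _ = _ := e
      _ ≤ _ := by gcongr

end Moments

/-! ### Pointwise expansions at a root of the score equation. -/

section Pointwise

variable {s : ℕ} {M : MixedModel s} {ℓ : Par s → (Fin M.N → ℝ) → ℝ} {d : Fin s → ℝ} {σ : Par s}

lemma toReal_le_envelope (δ : ℝ) (y : Fin M.N → ℝ) (i j k l : Fin s) :
    (ENNReal.ofReal (dStar d ^ 2 / (d i * d j * d k * d l)) *
      ⨆ τ ∈ SBox d δ σ, ENNReal.ofReal |pd i (pd j (pd k (pd l (fun σ => ℓ σ y)))) τ|).toReal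
      ≤ envelope M ℓ d δ σ y := by
  obtain ⟨h1, h2, h3, h4⟩ := envelope_nonneg_parts (M := M) (ℓ := ℓ) (d := d) (δ := δ) (σ := σ) (y := y)
  set f : Fin s → Fin s → Fin s → Fin s → ℝ := fun i j k l =>
    (ENNReal.ofReal (dStar d ^ 2 / (d i * d j * d k * d l)) *
      ⨆ τ ∈ SBox d δ σ, ENNReal.ofReal |pd i (pd j (pd k (pd l (fun σ => ℓ σ y)))) τ|).toReal with hf
  have hf0 : ∀ i j k l, 0 ≤ f i j k l := fun _ _ _ _ => ENNReal.toReal_nonneg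
  have e1 := Finset.single_le_sum (f := fun l => f i j k l) (fun l _ => hf0 i j k l)
    (Finset.mem_univ l)
  have e2 := Finset.single_le_sum (f := fun k => ∑ l, f i j k l)
    (fun k _ => Finset.sum_nonneg fun l _ => hf0 i j k l) (Finset.mem_univ k)
  have e3 := Finset.single_le_sum (f := fun j => ∑ k, ∑ l, f i j k l)
    (fun j _ => Finset.sum_nonneg fun k _ => Finset.sum_nonneg fun l _ => hf0 i j k l)
    (Finset.mem_univ j)
  have e4 := Finset.single_le_sum (f := fun i => ∑ j, ∑ k, ∑ l, f i j k l)
    (fun i _ => Finset.sum_nonneg fun j _ => Finset.sum_nonneg fun k _ =>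
      Finset.sum_nonneg fun l _ => hf0 i j k l) (Finset.mem_univ i)
  have e5 := ((e1.trans e2).trans e3).trans e4
  unfold envelope
  linarith

lemma sum_triple_le {u : Fin s → ℝ} {v : Fin s → Fin s → Fin s → ℝ} {c : ℝ}
    (h : ∀ i j k, |u i| * (|u j| * (|u k| * v i j k)) ≤ c) :
    ∑ i, |u i| * ∑ j, |u j| * ∑ k, |u k| * v i j k ≤ s ^ 3 * c := by
  simp only [Finset.mul_sum]
  refine (Finset.sum_le_sum fun i _ => Finset.sum_le_sum fun j _ => Finset.sum_le_sum fun k _ =>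
    h i j k).trans (le_of_eq ?_)
  simp
  ring

/-- The standardized score equation, expanded to the third order. -/
lemma abs_score_expansion_le [Nonempty (Fin s)] (hd : ∀ i, 0 < d i)
    (hs : ∀ y, ContDiffOn ℝ 4 (fun σ => ℓ σ y) (interior M.Θ)) {δ X : ℝ}
    (hsub : SBox d δ σ ⊆ interior M.Θ) (hX : 0 ≤ X) (hXδ : X ≤ δ * dStar d)
    {y : Fin M.N → ℝ}
    (hM4 : ∀ i j k l, ∀ τ ∈ SBox d δ σ, |pd i (pd j (pd k (pd l (fun σ => ℓ σ y)))) τ| ≤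
        (ENNReal.ofReal (dStar d ^ 2 / (d i * d j * d k * d l)) *
          ⨆ τ ∈ SBox d δ σ, ENNReal.ofReal
            |pd i (pd j (pd k (pd l (fun σ => ℓ σ y)))) τ|).toReal *
          (d i * d j * d k * d l / dStar d ^ 2))
    {τ : Par s} (hτ : ∀ i, |d i * (τ i - σ i)| ≤ X) (ha : ∀ i, M.aVec ℓ τ y i = 0) (i : Fin s) :
    |M.lam1 ℓ d σ y i + ((M.QMat ℓ d σ + Matrix.of fun i j => M.lam2 ℓ d σ y i j /
        Real.sqrt (d i * d j)) *ᵥ fun i => d i * (τ i - σ i)) i +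
      1 / 2 * ((fun i => d i * (τ i - σ i)) ⬝ᵥ
        ((Matrix.of fun j k => M.lam3 ℓ d σ y i j k / d i) *ᵥ fun i => d i * (τ i - σ i)))|
      ≤ s ^ 3 * envelope M ℓ d δ σ y * X ^ 3 / dStar d ^ 2 := by
  have hD := dStar_pos hd
  have hδ : 0 ≤ δ := nonneg_of_mul_nonneg_left (hX.trans hXδ) hD
  have hs3 : ∀ y, ContDiffOn ℝ 3 (fun σ => ℓ σ y) (interior M.Θ) := fun y =>
    (hs y).of_le (by norm_num)
  have hσS : σ ∈ SBox d δ σ := self_mem_SBox hd hδ σ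
  have hσ : σ ∈ interior M.Θ := hsub hσS
  have hτS : τ ∈ SBox d δ σ := by
    intro j
    have := hτ j
    rw [abs_mul, abs_of_pos (hd j)] at this
    rw [le_div_iff₀ (hd j)]
    linarith
  set W := envelope M ℓ d δ σ y with hW
  have hi := hd i
  -- The expansion is applied to each score component, so its remainder involves the fourth
  -- derivatives of the criterion function.
  have htay := abs_taylor_pd_le (f := pd i (fun σ => ℓ σ y)) isOpen_interior hsub (convex_SBox δ σ)
    (ContDiffOn.pd_of_isOpen isOpen_interior (hs y) (by norm_num) i)
    (K := fun j k l => W * (d l * d k * d j * d i / dStar d ^ 2))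
    (fun ξ hξ j k l => (hM4 l k j i ξ hξ).trans (by
      have := hd j
      have := hd k
      have := hd l
      gcongr
      exact toReal_le_envelope δ y l k j i)) hσS hτS
  have ha' : pd i (fun σ => ℓ σ y) τ = 0 := ha i
  have hbound : ∑ j, |τ j - σ j| * ∑ k, |τ k - σ k| * ∑ l, |τ l - σ l| *
      (W * (d l * d k * d j * d i / dStar d ^ 2)) ≤ s ^ 3 * (W * X ^ 3 * (d i / dStar d ^ 2)) := by
    refine sum_triple_le (u := fun j => τ j - σ j)
      (v := fun j k l => W * (d l * d k * d j * d i / dStar d ^ 2)) fun j k l => ?_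
    have e : ∀ j, |τ j - σ j| * d j ≤ X := fun j => by
      have := hτ j
      rwa [abs_mul, abs_of_pos (hd j), mul_comm] at this
    have e0 : ∀ j, 0 ≤ |τ j - σ j| * d j := fun j => mul_nonneg (abs_nonneg _) (hd j).le
    have hW0 : 0 ≤ W := zero_le_one.trans one_le_envelope
    calc |τ j - σ j| * (|τ k - σ k| * (|τ l - σ l| * (W * (d l * d k * d j * d i / dStar d ^ 2))))
        = W * ((|τ j - σ j| * d j) * (|τ k - σ k| * d k) * (|τ l - σ l| * d l)) *
          (d i / dStar d ^ 2) := by ring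
      _ ≤ W * (X * X * X) * (d i / dStar d ^ 2) := by
          gcongr
          exacts [e0 l, e0 k, e j, e k, e l]
      _ = _ := by ring
  have htay' := htay.trans hbound
  rw [ha'] at htay'
  have hid : M.lam1 ℓ d σ y i + ((M.QMat ℓ d σ + Matrix.of fun i j => M.lam2 ℓ d σ y i j /
        Real.sqrt (d i * d j)) *ᵥ fun i => d i * (τ i - σ i)) i +
      1 / 2 * ((fun i => d i * (τ i - σ i)) ⬝ᵥ
        ((Matrix.of fun j k => M.lam3 ℓ d σ y i j k / d i) *ᵥ fun i => d i * (τ i - σ i))) =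
      -((0 - pd i (fun σ => ℓ σ y) σ - ∑ j, (τ j - σ j) * pd j (pd i (fun σ => ℓ σ y)) σ
        - 1 / 2 * ∑ j, (τ j - σ j) * ∑ k, (τ k - σ k) * pd k (pd j (pd i (fun σ => ℓ σ y))) σ)
          / d i) := by
    have e2 : ((M.QMat ℓ d σ + Matrix.of fun i j => M.lam2 ℓ d σ y i j /
        Real.sqrt (d i * d j)) *ᵥ fun i => d i * (τ i - σ i)) i =
        (∑ j, (τ j - σ j) * pd j (pd i (fun σ => ℓ σ y)) σ) / d i := by
      simp only [Matrix.mulVec, dotProduct, Matrix.add_apply, Matrix.of_apply]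
      rw [Finset.sum_div]
      refine Finset.sum_congr rfl fun j _ => ?_
      have hj := hd j
      rw [QMat_apply hd, MixedModel.lam2, div_div, Real.mul_self_sqrt (by positivity), ← add_div,
        add_sub_cancel, FMat_comm hs3 hσ]
      simp only [MixedModel.FMat, Matrix.of_apply]
      field_simp
    have e3 : (fun i => d i * (τ i - σ i)) ⬝ᵥ
        ((Matrix.of fun j k => M.lam3 ℓ d σ y i j k / d i) *ᵥ fun i => d i * (τ i - σ i)) =
        (∑ j, (τ j - σ j) * ∑ k, (τ k - σ k) * pd k (pd j (pd i (fun σ => ℓ σ y))) σ) / d i := by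
      simp only [Matrix.mulVec, dotProduct, Matrix.of_apply]
      rw [Finset.sum_div]
      refine Finset.sum_congr rfl fun j _ => ?_
      rw [Finset.mul_sum, Finset.mul_sum, Finset.sum_div]
      refine Finset.sum_congr rfl fun k _ => ?_
      have hj := hd j
      have hk := hd k
      rw [pd_pd_pd_eq_HMat hs3 hσ, MixedModel.lam3]
      field_simp
    rw [e2, e3, MixedModel.lam1, MixedModel.aVec]
    ring
  rw [hid, abs_neg, abs_div, abs_of_pos hi, div_le_iff₀ hi]
  refine htay'.trans (le_of_eq ?_)
  ring

/-- The expansion of `η(τ) - η(σ)` at a root `τ` of the score equation. -/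
lemma abs_eta_sub_leadTerm_le [Nonempty (Fin s)] (hd : ∀ i, 0 < d i)
    (hs : ∀ y, ContDiffOn ℝ 4 (fun σ => ℓ σ y) (interior M.Θ))
    (hη : ContDiffOn ℝ 3 (M.eta ℓ) (interior M.Θ)) {δ p K X : ℝ}
    (hsub : SBox d δ σ ⊆ interior M.Θ) (hX : 1 ≤ X) (hXD : X ≤ dStar d) (hXδ : X ≤ δ * dStar d)
    (hdet : IsUnit (M.QMat ℓ d σ).det) (hp : 1 ≤ p) (hP : ∀ i j, |(M.QMat ℓ d σ)⁻¹ i j| ≤ p)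
    (hb : ∀ i, |M.bVec ℓ σ i| ≤ K) (hB : ∀ i j, |M.BMat ℓ σ i j| ≤ K)
    (hη3 : ∀ τ ∈ SBox d δ σ, ∀ i j k, |pd i (pd j (pd k (M.eta ℓ))) τ| ≤ K)
    {y : Fin M.N → ℝ}
    (hM4 : ∀ i j k l, ∀ τ ∈ SBox d δ σ, |pd i (pd j (pd k (pd l (fun σ => ℓ σ y)))) τ| ≤
        (ENNReal.ofReal (dStar d ^ 2 / (d i * d j * d k * d l)) *
          ⨆ τ ∈ SBox d δ σ, ENNReal.ofReal
            |pd i (pd j (pd k (pd l (fun σ => ℓ σ y)))) τ|).toReal *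
          (d i * d j * d k * d l / dStar d ^ 2))
    {τ : Par s} (hτ : ∀ i, |d i * (τ i - σ i)| ≤ X) (ha : ∀ i, M.aVec ℓ τ y i = 0) :
    |M.eta ℓ τ - M.eta ℓ σ - leadTerm d (M.bVec ℓ σ) (M.BMat ℓ σ) (M.QMat ℓ d σ)⁻¹
        (M.lam1 ℓ d σ y) (M.lam2 ℓ d σ y) (M.lam3 ℓ d σ y)|
      ≤ ((s ^ 2 * p * (3 * s ^ 4 * p + 3 * s ^ 6 * p ^ 2 + 1) + 3 * s ^ 6 * p ^ 2) * K * s ^ 9 +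
        s ^ 3 * K) * (envelope M ℓ d δ σ y ^ 3 * (X ^ 3 / dStar d ^ 3)) := by
  have hD := dStar_pos hd
  have hX0 : 0 ≤ X := by linarith
  have hδ : 0 ≤ δ := nonneg_of_mul_nonneg_left (hX0.trans hXδ) hD
  have hs3 : ∀ y, ContDiffOn ℝ 3 (fun σ => ℓ σ y) (interior M.Θ) := fun y =>
    (hs y).of_le (by norm_num)
  have hs1 : (1 : ℝ) ≤ s := by
    have : 0 < s := Fin.pos_iff_nonempty.2 inferInstance
    exact_mod_cast this
  have hσS : σ ∈ SBox d δ σ := self_mem_SBox hd hδ σ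
  have hσ : σ ∈ interior M.Θ := hsub hσS
  have hτS : τ ∈ SBox d δ σ := by
    intro j
    have := hτ j
    rw [abs_mul, abs_of_pos (hd j)] at this
    rw [le_div_iff₀ (hd j)]
    linarith
  have hK : 0 ≤ K := (abs_nonneg _).trans (hb (Classical.arbitrary _))
  set W := envelope M ℓ d δ σ y with hW
  have hW1 : 1 ≤ W := one_le_envelope
  have hs31 : (1 : ℝ) ≤ s ^ 3 := one_le_pow₀ hs1
  -- The residual of the score expansion carries a factor s³. Using s³W as the common bound absorbs
  -- it, and produces the s⁹ in the final constant.
  have hWW : W ≤ s ^ 3 * W := le_mul_of_one_le_left (by linarith) hs31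
  set x : Fin s → ℝ := fun i => d i * (τ i - σ i) with hx
  have hPsymm : ∀ i j, (M.QMat ℓ d σ)⁻¹ i j = (M.QMat ℓ d σ)⁻¹ j i := fun i j => by
    have := (QMat_isHermitian hd hs3 hσ).inv.apply i j
    simpa using this.symm
  have hquad := abs_quadratic_expansion_le (b := fun i => M.bVec ℓ σ i / d i)
    (B := Matrix.of fun i j => M.BMat ℓ σ i j / (d i * d j)) (K := K) (W := s ^ 3 * W)
    (L := Matrix.of fun i j => M.lam2 ℓ d σ y i j / Real.sqrt (d i * d j))
    (h := fun i => Matrix.of fun j k => M.lam3 ℓ d σ y i j k / d i) (lam := M.lam1 ℓ d σ y)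
    hs1 (Matrix.nonsing_inv_mul _ hdet) hp (hW1.trans hWW) hX hXD hP
    (fun i j => by
      rw [Matrix.of_apply, abs_div, abs_of_nonneg (Real.sqrt_nonneg _)]
      exact div_le_div₀ (by positivity) ((abs_lam2_le_envelope i j).trans hWW) hD
        (dStar_le_sqrt hd i j))
    (fun i j k => by
      rw [Matrix.of_apply, abs_div, abs_of_pos (hd i)]
      exact div_le_div₀ (by positivity) ((abs_lam3_le_envelope i j k).trans hWW) hD
        (dStar_le d i))
    (fun i => (abs_lam1_le_envelope i).trans hWW) hτ
    (fun i => abs_score_expansion_le hd hs hsub hX0 hXδ hM4 hτ ha i)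
    (fun i => by
      rw [abs_div, abs_of_pos (hd i)]
      exact div_le_div₀ hK (hb i) hD (dStar_le d i))
    (fun i j => by
      have hi := hd i
      have hj := hd j
      rw [Matrix.of_apply, abs_div, abs_of_pos (mul_pos hi hj)]
      refine div_le_div₀ hK (hB i j) (by positivity) ?_
      rw [sq]
      exact mul_le_mul (dStar_le d i) (dStar_le d j) hD.le hi.le)
  rw [← leadTerm_eq hPsymm] at hquad
  have htay := abs_taylor_pd_le (f := M.eta ℓ) isOpen_interior hsub (convex_SBox δ σ) hη
    (K := fun _ _ _ => K) (fun ξ hξ i j k => hη3 ξ hξ k j i) hσS hτS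
  have hbound : ∑ i, |τ i - σ i| * ∑ j, |τ j - σ j| * ∑ k, |τ k - σ k| * K
      ≤ s ^ 3 * (K * (X ^ 3 / dStar d ^ 3)) := by
    refine sum_triple_le (u := fun j => τ j - σ j) (v := fun _ _ _ => K) fun i j k => ?_
    have e : ∀ j, |τ j - σ j| ≤ X / dStar d := fun j => by
      have := hτ j
      rw [abs_mul, abs_of_pos (hd j)] at this
      rw [le_div_iff₀ hD]
      have h2 := mul_le_mul_of_nonneg_right (dStar_le d j) (abs_nonneg (τ j - σ j))
      linarith
    calc |τ i - σ i| * (|τ j - σ j| * (|τ k - σ k| * K))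
        ≤ X / dStar d * (X / dStar d * (X / dStar d * K)) := by
          gcongr
          exacts [e i, e j, e k]
      _ = _ := by ring
  have e1 : ∑ i, (τ i - σ i) * pd i (M.eta ℓ) σ = (fun i => M.bVec ℓ σ i / d i) ⬝ᵥ x := by
    simp only [dotProduct, hx, MixedModel.bVec]
    refine Finset.sum_congr rfl fun i _ => ?_
    have hi := hd i
    field_simp
  have e2 : ∑ i, (τ i - σ i) * ∑ j, (τ j - σ j) * pd j (pd i (M.eta ℓ)) σ =
      x ⬝ᵥ ((Matrix.of fun i j => M.BMat ℓ σ i j / (d i * d j)) *ᵥ x) := by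
    simp only [dotProduct, Matrix.mulVec, hx, MixedModel.BMat, Matrix.of_apply]
    refine Finset.sum_congr rfl fun i _ => ?_
    rw [Finset.mul_sum, Finset.mul_sum]
    refine Finset.sum_congr rfl fun j _ => ?_
    rw [pd_comm isOpen_interior (hη.of_le (by norm_num)) j i hσ]
    have hi := hd i
    have hj := hd j
    field_simp
  rw [e1, e2] at htay
  have htay' := htay.trans hbound
  have hW3 : 1 ≤ W ^ 3 := one_le_pow₀ hW1
  have hXX : 0 ≤ X ^ 3 / dStar d ^ 3 := by positivity
  have hlast : s ^ 3 * (K * (X ^ 3 / dStar d ^ 3)) ≤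
      s ^ 3 * K * (W ^ 3 * (X ^ 3 / dStar d ^ 3)) := by
    rw [mul_assoc]
    gcongr
    exact le_mul_of_one_le_left hXX hW3
  set T := leadTerm d (M.bVec ℓ σ) (M.BMat ℓ σ) (M.QMat ℓ d σ)⁻¹
        (M.lam1 ℓ d σ y) (M.lam2 ℓ d σ y) (M.lam3 ℓ d σ y)
  set q₁ := (fun i => M.bVec ℓ σ i / d i) ⬝ᵥ x
  set q₂ := x ⬝ᵥ ((Matrix.of fun i j => M.BMat ℓ σ i j / (d i * d j)) *ᵥ x)
  have hsplit : M.eta ℓ τ - M.eta ℓ σ - T =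
      (M.eta ℓ τ - M.eta ℓ σ - q₁ - 1 / 2 * q₂) + (q₁ + 1 / 2 * q₂ - T) := by ring
  rw [hsplit]
  refine (abs_add_le _ _).trans ((add_le_add (htay'.trans hlast) hquad).trans (le_of_eq ?_))
  ring

end Pointwise

/-! ### Continuity of the corrections near the true value. -/

section Closeness

variable {s : ℕ} {M : ℕ → MixedModel s} {ℓ : ∀ n, Par s → (Fin (M n).N → ℝ) → ℝ}
  {d : ℕ → Fin s → ℝ} {σ₀ : Par s} {g δ lam : ℝ}

lemma close_of_abs_sub_le {K K' ε x x₀ : ℝ} (hε : ε ≤ 1) (h0 : |x₀| ≤ K) (h : |x - x₀| ≤ K' * ε)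
    (hK' : 0 ≤ K') {L : ℝ} (hL : K + K' ≤ L) (hε0 : 0 ≤ ε) : Close L ε x x₀ := by
  have hK : 0 ≤ K := (abs_nonneg _).trans h0
  have e1 : |x| ≤ |x - x₀| + |x₀| := by
    have := abs_add_le (x - x₀) x₀
    simpa using this
  have e2 : K' * ε ≤ K' := mul_le_of_le_one_right hK' hε
  refine ⟨by linarith, by linarith, h.trans ?_⟩
  exact mul_le_mul_of_nonneg_right (by linarith) hε0

/-- The resolvent identity Q⁻¹ − Q₀⁻¹ = Q⁻¹(Q₀ − Q)Q₀⁻¹. -/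
lemma abs_inv_sub_inv_apply_le {Q Q₀ : Matrix (Fin s) (Fin s) ℝ} (hQ : IsUnit Q.det)
    (hQ₀ : IsUnit Q₀.det) {p p₀ e : ℝ} (hP : ∀ i j, |Q⁻¹ i j| ≤ p) (hP₀ : ∀ i j, |Q₀⁻¹ i j| ≤ p₀)
    (he : ∀ i j, |Q i j - Q₀ i j| ≤ e) (i j : Fin s) :
    |Q⁻¹ i j - Q₀⁻¹ i j| ≤ s * (p * (s * (e * p₀))) := by
  have h : Q⁻¹ - Q₀⁻¹ = Q⁻¹ * ((Q₀ - Q) * Q₀⁻¹) := by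
    rw [Matrix.sub_mul, Matrix.mul_nonsing_inv _ hQ₀, Matrix.mul_sub, mul_one, ← mul_assoc,
      Matrix.nonsing_inv_mul _ hQ, one_mul]
  have e1 : ∀ k, |((Q₀ - Q) * Q₀⁻¹) k j| ≤ s * (e * p₀) := fun k =>
    abs_dotProduct_le (v := fun l => (Q₀ - Q) k l) (w := fun l => Q₀⁻¹ l j)
      (fun l => by rw [Matrix.sub_apply, abs_sub_comm]; exact he k l) (fun l => hP₀ l j)
  have h' : Q⁻¹ i j - Q₀⁻¹ i j = (Q⁻¹ * ((Q₀ - Q) * Q₀⁻¹)) i j := by rw [← h, Matrix.sub_apply]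
  rw [h']
  exact abs_dotProduct_le (v := fun l => Q⁻¹ i l) (w := fun l => ((Q₀ - Q) * Q₀⁻¹) l j)
    (fun l => hP i l) e1

/-- The quantities which enter the corrections at `τ` near `σ₀` are close to those at `σ₀`. -/
structure CloseAt (M : MixedModel s) (ℓ : Par s → (Fin M.N → ℝ) → ℝ) (d : Fin s → ℝ)
    (K ε : ℝ) (σ τ : Par s) : Prop where
  eta : |M.eta ℓ τ| ≤ K
  b : ∀ i, Close K ε (M.bVec ℓ τ i) (M.bVec ℓ σ i)
  B : ∀ i j, Close K ε (M.BMat ℓ τ i j) (M.BMat ℓ σ i j)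
  P : ∀ i j, Close K ε ((M.QMat ℓ d τ)⁻¹ i j) ((M.QMat ℓ d σ)⁻¹ i j)
  U1 : ∀ i j, Close K ε (M.U1 ℓ d τ i j) (M.U1 ℓ d σ i j)
  U2 : ∀ i j k, Close K ε (M.U2 ℓ d τ i j k) (M.U2 ℓ d σ i j k)
  U3 : ∀ i j k l m, Close K ε (M.U3 ℓ d τ i j k l m) (M.U3 ℓ d σ i j k l m)

lemma abs_U_le_of_envelope {M : MixedModel s} {ℓ : Par s → (Fin M.N → ℝ) → ℝ} {d : Fin s → ℝ}
    {δ K : ℝ} {σ : Par s} (hint : Integrable (fun y => envelope M ℓ d δ σ y ^ 6) (M.law σ))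
    (hK : ∫ y, envelope M ℓ d δ σ y ^ 6 ∂(M.law σ) ≤ K) :
    (∀ i j, |M.U1 ℓ d σ i j| ≤ K) ∧ (∀ i j k, |M.U2 ℓ d σ i j k| ≤ K) ∧
      ∀ i j k l m, |M.U3 ℓ d σ i j k l m| ≤ K := by
  have key : ∀ f : (Fin M.N → ℝ) → ℝ, (∀ y, |f y| ≤ envelope M ℓ d δ σ y ^ 6) →
      |∫ y, f y ∂(M.law σ)| ≤ K := fun f hf =>
    (Real.norm_eq_abs _).symm.le.trans
      ((norm_integral_le_of_norm_le (f := f) hint (Eventually.of_forall hf)).trans hK)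
  have h1 : ∀ y, 1 ≤ envelope M ℓ d δ σ y := fun y => one_le_envelope
  have h2 : ∀ {a b : ℝ} {y}, |a| ≤ envelope M ℓ d δ σ y → |b| ≤ envelope M ℓ d δ σ y →
      |a * b| ≤ envelope M ℓ d δ σ y ^ 2 := fun {a b y} ha hb => by
    rw [abs_mul, sq]; exact mul_le_mul ha hb (abs_nonneg _) (zero_le_one.trans (h1 y))
  refine ⟨fun i j => key _ fun y => ?_, fun i j k => key _ fun y => ?_,
    fun i j k l m => key _ fun y => ?_⟩
  · exact (h2 (abs_lam1_le_envelope i) (abs_lam1_le_envelope j)).trans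
      (pow_le_pow_right₀ (h1 y) (by norm_num))
  · exact (h2 (abs_lam2_le_envelope i j) (abs_lam1_le_envelope k)).trans
      (pow_le_pow_right₀ (h1 y) (by norm_num))
  · have : |M.lam3 ℓ d σ y i j l * M.lam1 ℓ d σ y k * M.lam1 ℓ d σ y m| ≤
        envelope M ℓ d δ σ y ^ 3 := by
      rw [abs_mul, pow_succ]
      exact mul_le_mul (h2 (abs_lam3_le_envelope i j l) (abs_lam1_le_envelope k))
        (abs_lam1_le_envelope m) (abs_nonneg _) (pow_nonneg (zero_le_one.trans (h1 y)) 2)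
    exact this.trans (pow_le_pow_right₀ (h1 y) (by norm_num))

/-- The constant K is fixed before ε, which is what later yields little-o. Bounds descend from the
third derivatives of η to B, b and η by the mean value inequality. The inverse of Q is handled by
the resolvent identity, and the moment arrays by their assumed continuity and the envelope bound at
σ₀. -/
lemma MSEConditions.exists_closeAt (h : MSEConditions M ℓ d σ₀ g δ lam) (hlam : 0 < lam) :
    ∃ K : ℝ, 1 ≤ K ∧ ∀ ε : ℝ, 0 < ε → ε ≤ 1 → ∃ δ₁ > 0, ∀ᶠ n in atTop,
      ∀ τ ∈ SBox (d n) δ₁ σ₀, CloseAt (M n) (ℓ n) (d n) K ε σ₀ τ := by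
  have hsc := h.score
  have hne : Nonempty (Fin s) := nonempty_of_dStar_tendsto hsc.dStar_tendsto
  obtain ⟨δ', hδ', hδδ, hsub⟩ := exists_SBox_subset hsc.d_pos hsc.mem_interior hsc.δ_pos
  obtain ⟨⟨KU, hKU0, hKU⟩, -⟩ := h.envelope_moment hlam hδδ hsub
  obtain ⟨Kη, hKη⟩ := h.eta_bdd
  obtain ⟨Kb, hKb⟩ := h.b_bdd
  obtain ⟨KB, hKB⟩ := h.B_bdd
  obtain ⟨K₃, hK₃⟩ := h.eta3_bdd
  obtain ⟨c, hc, hneg⟩ := hsc.eventually_negDef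
  have hKη0 : 0 ≤ Kη := (abs_nonneg _).trans (hKη 0)
  have hKb0 : 0 ≤ Kb := (norm_nonneg _).trans (hKb 0)
  have hKB0 : 0 ≤ KB := (norm_nonneg _).trans (hKB 0)
  have hK₃0 : 0 ≤ K₃ := by
    have i : Fin s := Classical.arbitrary _
    exact (abs_nonneg _).trans (hK₃ 0 σ₀ (self_mem_SBox (hsc.d_pos 0) hsc.δ_pos.le σ₀) i i i)
  set KB' := KB + s * K₃ with hKB'
  set Kb' := Kb + s * KB' with hKb'
  set Kη' := Kη + s * Kb' with hKη'
  set KP := 1 / c + s * (2 / c * (s * (1 / c))) with hKP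
  have hs0 : (0 : ℝ) ≤ s := Nat.cast_nonneg s
  have hKB'0 : 0 ≤ KB' := by positivity
  have hKb'0 : 0 ≤ Kb' := by positivity
  have hKη'0 : 0 ≤ Kη' := by positivity
  have hKP0 : 0 ≤ KP := by positivity
  refine ⟨Kη' + Kb' + KB' + KP + (KU + 1), by linarith, fun ε hε hε1 => ?_⟩
  -- The bound ε gives closeness of Q. The bound c/2 keeps Q(τ) negative definite with constant c/2,
  -- so that its inverse has entries at most 2/c.
  obtain ⟨δQ, hδQ, hQ⟩ := h.Q_cont (min ε (c / 2)) (by positivity)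
  obtain ⟨δ₁, hδ₁, hU1⟩ := h.U1_cont ε hε
  obtain ⟨δ₂, hδ₂, hU2⟩ := h.U2_cont ε hε
  obtain ⟨δ₃, hδ₃, hU3⟩ := h.U3_cont ε hε
  set δm := min ε (min δ' (min δQ (min δ₁ (min δ₂ δ₃)))) with hδm
  have hδm0 : 0 < δm := by positivity
  refine ⟨δm, hδm0, ?_⟩
  have l1 : δm ≤ ε := min_le_left _ _
  have l2 : δm ≤ δ' := (min_le_right _ _).trans (min_le_left _ _)
  have l3 : δm ≤ δQ := ((min_le_right _ _).trans (min_le_right _ _)).trans (min_le_left _ _)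
  have l4 : δm ≤ δ₁ := (((min_le_right _ _).trans (min_le_right _ _)).trans
    (min_le_right _ _)).trans (min_le_left _ _)
  have l5 : δm ≤ δ₂ := ((((min_le_right _ _).trans (min_le_right _ _)).trans
    (min_le_right _ _)).trans (min_le_right _ _)).trans (min_le_left _ _)
  have l6 : δm ≤ δ₃ := ((((min_le_right _ _).trans (min_le_right _ _)).trans
    (min_le_right _ _)).trans (min_le_right _ _)).trans (min_le_right _ _)
  filter_upwards [hneg] with n hn τ hτ
  have hd := hsc.d_pos n
  have hmono : ∀ {a}, δm ≤ a → SBox (d n) δm σ₀ ⊆ SBox (d n) a σ₀ := fun ha => SBox_mono hd ha σ₀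
  have hsubm : SBox (d n) δm σ₀ ⊆ interior (M n).Θ := (hmono l2).trans (hsub n)
  have hσS : σ₀ ∈ SBox (d n) δm σ₀ := self_mem_SBox hd hδm0.le σ₀
  have hmv : ∀ {f : Par s → ℝ} {K : ℝ}, 0 ≤ K → DifferentiableOn ℝ f (interior (M n).Θ) →
      (∀ ξ ∈ SBox (d n) δm σ₀, ∀ i, |pd i f ξ| ≤ K) → ∀ ξ ∈ SBox (d n) δm σ₀,
      |f ξ - f σ₀| ≤ s * K * ε := by
    intro f K hK0 hf hK ξ hξ
    refine (abs_sub_le_sum_of_pd_le (K := fun _ => K) isOpen_interior hsubm (convex_SBox _ _) hf hK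
      hσS hξ).trans ?_
    calc ∑ i, |ξ i - σ₀ i| * K ≤ ∑ _i : Fin s, ε * K := Finset.sum_le_sum fun i _ => by
          gcongr
          exact (abs_sub_le_of_mem_SBox hd hδm0.le hξ i).trans l1
      _ = s * K * ε := by simp; ring
  have hηs := h.eta_smooth n
  have hB : ∀ ξ ∈ SBox (d n) δm σ₀, ∀ i j, |(M n).BMat (ℓ n) ξ i j - (M n).BMat (ℓ n) σ₀ i j|
      ≤ s * K₃ * ε := fun ξ hξ i j =>
    hmv hK₃0 ((ContDiffOn.pd_of_isOpen (m := 1) isOpen_interior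
      (ContDiffOn.pd_of_isOpen (m := 2) isOpen_interior hηs (by norm_num) j)
      (by norm_num) i).differentiableOn (by norm_num))
      (fun ξ hξ k => hK₃ n ξ (hmono (l2.trans hδδ) hξ) k i j) ξ hξ
  have hB0 : ∀ i j, |(M n).BMat (ℓ n) σ₀ i j| ≤ KB := fun i j =>
    (abs_apply_le_specNorm _ i j).trans (hKB n)
  have hBc : ∀ ξ ∈ SBox (d n) δm σ₀, ∀ i j,
      Close KB' ε ((M n).BMat (ℓ n) ξ i j) ((M n).BMat (ℓ n) σ₀ i j) := fun ξ hξ i j =>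
    close_of_abs_sub_le hε1 (hB0 i j) (hB ξ hξ i j) (by positivity) le_rfl hε.le
  have hb : ∀ ξ ∈ SBox (d n) δm σ₀, ∀ i, |(M n).bVec (ℓ n) ξ i - (M n).bVec (ℓ n) σ₀ i|
      ≤ s * KB' * ε := fun ξ hξ i =>
    hmv hKB'0 ((ContDiffOn.pd_of_isOpen (m := 2) isOpen_interior hηs (by norm_num)
      i).differentiableOn (by norm_num)) (fun ξ hξ k => (hBc ξ hξ k i).1) ξ hξ
  have hb0 : ∀ i, |(M n).bVec (ℓ n) σ₀ i| ≤ Kb := fun i =>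
    (PiLp.norm_apply_le (WithLp.toLp 2 ((M n).bVec (ℓ n) σ₀)) i).trans (hKb n)
  have hbc : ∀ ξ ∈ SBox (d n) δm σ₀, ∀ i,
      Close Kb' ε ((M n).bVec (ℓ n) ξ i) ((M n).bVec (ℓ n) σ₀ i) := fun ξ hξ i =>
    close_of_abs_sub_le hε1 (hb0 i) (hb ξ hξ i) (by positivity) le_rfl hε.le
  have hηc : Close Kη' ε ((M n).eta (ℓ n) τ) ((M n).eta (ℓ n) σ₀) :=
    close_of_abs_sub_le hε1 (hKη n) (hmv hKb'0 (hηs.differentiableOn (by norm_num))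
      (fun ξ hξ i => (hbc ξ hξ i).1) τ hτ) (by positivity) le_rfl hε.le
  have hQτ := hQ n τ (hmono l3 hτ)
  obtain ⟨hdet₀, hP₀⟩ := inv_bound_of_negDef hc hn
  have hn' : ∀ v : Fin s → ℝ, v ⬝ᵥ ((M n).QMat (ℓ n) (d n) τ *ᵥ v) ≤ -(c / 2) * (v ⬝ᵥ v) := by
    intro v
    have e1 := abs_dotProduct_mulVec_le
      ((M n).QMat (ℓ n) (d n) τ - (M n).QMat (ℓ n) (d n) σ₀) v
    have e2 : v ⬝ᵥ (((M n).QMat (ℓ n) (d n) τ - (M n).QMat (ℓ n) (d n) σ₀) *ᵥ v) =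
        v ⬝ᵥ ((M n).QMat (ℓ n) (d n) τ *ᵥ v) - v ⬝ᵥ ((M n).QMat (ℓ n) (d n) σ₀ *ᵥ v) := by
      rw [Matrix.sub_mulVec, dotProduct_sub]
    rw [e2] at e1
    have hvv : 0 ≤ v ⬝ᵥ v := Finset.sum_nonneg fun i _ => mul_self_nonneg _
    have e3 := mul_le_mul_of_nonneg_right (hQτ.trans (min_le_right _ _)) hvv
    have e4 := (le_abs_self _).trans e1
    have e5 := hn v
    linarith
  obtain ⟨hdet, hP⟩ := inv_bound_of_negDef (by positivity) hn'
  have hPc : ∀ i j, Close KP ε (((M n).QMat (ℓ n) (d n) τ)⁻¹ i j)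
      (((M n).QMat (ℓ n) (d n) σ₀)⁻¹ i j) := fun i j => by
    have := abs_inv_sub_inv_apply_le hdet hdet₀ hP hP₀ (e := ε) (fun i j =>
      (abs_apply_le_specNorm ((M n).QMat (ℓ n) (d n) τ - (M n).QMat (ℓ n) (d n) σ₀) i j).trans
        (hQτ.trans (min_le_left _ _))) i j
    refine close_of_abs_sub_le (K' := s * (2 / c * (s * (1 / c)))) hε1 (hP₀ i j) (this.trans
      (le_of_eq ?_)) (by positivity) le_rfl hε.le
    field_simp
  obtain ⟨u1, u2, u3⟩ := abs_U_le_of_envelope (hKU n).1 (hKU n).2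
  have wk : ∀ {K L : ℝ} {x x' : ℝ}, K ≤ L → Close K ε x x' → Close L ε x x' := fun hKL hx =>
    ⟨hx.1.trans hKL, hx.2.1.trans hKL, hx.2.2.trans (mul_le_mul_of_nonneg_right hKL hε.le)⟩
  refine ⟨hηc.1.trans (by linarith), fun i => wk (by linarith) (hbc τ hτ i),
    fun i j => wk (by linarith) (hBc τ hτ i j), fun i j => wk (by linarith) (hPc i j),
    fun i j => ?_, fun i j k => ?_, fun i j k l m => ?_⟩
  · refine close_of_abs_sub_le (K' := 1) hε1 (u1 i j) ?_ zero_le_one (by linarith) hε.le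
    rw [one_mul]
    exact (abs_apply_le_specNorm ((M n).U1 (ℓ n) (d n) τ - (M n).U1 (ℓ n) (d n) σ₀) i j).trans
      (hU1 n τ (hmono l4 hτ))
  · refine close_of_abs_sub_le (K' := 1) hε1 (u2 i j k) ?_ zero_le_one (by linarith) hε.le
    rw [one_mul]
    refine le_trans ?_ (hU2 n τ (hmono l5 hτ))
    set f := (M n).U2 (ℓ n) (d n) τ - (M n).U2 (ℓ n) (d n) σ₀
    exact ((norm_le_pi_norm (f i j) k).trans (norm_le_pi_norm (f i) j)).trans (norm_le_pi_norm f i)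
  · refine close_of_abs_sub_le (K' := 1) hε1 (u3 i j k l m) ?_ zero_le_one (by linarith) hε.le
    rw [one_mul]
    refine le_trans ?_ (hU3 n τ (hmono l6 hτ))
    set f := (M n).U3 (ℓ n) (d n) τ - (M n).U3 (ℓ n) (d n) σ₀
    exact ((((norm_le_pi_norm (f i j k l) m).trans (norm_le_pi_norm (f i j k) l)).trans
      (norm_le_pi_norm (f i j) k)).trans (norm_le_pi_norm (f i) j)).trans (norm_le_pi_norm f i)

/-- Closeness of the total corrections. -/
lemma CloseAt.correction [Nonempty (Fin s)] {M : MixedModel s} {ℓ : Par s → (Fin M.N → ℝ) → ℝ}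
    {d : Fin s → ℝ} {K ε : ℝ} {σ τ : Par s} (h : CloseAt M ℓ d K ε σ τ) (hd : ∀ i, 0 < d i)
    (hσ : σ ∈ interior M.Θ) (hτ : τ ∈ interior M.Θ)
    (ha : ∀ σ ∈ interior M.Θ, ∀ i, Integrable (fun y => M.aVec ℓ σ y i) (M.law σ))
    (haa : ∀ σ ∈ interior M.Θ, ∀ i j,
      Integrable (fun y => M.aVec ℓ σ y i * M.aVec ℓ σ y j) (M.law σ))
    (hFa : ∀ σ ∈ interior M.Θ, ∀ i j k,
      Integrable (fun y => M.FMat ℓ σ y i j * M.aVec ℓ σ y k) (M.law σ))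
    (hHaa : ∀ σ ∈ interior M.Θ, ∀ i j k l m,
      Integrable (fun y => M.HMat ℓ i σ y j k * M.aVec ℓ σ y l * M.aVec ℓ σ y m) (M.law σ))
    (hE : ∀ σ ∈ interior M.Θ, ∀ i, ∫ y, M.aVec ℓ σ y i ∂(M.law σ) = 0) :
    Close (16 * s ^ 4 * K ^ 4 + 16 * s ^ 6 * K ^ 5) ε
      ((M.Delta1 ℓ τ + M.Delta2 ℓ τ + M.Delta3 ℓ τ) * dStar d ^ 2)
      ((M.Delta1 ℓ σ + M.Delta2 ℓ σ + M.Delta3 ℓ σ) * dStar d ^ 2) := by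
  have c := ((close_corr1 hd h.b h.P h.U2).add (close_corr2 hd h.B h.P h.U1)).add
    (close_corr3 hd h.b h.P h.U3)
  rw [Delta1_eq_corr1 hd (ha τ hτ) (hFa τ hτ) (hE τ hτ), Delta2_eq_corr2 hd (haa τ hτ),
    Delta3_eq_corr3 hd (hHaa τ hτ), Delta1_eq_corr1 hd (ha σ hσ) (hFa σ hσ) (hE σ hσ),
    Delta2_eq_corr2 hd (haa σ hσ), Delta3_eq_corr3 hd (hHaa σ hσ)]
  rw [add_mul, add_mul, add_mul, add_mul]
  convert c using 1
  ring

end Closeness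

/-! ### From pointwise bounds to the bias. -/

section Final

/-- Off B, the inequality w ≤ tw² + 1/t with w = W³ separates the random size of R from the
indicator of Bᶜ, so only the sixth moment of W and the probability of Bᶜ enter. The free parameter t
balances the two contributions. -/
lemma abs_integral_le_of_split {Ω : Type*} [MeasurableSpace Ω] {μ : Measure Ω}
    [IsProbabilityMeasure μ] {B : Set Ω} (hB : MeasurableSet B) {R W : Ω → ℝ}
    (hW6 : Integrable (fun y => W y ^ 6) μ) (hW : ∀ y, 1 ≤ W y) {α β γ κ t : ℝ} (hα : 0 ≤ α)
    (hβ : 0 ≤ β) (hκ : 0 ≤ κ) (ht : 0 < t)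
    (hon : ∀ᵐ y ∂μ, y ∈ B → |R y| ≤ α * W y ^ 3 + β)
    (hoff : ∀ᵐ y ∂μ, y ∉ B → |R y| ≤ γ + κ * W y ^ 3) :
    |∫ y, R y ∂μ| ≤ (α + κ * t) * ∫ y, W y ^ 6 ∂μ + β + (γ + κ / t) * μ.real Bᶜ := by
  have i1 : Integrable (fun y => (α + κ * t) * W y ^ 6) μ := hW6.const_mul _
  have i2 : Integrable (fun y => (α + κ * t) * W y ^ 6 + β) μ := i1.add (integrable_const _)
  have i3 : Integrable (Bᶜ.indicator fun _ => γ + κ / t) μ :=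
    (integrable_const _).indicator hB.compl
  have hle : ∀ᵐ y ∂μ, ‖R y‖ ≤ (α + κ * t) * W y ^ 6 + β + Bᶜ.indicator (fun _ => γ + κ / t) y := by
    filter_upwards [hon, hoff] with y h1 h2
    have hW3 : 1 ≤ W y ^ 3 := one_le_pow₀ (hW y)
    have e : W y ^ 6 = W y ^ 3 * W y ^ 3 := by ring
    by_cases hy : y ∈ B
    · rw [Set.indicator_of_notMem (by simpa using hy), add_zero, Real.norm_eq_abs]
      refine (h1 hy).trans ?_
      have : W y ^ 3 ≤ W y ^ 6 := pow_le_pow_right₀ (hW y) (by norm_num)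
      have h3 : α * W y ^ 3 ≤ α * W y ^ 6 := by gcongr
      have h4 : 0 ≤ κ * t * W y ^ 6 := by rw [e]; positivity
      linarith
    · rw [Set.indicator_of_mem (by simpa using hy), Real.norm_eq_abs]
      refine (h2 hy).trans ?_
      have h3 : W y ^ 3 ≤ t * W y ^ 6 + 1 / t := by
        rw [e]
        set w := W y ^ 3
        have hw : 0 ≤ (t * w - 1) ^ 2 + t * w := by positivity
        have : t * w ≤ t * (t * (w * w) + 1 / t) := by
          have : t * (t * (w * w) + 1 / t) = (t * w) ^ 2 + 1 := by field_simp
          rw [this]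
          linarith [hw]
        exact le_of_mul_le_mul_left this ht
      have h4 := mul_le_mul_of_nonneg_left h3 hκ
      have h5 : 0 ≤ α * W y ^ 6 := by rw [e]; positivity
      have h6 : κ * (t * W y ^ 6 + 1 / t) = κ * t * W y ^ 6 + κ / t := by ring
      linarith
  have := norm_integral_le_of_norm_le (i2.add i3) hle
  rw [Real.norm_eq_abs] at this
  refine this.trans (le_of_eq ?_)
  simp only [Pi.add_apply]
  rw [integral_add i2 i3, integral_add i1 (integrable_const _), integral_const_mul,
    integral_indicator_const _ hB.compl]
  simp
  ring

variable {s : ℕ} {M : ℕ → MixedModel s} {ℓ : ∀ n, Par s → (Fin (M n).N → ℝ) → ℝ}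
  {d : ℕ → Fin s → ℝ} {σ₀ σstar : Par s} {g δ c₀ lam : ℝ}
  {σhat : ∀ n, (Fin (M n).N → ℝ) → Par s}

lemma abs_etaHat_le {M : MixedModel s} {ℓ : Par s → (Fin M.N → ℝ) → ℝ} {d : Fin s → ℝ}
    (hpos : 0 ≤ c₀ * dStar d ^ lam) (τ : Par s) :
    |etaHat M ℓ d c₀ lam σstar τ| ≤ c₀ * dStar d ^ lam + |M.eta ℓ σstar| := by
  unfold etaHat
  split_ifs with h
  · linarith [abs_nonneg (M.eta ℓ σstar)]
  · linarith

lemma sum_rates_le {C₁ C₂ C₃ L V u v w ε q : ℝ} (h₁ : 0 ≤ C₁) (h₂ : 0 ≤ C₂) (h₃ : 0 ≤ C₃)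
    (hL : 0 ≤ L) (hV : 0 ≤ V) (hu : 0 ≤ u) (hv : 0 ≤ v) (hw : 0 ≤ w) (hε : 0 ≤ ε) (hq : 0 ≤ q) :
    (C₁ * (u * q) + C₂ * (v * q)) * V + C₃ * ε * q + L * (w * q) ≤
      (C₁ * V + C₂ * V + C₃ + L) * (u + v + w + ε) * q := by
  have hnn : 0 ≤ (C₁ * V * (v + w + ε) + C₂ * V * (u + w + ε) + C₃ * (u + v + w) +
    L * (u + v + ε)) * q := by positivity
  linarith

set_option maxHeartbeats 800000 in
/-- A bound for the bias which holds for all large `n`, with a constant independent of `ε`. -/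
lemma exists_abs_bias_le (hc₀ : 0 < c₀) (hlam : 0 < lam)
    (hηstar : (fun n => (M n).eta (ℓ n) σstar) =O[atTop] fun n => dStar (d n) ^ lam)
    (hexp : ExpectationsExist M ℓ) (h : MSEConditions M ℓ d σ₀ g δ lam)
    (hEa : ∀ n, ∀ σ ∈ interior (M n).Θ, ∀ i, ∫ y, (M n).aVec (ℓ n) σ y i ∂((M n).law σ) = 0)
    (hroot : IsScoreRoot M ℓ d σ₀ g σhat)
    (hint : ∀ n, Integrable
        (fun y => etaHat (M n) (ℓ n) (d n) c₀ lam σstar (σhat n y)) ((M n).law σ₀)) :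
    ∃ C : ℝ, 0 ≤ C ∧ ∀ ε : ℝ, 0 < ε → ε ≤ 1 → ∀ᶠ n in atTop,
      |(∫ y, etaHat (M n) (ℓ n) (d n) c₀ lam σstar (σhat n y) ∂((M n).law σ₀))
          - (M n).eta (ℓ n) σ₀| ≤
        C * (dStar (d n) ^ (-1 / 4 : ℝ) + dStar (d n) ^ (-lam) +
          dStar (d n) ^ (-(g / 4 - 2 - lam)) + ε) * (dStar (d n) ^ 2)⁻¹ := by
  have hsc := h.score
  have hne : Nonempty (Fin s) := nonempty_of_dStar_tendsto hsc.dStar_tendsto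
  obtain ⟨δ', hδ', hδδ, hsub⟩ := exists_SBox_subset hsc.d_pos hsc.mem_interior hsc.δ_pos
  obtain ⟨⟨KW, hKW0, hKW⟩, hM4⟩ := h.envelope_moment hlam hδδ hsub
  obtain ⟨c, hc, hneg⟩ := hsc.eventually_negDef
  obtain ⟨K₃, hK₃⟩ := h.eta3_bdd
  obtain ⟨K, hK1, hclose⟩ := h.exists_closeAt hlam
  -- At ρ = 3/4 both terms of the minimum equal 1/4. The complement then has probability
  -- O(d_*^{-g/4}) and |x| < d_*^{1/4}, so that the cubic remainder is d_*^{-9/4}.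
  obtain ⟨B, hBm, hBroot, cB, hcB⟩ := hroot.root (3 / 4) (by norm_num) (by norm_num)
  obtain ⟨Cs, hCs⟩ := hηstar.bound
  have hK0 : 0 ≤ K := by linarith
  set K' := K + |K₃| with hK'
  have hK'0 : 0 ≤ K' := by positivity
  set C₁ : ℝ := (s ^ 2 * K * (3 * s ^ 4 * K + 3 * s ^ 6 * K ^ 2 + 1) + 3 * s ^ 6 * K ^ 2) * K' * s ^ 9 +
        s ^ 3 * K' with hC₁
  set C₂ : ℝ := s ^ 2 * K ^ 2 + 16 * s ^ 4 * K ^ 3 + 16 * s ^ 6 * K ^ 4 with hC₂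
  set C₃ : ℝ := 16 * s ^ 4 * K ^ 4 + 16 * s ^ 6 * K ^ 5 with hC₃
  set C₄ : ℝ := c₀ + |Cs| + K + C₃ with hC₄
  have hC₁0 : 0 ≤ C₁ := by positivity
  have hC₂0 : 0 ≤ C₂ := by positivity
  have hC₃0 : 0 ≤ C₃ := by positivity
  have hC₄0 : 0 ≤ C₄ := by positivity
  refine ⟨C₁ * KW + C₂ * KW + C₃ + (C₄ + C₂) * |cB|, by positivity, fun ε hε hε1 => ?_⟩
  obtain ⟨δ₁, hδ₁, hcl⟩ := hclose ε hε hε1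
  have hDpos : ∀ n, 0 < dStar (d n) := fun n => dStar_pos (hsc.d_pos n)
  -- The bound |x| ≤ d_*^{1/4} puts σ̂ in the box of relative size d_*^{-3/4}, which eventually lies
  -- in any fixed box.
  have hsmall : Tendsto (fun n => dStar (d n) ^ (-(3 / 4) : ℝ)) atTop (𝓝 0) :=
    (tendsto_rpow_neg_atTop (by norm_num)).comp hsc.dStar_tendsto
  have hlarge : Tendsto (fun n => dStar (d n) ^ lam) atTop atTop :=
    (tendsto_rpow_atTop hlam).comp hsc.dStar_tendsto
  filter_upwards [hcl, hneg, hBroot, hCs, hsc.dStar_tendsto.eventually_ge_atTop 1,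
    hsmall.eventually_le_const hδ₁, hsmall.eventually_le_const hδ',
    hlarge.eventually_ge_atTop ((K + C₃) / c₀)] with n hcl hneg hBroot hCs hD1 hs1 hs2 hl
  have hd := hsc.d_pos n
  set D := dStar (d n) with hDdef
  have hD0 : 0 < D := hDpos n
  set X := D ^ (1 / 4 : ℝ) with hX
  have hX1 : 1 ≤ X := Real.one_le_rpow hD1 (by norm_num)
  have hXe : X = D ^ (-(3 / 4) : ℝ) * D := by
    rw [hX]
    conv_rhs => rw [← Real.rpow_one D, ← Real.rpow_mul hD0.le, ← Real.rpow_add hD0]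
    norm_num
  have hXδ₁ : X ≤ δ₁ * D := by rw [hXe]; gcongr
  have hXδ' : X ≤ δ' * D := by rw [hXe]; gcongr
  have hXD : X ≤ D := by
    calc X ≤ D ^ (1 : ℝ) := Real.rpow_le_rpow_of_exponent_le hD1 (by norm_num)
      _ = D := Real.rpow_one D
  have hX3 : X ^ 3 / D ^ 3 = D ^ (-1 / 4 : ℝ) * (D ^ 2)⁻¹ := by
    rw [hX, ← Real.rpow_natCast, ← Real.rpow_mul hD0.le, ← Real.rpow_natCast D 3,
      ← Real.rpow_sub hD0, ← Real.rpow_natCast D 2, ← Real.rpow_neg hD0.le, ← Real.rpow_add hD0]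
    norm_num
  have hDlam : 1 ≤ D ^ lam := Real.one_le_rpow hD1 hlam.le
  have hD2 : 1 ≤ D ^ 2 := one_le_pow₀ hD1
  have hσ : σ₀ ∈ interior (M n).Θ := hsc.mem_interior' n
  have hc0 := hcl σ₀ (self_mem_SBox hd hδ₁.le σ₀)
  obtain ⟨hdet, -⟩ := inv_bound_of_negDef hc hneg
  have hP : ∀ i j, |((M n).QMat (ℓ n) (d n) σ₀)⁻¹ i j| ≤ K := fun i j => (hc0.P i j).1
  have hb : ∀ i, |(M n).bVec (ℓ n) σ₀ i| ≤ K := fun i => (hc0.b i).1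
  have hB : ∀ i j, |(M n).BMat (ℓ n) σ₀ i j| ≤ K := fun i j => (hc0.B i j).1
  have hKK' : K ≤ K' := by rw [hK']; linarith [abs_nonneg K₃]
  have hη3 : ∀ τ ∈ SBox (d n) δ' σ₀, ∀ i j k, |pd i (pd j (pd k ((M n).eta (ℓ n)))) τ| ≤ K' :=
    fun τ hτ i j k => (hK₃ n τ (SBox_mono hd hδδ σ₀ hτ) i j k).trans (by
      rw [hK']; linarith [le_abs_self K₃])
  have hcorr : ∀ τ ∈ interior (M n).Θ, CloseAt (M n) (ℓ n) (d n) K ε σ₀ τ →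
      Close C₃ ε (((M n).Delta1 (ℓ n) τ + (M n).Delta2 (ℓ n) τ + (M n).Delta3 (ℓ n) τ) * D ^ 2)
        (((M n).Delta1 (ℓ n) σ₀ + (M n).Delta2 (ℓ n) σ₀ + (M n).Delta3 (ℓ n) σ₀) * D ^ 2) :=
    fun τ hτ hclτ => hclτ.correction hd hσ hτ (hexp.int_a n) (hexp.int_aa n) (hexp.int_Fa n)
      (hexp.int_Haa n) (hEa n)
  have hdiv : ∀ {x L : ℝ}, |x * D ^ 2| ≤ L → |x| ≤ L * (D ^ 2)⁻¹ := by
    intro x L hx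
    rwa [abs_mul, abs_of_pos (by positivity : 0 < D ^ 2), ← le_div_iff₀ (by positivity),
      div_eq_mul_inv] at hx
  set Δ : Par s → ℝ := fun τ =>
    (M n).Delta1 (ℓ n) τ + (M n).Delta2 (ℓ n) τ + (M n).Delta3 (ℓ n) τ with hΔ
  have hΔ0 : |Δ σ₀| ≤ C₃ := by
    refine (hdiv (hcorr σ₀ hσ hc0).2.1).trans ?_
    exact mul_le_of_le_one_right hC₃0 (inv_le_one_of_one_le₀ hD2)
  set T : (Fin (M n).N → ℝ) → ℝ := fun y => leadTerm (d n) ((M n).bVec (ℓ n) σ₀)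
    ((M n).BMat (ℓ n) σ₀) ((M n).QMat (ℓ n) (d n) σ₀)⁻¹ ((M n).lam1 (ℓ n) (d n) σ₀ y)
      ((M n).lam2 (ℓ n) (d n) σ₀ y) ((M n).lam3 (ℓ n) (d n) σ₀ y) with hT
  obtain ⟨hTint, hTval⟩ : Integrable T ((M n).law σ₀) ∧ ∫ y, T y ∂((M n).law σ₀) = Δ σ₀ :=
    integral_leadTerm hd (hexp.int_a n σ₀ hσ) (hexp.int_aa n σ₀ hσ) (hexp.int_Fa n σ₀ hσ)
      (hexp.int_Haa n σ₀ hσ) (hEa n σ₀ hσ)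
  set W := envelope (M n) (ℓ n) (d n) δ' σ₀ with hW
  set η₀ := (M n).eta (ℓ n) σ₀ with hη₀
  set H : (Fin (M n).N → ℝ) → ℝ := fun y => etaHat (M n) (ℓ n) (d n) c₀ lam σstar (σhat n y) with hH
  have hon : ∀ᵐ y ∂((M n).law σ₀), y ∈ B n → |H y - T y - (η₀ - Δ σ₀)| ≤
      C₁ * (X ^ 3 / D ^ 3) * W y ^ 3 + C₃ * ε * (D ^ 2)⁻¹ := by
    filter_upwards [hM4 n] with y hy4 hyB
    obtain ⟨-, hscore, hdist⟩ := hBroot y hyB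
    set τ := σhat n y with hτdef
    have hτ : ∀ i, |d n i * (τ i - σ₀ i)| ≤ X := by
      intro i
      have e1 : |d n i * (τ i - σ₀ i)| ≤ Real.sqrt (∑ i, (d n i * (τ i - σ₀ i)) ^ 2) := by
        refine Real.abs_le_sqrt ?_
        exact Finset.single_le_sum (f := fun i => (d n i * (τ i - σ₀ i)) ^ 2)
          (fun _ _ => sq_nonneg _) (Finset.mem_univ i)
      have e2 : D ^ (1 - 3 / 4 : ℝ) = X := by rw [hX]; norm_num
      rw [e2] at hdist
      exact e1.trans hdist.le
    have hbox : ∀ {δ'' : ℝ}, X ≤ δ'' * D → τ ∈ SBox (d n) δ'' σ₀ := by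
      intro δ'' hδ'' j
      have := hτ j
      rw [abs_mul, abs_of_pos (hd j)] at this
      rw [le_div_iff₀ (hd j)]
      change _ ≤ δ'' * D
      linarith
    have hτint : τ ∈ interior (M n).Θ := hsub n (hbox hXδ')
    have hclτ := hcl τ (hbox hXδ₁)
    have hcτ := hcorr τ hτint hclτ
    have hΔτ : |Δ τ| ≤ C₃ := (hdiv hcτ.1).trans
      (mul_le_of_le_one_right hC₃0 (inv_le_one_of_one_le₀ hD2))
    have hΔdiff : |Δ τ - Δ σ₀| ≤ C₃ * ε * (D ^ 2)⁻¹ := by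
      refine hdiv ?_
      have := hcτ.2.2
      rwa [← sub_mul] at this
    have hcorrected : (M n).corrected (ℓ n) τ = (M n).eta (ℓ n) τ - Δ τ := rfl
    -- For large n the truncation is inactive on the event: the corrected value is at most K + C₃
    -- there, while the threshold c₀ d_*^λ tends to infinity.
    have hHy : H y = (M n).eta (ℓ n) τ - Δ τ := by
      rw [hH]
      simp only [etaHat]
      rw [← hτdef, if_pos, hcorrected]
      rw [hcorrected]
      have e1 : K + C₃ ≤ c₀ * D ^ lam := by
        rw [div_le_iff₀ hc₀] at hl
        linarith
      exact (abs_sub _ _).trans ((add_le_add hclτ.eta hΔτ).trans e1)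
    have hmain := abs_eta_sub_leadTerm_le hd (h.smooth4 n) (h.eta_smooth n) (hsub n) hX1 hXD hXδ'
      hdet hK1 hP (fun i => (hb i).trans hKK') (fun i j => (hB i j).trans hKK') hη3 hy4 hτ hscore
    have hsplit : H y - T y - (η₀ - Δ σ₀) =
        ((M n).eta (ℓ n) τ - η₀ - T y) - (Δ τ - Δ σ₀) := by rw [hHy]; ring
    rw [hsplit]
    refine (abs_sub _ _).trans (add_le_add (hmain.trans (le_of_eq ?_)) hΔdiff)
    ring
  have hHb : ∀ y, |H y| ≤ (c₀ + |Cs|) * D ^ lam := by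
    intro y
    refine (abs_etaHat_le (by positivity) _).trans ?_
    rw [Real.norm_eq_abs, Real.norm_eq_abs, abs_of_nonneg (by positivity : 0 ≤ D ^ lam)] at hCs
    have := mul_le_mul_of_nonneg_right (le_abs_self Cs) (by positivity : 0 ≤ D ^ lam)
    linarith
  have hoff : ∀ᵐ y ∂((M n).law σ₀), y ∉ B n → |H y - T y - (η₀ - Δ σ₀)| ≤
      C₄ * D ^ lam + C₂ * D⁻¹ * W y ^ 3 := by
    refine Eventually.of_forall fun y _ => ?_
    have e1 := hHb y
    have e2 : |T y| ≤ C₂ * D⁻¹ * W y ^ 3 := by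
      refine (abs_leadTerm_le hd hD1 hK1 one_le_envelope hb hB hP (abs_lam1_le_envelope (δ := δ'))
        abs_lam2_le_envelope abs_lam3_le_envelope).trans (le_of_eq ?_)
      ring
    have e3 : |η₀| ≤ K := hc0.eta
    have e4 := abs_sub (H y - T y) (η₀ - Δ σ₀)
    have e5 := abs_sub (H y) (T y)
    have e6 := abs_sub η₀ (Δ σ₀)
    have e7 : K + C₃ ≤ (K + C₃) * D ^ lam := le_mul_of_one_le_right (by positivity) hDlam
    rw [hC₄]
    linarith
  have hprob : ((M n).law σ₀).real (B n)ᶜ ≤ |cB| * D ^ (-(g / 4)) := by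
    refine ENNReal.toReal_le_of_le_ofReal (by positivity) ((hcB n).trans ?_)
    refine ENNReal.ofReal_le_ofReal ?_
    have e : -(min (1 / 4) (1 - 3 / 4) * g) = -(g / 4) := by norm_num; ring
    rw [e]
    exact mul_le_mul_of_nonneg_right (le_abs_self cB) (by positivity)
  -- With t = d_*^{-(1+λ)} the sixth-moment part is of order d_*^{-2-λ}, and the probability part
  -- has the same growth d_*^λ as the truncated estimator.
  have hfin := abs_integral_le_of_split (hBm n) (hKW n).1 (fun y => one_le_envelope)
    (α := C₁ * (X ^ 3 / D ^ 3)) (β := C₃ * ε * (D ^ 2)⁻¹) (γ := C₄ * D ^ lam) (κ := C₂ * D⁻¹)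
    (t := D ^ (-(1 + lam))) (by positivity) (by positivity) (by positivity) (by positivity)
    hon hoff
  -- Since T has mean Δ(σ₀), the deterministic −Δ(σ₀) in the corrected target cancels it, and the
  -- integral is the bias itself.
  have hval : ∫ y, (H y - T y - (η₀ - Δ σ₀)) ∂((M n).law σ₀) =
      (∫ y, H y ∂((M n).law σ₀)) - η₀ := by
    have j0 : Integrable H ((M n).law σ₀) := hint n
    have j1 : Integrable (fun y => H y - T y) ((M n).law σ₀) := j0.sub hTint
    rw [integral_sub j1 (integrable_const _), integral_sub j0 hTint, hTval, integral_const,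
      probReal_univ, one_smul]
    ring
  rw [hval] at hfin
  refine hfin.trans ?_
  have r1 : C₂ * D⁻¹ * D ^ (-(1 + lam)) = C₂ * (D ^ (-lam) * (D ^ 2)⁻¹) := by
    rw [mul_assoc]
    congr 1
    rw [← Real.rpow_neg_one, ← Real.rpow_natCast D 2, ← Real.rpow_neg hD0.le,
      ← Real.rpow_add hD0, ← Real.rpow_add hD0]
    congr 1
    push_cast
    ring
  have r2 : C₂ * D⁻¹ / D ^ (-(1 + lam)) = C₂ * D ^ lam := by
    rw [mul_div_assoc]
    congr 1
    rw [← Real.rpow_neg_one, ← Real.rpow_sub hD0]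
    congr 1
    ring
  have r3 : D ^ lam * D ^ (-(g / 4)) = D ^ (-(g / 4 - 2 - lam)) * (D ^ 2)⁻¹ := by
    rw [← Real.rpow_natCast D 2, ← Real.rpow_neg hD0.le, ← Real.rpow_add hD0, ← Real.rpow_add hD0]
    congr 1
    push_cast
    ring
  rw [r1, r2, hX3]
  set u := D ^ (-1 / 4 : ℝ) with hu
  set v := D ^ (-lam) with hv
  set w := D ^ (-(g / 4 - 2 - lam)) with hw
  set i2 := (D ^ 2)⁻¹ with hi2
  have hu0 : 0 ≤ u := by positivity
  have hv0 : 0 ≤ v := by positivity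
  have hw0 : 0 ≤ w := by positivity
  have hi0 : 0 ≤ i2 := by positivity
  have s1 : (C₁ * (u * i2) + C₂ * (v * i2)) * ∫ y, W y ^ 6 ∂((M n).law σ₀) ≤
      (C₁ * (u * i2) + C₂ * (v * i2)) * KW := by
    gcongr
    exact (hKW n).2
  have s2 : (C₄ * D ^ lam + C₂ * D ^ lam) * ((M n).law σ₀).real (B n)ᶜ ≤
      (C₄ + C₂) * |cB| * (w * i2) := by
    calc _ ≤ (C₄ * D ^ lam + C₂ * D ^ lam) * (|cB| * D ^ (-(g / 4))) := by gcongr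
      _ = (C₄ + C₂) * |cB| * (D ^ lam * D ^ (-(g / 4))) := by ring
      _ = _ := by rw [r3]
  refine (add_le_add (add_le_add s1 le_rfl) s2).trans ?_
  exact sum_rates_le hC₁0 hC₂0 hC₃0 (by positivity) hKW0 hu0 hv0 hw0 hε.le hi0

end Final

end EBLUP

end

/-- If `E(a) = 0`, the MSE estimator `η̂` with the bias correction `Δ₁ + Δ₂ + Δ₃` (without `Δ₀`)
satisfies `E(η̂) = η(σ) + o(d_*⁻²)`.  The estimators `σ̂` in question exist, and the claim holds for
all of them. -/
theorem corollary4p1 {s : ℕ} (M : ℕ → EBLUP.MixedModel s)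
    (ℓ : ∀ n, EBLUP.Par s → (Fin (M n).N → ℝ) → ℝ)
    (d : ℕ → Fin s → ℝ) (σ₀ σstar : EBLUP.Par s) (g δ c₀ lam : ℝ)
    (hc₀ : 0 < c₀) (hlam : 0 < lam)
    (hσstar : ∀ n, σstar ∈ (M n).Θ)
    (hηstar : (fun n => (M n).eta (ℓ n) σstar) =O[atTop]
      fun n => EBLUP.dStar (d n) ^ lam)
    (hexp : EBLUP.ExpectationsExist M ℓ)
    (hcond : EBLUP.MSEConditions M ℓ d σ₀ g δ lam)
    (hEa : ∀ n, ∀ σ ∈ interior (M n).Θ, ∀ i,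
      ∫ y, (M n).aVec (ℓ n) σ y i ∂((M n).law σ) = 0) :
    (∃ σhat : ∀ n, (Fin (M n).N → ℝ) → EBLUP.Par s,
      EBLUP.IsScoreRoot M ℓ d σ₀ g σhat ∧ ∀ n y, σhat n y ∈ interior (M n).Θ) ∧
    ∀ σhat : ∀ n, (Fin (M n).N → ℝ) → EBLUP.Par s,
      EBLUP.IsScoreRoot M ℓ d σ₀ g σhat →
      (∀ n, AEMeasurable
        (fun y => EBLUP.etaHat (M n) (ℓ n) (d n) c₀ lam σstar (σhat n y)) ((M n).law σ₀)) →
      (∀ n, Integrable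
        (fun y => EBLUP.etaHat (M n) (ℓ n) (d n) c₀ lam σstar (σhat n y)) ((M n).law σ₀)) ∧
      (fun n => (∫ y, EBLUP.etaHat (M n) (ℓ n) (d n) c₀ lam σstar (σhat n y) ∂((M n).law σ₀))
          - (M n).eta (ℓ n) σ₀)
        =o[atTop] fun n => (EBLUP.dStar (d n) ^ 2)⁻¹ := by
  refine ⟨EBLUP.exists_scoreRoot hcond.score, fun σhat hroot hmeas => ?_⟩
  have hsc := hcond.score
  have hne : Nonempty (Fin s) := EBLUP.nonempty_of_dStar_tendsto hsc.dStar_tendsto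
  have hint : ∀ n, Integrable
      (fun y => EBLUP.etaHat (M n) (ℓ n) (d n) c₀ lam σstar (σhat n y)) ((M n).law σ₀) := by
    intro n
    have hD := EBLUP.dStar_pos (hsc.d_pos n)
    exact Integrable.of_bound (hmeas n).aestronglyMeasurable _
      (Eventually.of_forall fun y => EBLUP.abs_etaHat_le (by positivity) _)
  refine ⟨hint, ?_⟩
  obtain ⟨C, hC, hbias⟩ := EBLUP.exists_abs_bias_le hc₀ hlam hηstar hexp hcond hEa hroot hint
  have hD := hsc.dStar_tendsto
  have hlim : Tendsto (fun n => EBLUP.dStar (d n) ^ (-1 / 4 : ℝ) + EBLUP.dStar (d n) ^ (-lam) +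
      EBLUP.dStar (d n) ^ (-(g / 4 - 2 - lam))) atTop (𝓝 0) := by
    have h1 := (tendsto_rpow_neg_atTop (by norm_num : (0 : ℝ) < 1 / 4)).comp hD
    have h2 := (tendsto_rpow_neg_atTop hlam).comp hD
    -- Positivity of this exponent is exactly the assumption g > 8 + 4λ.
    have h3 := (tendsto_rpow_neg_atTop (by linarith [hcond.g_gt] : 0 < g / 4 - 2 - lam)).comp hD
    have h4 := (h1.add h2).add h3
    simp only [add_zero] at h4
    refine h4.congr fun n => ?_
    simp only [Function.comp_apply]
    norm_num
  rw [isLittleO_iff]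
  intro e he
  -- The bias bound is C times at most 2ε: one ε for the vanishing rates, one for the closeness.
  -- Dividing by C + 1 instead of C allows C = 0.
  set ε := min 1 (e / (2 * (C + 1))) with hε
  have hε0 : 0 < ε := by positivity
  filter_upwards [hbias ε hε0 (min_le_left _ _), hlim.eventually_le_const hε0] with n h1 h2
  have hDn := EBLUP.dStar_pos (hsc.d_pos n)
  have hi : 0 ≤ (EBLUP.dStar (d n) ^ 2)⁻¹ := by positivity
  rw [Real.norm_eq_abs, Real.norm_eq_abs, abs_of_nonneg hi]
  refine h1.trans (mul_le_mul_of_nonneg_right ?_ hi)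
  have h3 : ε ≤ e / (2 * (C + 1)) := min_le_right _ _
  calc _ ≤ C * (ε + ε) := by gcongr
    _ ≤ (C + 1) * (e / (2 * (C + 1)) + e / (2 * (C + 1))) := by gcongr; linarith
    _ = e := by field_simp; norm_num
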